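/- Let $D\subset\mathbb{C}$ be the open unit disk, $dA$ the Lebesgue area measure on $D$ normalized so that $A(D)=1$, and $L_h^2$ the closed subspace of $L^2(D,dA)$ consisting of the (complex-valued) harmonic functions on $D$. Let $$Qf(z)=\int_D\left(\frac1{(1-z\bar w)^2}+\frac1{(1-\bar z w)^2}-1\right)f(w)\,dA(w),$$ which for $f\in L^2(D,dA)$ is the orthogonal projection onto $L_h^2$ and which makes sense for all $f\in L^1(D,dA)$. A function $F\in L^1(D,dA)$ is called a T-function if $p\mapsto Q(Fp)$, defined on the harmonic polynomials $p$ in $z,\bar z$, extends to a bounded operator on $L_h^2$; this extension is the Toeplitz operator $T_F$. A radial function $\varphi(r)$ has Mellin transform $\widehat\varphi(z)=\int_0^1\varphi(r)r^{z-1}\,dr$. If $\varphi$ is a radial T-function and $k\in\mathbb{Z}$, then $e^{ik\theta}\varphi(r)$ is a T-function as well; the function $e^{ik\theta}r^m$ is a T-function for all $k\in\mathbb Z$ and all real $m\ge-1$. Write $[S,T]=ST-TS$ and $(x\otimes y)h=\langle h,y\rangle x$. An operator $A$ has finite rank if the closure of its range $\mathrm{Ran}(A)$ has finite dimension, and $\mathrm{rank}(A)=\dim\mathrm{Ran}(A)$.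 Functions on $D$ are identified if they agree almost everywhere, and $\mathbb N=\{0,1,2,\dots\}$. For $k_1,k_2\in\mathbb{Z}$ put $N_1=\max\{0,-k_1,-k_2,-k_1-k_2\}$, $$\Lambda_1=\left\{k\in\mathbb{Z}:-N_1+1\le k\le N_1+k_1+k_2-1,\ k\ne\tfrac{k_1+k_2}2\right\},\qquad \Lambda_{1/2}=\left\{k\in\mathbb{Z}:\tfrac{k_1+k_2}2<k\le N_1+k_1+k_2-1\right\}.$$ **Theorem.** Let $k_1,k_2\in\mathbb{Z}$, let $m\in\mathbb{R}$ with $m\ge-1$, and let $\varphi$ be a nonzero radial T-function. Then the commutator $A=\left[T_{e^{ik_1\theta}r^m},T_{e^{ik_2\theta}\varphi}\right]$ on $L_h^2$ has finite rank if and only if one of the following conditions holds for some constant $C\in\mathbb{C}$, where the formulas for $\widehat\varphi(z)$ are required for all $z$ with $\mathrm{Re}\,z\ge2$ (and $1/\Gamma$ is $0$ at the poles of $\Gamma$): 1. $k_1=m=0$. 2. $k_2=0$ and $\varphi=C$. 3. $k_1=k_2=0$. 4. $k_1=k_2\ne0$ and $\varphi=Cr^m$. 5. $k_1k_2=-1$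 and $\varphi=C\left(\frac{m+1}2r^{-1}-\frac{m-1}2r\right)$. 6. $k_1k_2<-1$, $|k_2|\ge2$, $m+|k_1|=0$ and $\varphi=Cr^{|k_2|}$. 7. $k_1k_2<-1$, $|k_2|=1$ and $$\widehat\varphi(z)=C\,\frac{\Gamma\left(\frac{z-1}{2|k_1|}\right)\Gamma\left(\frac{z+m+|k_1|+1}{2|k_1|}\right)}{\Gamma\left(\frac{z+2|k_1|+1}{2|k_1|}\right)\Gamma\left(\frac{z+m+|k_1|-1}{2|k_1|}\right)}.$$ 8. $k_1k_2>0$, $k_1\ne k_2$, $|k_2|<m+|k_1|+2$ and $$\widehat\varphi(z)=C\,\frac{\Gamma\left(\frac{z+|k_2|}{2|k_1|}\right)\Gamma\left(\frac{z+m+|k_1|-|k_2|}{2|k_1|}\right)}{\Gamma\left(\frac{z+2|k_1|-|k_2|}{2|k_1|}\right)\Gamma\left(\frac{z+m+|k_1|+|k_2|}{2|k_1|}\right)}.$$ 9. $k_1k_2>0$, $|k_2|\ge m+|k_1|+2$, and for some $n\in\mathbb{N}$, $m=(2n+1)|k_1|$ and $$\widehat\varphi(z)=C\,\frac{\prod_{j=1}^n\left(\frac{z-|k_2|}{2|k_1|}+j\right)}{\prod_{j=0}^n\left(\frac{z+|k_2|}{2|k_1|}+j\right)}.$$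 Under each of the conditions (1)–(5), $A=0$, that is, $\mathrm{rank}(A)=0$. Under each of the conditions (6)–(9), $$\mathrm{Ran}(A)=\mathrm{span}\left\{r^{|k|}e^{ik\theta}:k\in\Lambda_1\right\},$$ there are nonzero constants $C_k$ $(k\in\Lambda_{1/2})$ with $$A=\sum_{k\in\Lambda_{1/2}}C_k\left[\left(r^{|k|}e^{ik\theta}\right)\otimes\left(r^{|k-k_1-k_2|}e^{i(k-k_1-k_2)\theta}\right)-\left(r^{|-k+k_1+k_2|}e^{i(-k+k_1+k_2)\theta}\right)\otimes\left(r^{|-k|}e^{-ik\theta}\right)\right],$$ and $\mathrm{rank}(A)=|k_1|+|k_2|-1$ if $k_1+k_2$ is odd, $\mathrm{rank}(A)=|k_1|+|k_2|-2$ if $k_1+k_2$ is even. -/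

import Mathlib

open MeasureTheory
open scoped ComplexConjugate

noncomputable section

namespace HarmonicToeplitz

/-- Lebesgue area measure on the open unit disk, normalized so that the disk has measure `1`. -/
def diskMeasure : Measure ℂ :=
  (volume (Metric.ball (0 : ℂ) 1))⁻¹ • volume.restrict (Metric.ball (0 : ℂ) 1)

instance : IsFiniteMeasure diskMeasure := by
  constructor
  simp only [diskMeasure, Measure.smul_apply, Measure.restrict_apply_univ, smul_eq_mul]
  have h0 : volume (Metric.ball (0 : ℂ) 1) ≠ 0 := (Metric.measure_ball_pos _ _ one_pos).ne'
  have h1 : volume (Metric.ball (0 : ℂ) 1) ≠ ⊤ := measure_ball_lt_top.ne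
  rw [ENNReal.inv_mul_cancel h0 h1]
  exact ENNReal.one_lt_top

theorem ae_diskMeasure_mem_ball : ∀ᵐ z ∂diskMeasure, z ∈ Metric.ball (0 : ℂ) 1 :=
  Measure.ae_smul_measure (ae_restrict_mem Metric.isOpen_ball.measurableSet) _

/-- The harmonic Bergman space: the subspace of `L²` of the normalized disk consisting of the
(complex-valued) harmonic functions on the disk. -/
def harmonicBergman : Submodule ℂ (Lp ℂ 2 diskMeasure) where
  carrier := {f | ∃ g : ℂ → ℂ,
    InnerProductSpace.HarmonicOnNhd g (Metric.ball (0 : ℂ) 1) ∧ f =ᵐ[diskMeasure] g}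
  zero_mem' :=
    ⟨fun _ => 0, InnerProductSpace.harmonicOnNhd_const 0, Lp.coeFn_zero ℂ 2 diskMeasure⟩
  add_mem' := by
    rintro f₁ f₂ ⟨g₁, hg₁, h₁⟩ ⟨g₂, hg₂, h₂⟩
    exact ⟨g₁ + g₂, hg₁.add hg₂, (Lp.coeFn_add f₁ f₂).trans (h₁.add h₂)⟩
  smul_mem' := by
    rintro c f ⟨g, hg, h⟩
    refine ⟨c • g, ?_, (Lp.coeFn_smul c f).trans (h.const_smul c)⟩
    exact hg.comp_CLM ((ContinuousLinearMap.mul ℝ ℂ) c)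

/-- The function `r e^{iθ} ↦ e^{ikθ} φ(r)`; its value at the origin is irrelevant. -/
def quasihomogeneous (k : ℤ) (φ : ℝ → ℂ) (z : ℂ) : ℂ :=
  Complex.exp (Complex.I * k * Complex.arg z) * φ ‖z‖

/-- The function `r e^{iθ} ↦ r^{|l|} e^{ilθ}`. -/
def harmonicMonomialFun (l : ℤ) : ℂ → ℂ :=
  quasihomogeneous l (fun r => (r : ℂ) ^ l.natAbs)

theorem harmonicMonomialFun_natCast (n : ℕ) (z : ℂ) :
    harmonicMonomialFun n z = z ^ n := by
  conv_rhs => rw [← Complex.norm_mul_exp_arg_mul_I z]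
  rw [mul_pow, ← Complex.exp_nat_mul]
  simp only [harmonicMonomialFun, quasihomogeneous, Int.natAbs_natCast, Int.cast_natCast]
  rw [mul_comm]
  congr 2
  ring

theorem harmonicMonomialFun_neg_natCast (n : ℕ) (z : ℂ) :
    harmonicMonomialFun (-n) z = conj (z ^ n) := by
  conv_rhs => rw [← Complex.norm_mul_exp_arg_mul_I z]
  rw [mul_pow, ← Complex.exp_nat_mul, map_mul, map_pow, Complex.conj_ofReal, ← Complex.exp_conj]
  simp only [harmonicMonomialFun, quasihomogeneous, Int.natAbs_neg, Int.natAbs_natCast,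
    Int.cast_neg, Int.cast_natCast, map_mul, map_natCast, Complex.conj_ofReal, Complex.conj_I]
  rw [mul_comm]
  congr 2
  ring

theorem harmonicOnNhd_harmonicMonomialFun (l : ℤ) (s : Set ℂ) :
    InnerProductSpace.HarmonicOnNhd (harmonicMonomialFun l) s := by
  have key : ∀ n : ℕ, InnerProductSpace.HarmonicOnNhd (fun z : ℂ => z ^ n) s := fun n z _ =>
    AnalyticAt.harmonicAt (by fun_prop)
  obtain ⟨n, rfl | rfl⟩ := l.eq_nat_or_neg
  · have : harmonicMonomialFun n = fun z => z ^ n := funext (harmonicMonomialFun_natCast n)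
    rw [this]
    exact key n
  · have : harmonicMonomialFun (-n) = Complex.conjCLE ∘ fun z : ℂ => z ^ n :=
      funext (harmonicMonomialFun_neg_natCast n)
    rw [this]
    exact (key n).comp_CLM Complex.conjCLE.toContinuousLinearMap

theorem memLp_harmonicMonomialFun (l : ℤ) : MemLp (harmonicMonomialFun l) 2 diskMeasure := by
  refine MemLp.of_bound (C := 1) ?_ ?_
  · have hc : Continuous (harmonicMonomialFun l) := by
      rw [← continuousOn_univ]
      exact (harmonicOnNhd_harmonicMonomialFun l Set.univ).continuousOn
    exact hc.aestronglyMeasurable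
  · filter_upwards [ae_diskMeasure_mem_ball] with z hz
    have hz' : ‖z‖ ≤ 1 := (mem_ball_zero_iff.mp hz).le
    obtain ⟨n, rfl | rfl⟩ := l.eq_nat_or_neg
    · rw [harmonicMonomialFun_natCast, norm_pow]
      exact pow_le_one₀ (norm_nonneg _) hz'
    · rw [harmonicMonomialFun_neg_natCast, RCLike.norm_conj, norm_pow]
      exact pow_le_one₀ (norm_nonneg _) hz'

/-- The element `r^{|l|} e^{ilθ}` of the harmonic Bergman space. -/
def harmonicMonomial (l : ℤ) : harmonicBergman :=
  ⟨(memLp_harmonicMonomialFun l).toLp _, harmonicMonomialFun l,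
    harmonicOnNhd_harmonicMonomialFun l _, MemLp.coeFn_toLp _⟩

/-- The harmonic polynomials in `z` and `conj z`. -/
def harmonicPolynomials : Submodule ℂ harmonicBergman :=
  Submodule.span ℂ (Set.range harmonicMonomial)

/-- The integral operator `Q` that represents the orthogonal projection of `L²` of the disk onto
the harmonic Bergman space; the same formula makes sense on `L¹` of the disk. -/
def harmonicProjection (f : ℂ → ℂ) (z : ℂ) : ℂ :=
  ∫ w, (1 / (1 - z * conj w) ^ 2 + 1 / (1 - conj z * w) ^ 2 - 1) * f w ∂diskMeasure

/-- `T` is a bounded operator on the harmonic Bergman space that extends the operator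
`p ↦ Q (F p)`, which is defined on the harmonic polynomials. -/
def IsToeplitzExtension (F : ℂ → ℂ) (T : harmonicBergman →L[ℂ] harmonicBergman) : Prop :=
  ∀ p ∈ harmonicPolynomials,
    ((T p : Lp ℂ 2 diskMeasure) : ℂ → ℂ) =ᵐ[diskMeasure]
      harmonicProjection (fun w => F w * ((p : Lp ℂ 2 diskMeasure) : ℂ → ℂ) w)

/-- `F` is a T-function: it is integrable on the disk and `p ↦ Q (F p)` defines a bounded
operator on the harmonic Bergman space. -/
def IsTFunction (F : ℂ → ℂ) : Prop :=
  Integrable F diskMeasure ∧ ∃ T, IsToeplitzExtension F T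

open Classical in
/-- The Toeplitz operator of a T-function `F` (with the value `0` if `F` is not a T-function). -/
def toeplitz (F : ℂ → ℂ) : harmonicBergman →L[ℂ] harmonicBergman :=
  if h : IsTFunction F then h.2.choose else 0

/-- The commutator `S T - T S` of two bounded operators. -/
def operatorCommutator (S T : harmonicBergman →L[ℂ] harmonicBergman) :
    harmonicBergman →L[ℂ] harmonicBergman :=
  S ∘L T - T ∘L S

/-- An operator has finite rank if the closure of its range has finite dimension. -/
def HasFiniteRank (A : harmonicBergman →L[ℂ] harmonicBergman) : Prop :=
  FiniteDimensional ℂ (LinearMap.range A.toLinearMap).topologicalClosure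

/-- The rank of an operator, as a cardinal: the dimension of its range. -/
def operatorRank (A : harmonicBergman →L[ℂ] harmonicBergman) : Cardinal :=
  Module.rank ℂ (LinearMap.range A.toLinearMap)

/-- The rank one operator `(x ⊗ y) h = ⟨h, y⟩ x`; Mathlib's inner product is linear in its second
argument. -/
def tensor (x y : harmonicBergman) : harmonicBergman →L[ℂ] harmonicBergman :=
  InnerProductSpace.rankOne ℂ x y

/-- The Mellin transform `∫₀¹ φ(r) r^{z-1} dr` of a radial function. -/
def mellinTransform (φ : ℝ → ℂ) (z : ℂ) : ℂ :=
  ∫ r in (0 : ℝ)..1, φ r * (r : ℂ) ^ (z - 1)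

/-- Two radial functions on the disk agree almost everywhere. -/
def RadialEq (φ ψ : ℝ → ℂ) : Prop :=
  ∀ᵐ r ∂(volume.restrict (Set.Ioo (0 : ℝ) 1)), φ r = ψ r

/-- `max {0, -k₁, -k₂, -k₁-k₂}`. -/
def boundN (k₁ k₂ : ℤ) : ℤ := max (max 0 (-k₁)) (max (-k₂) (-k₁ - k₂))

/-- The integers `k` with `-N+1 ≤ k ≤ N+k₁+k₂-1` and `k ≠ (k₁+k₂)/2`, where `N = boundN k₁ k₂`. -/
def indexSet (k₁ k₂ : ℤ) : Set ℤ :=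
  {k | -boundN k₁ k₂ + 1 ≤ k ∧ k ≤ boundN k₁ k₂ + k₁ + k₂ - 1 ∧ (k : ℚ) ≠ (k₁ + k₂) / 2}

/-- The integers `k` with `(k₁+k₂)/2 < k ≤ N+k₁+k₂-1`, where `N = boundN k₁ k₂`. -/
def halfIndexSet (k₁ k₂ : ℤ) : Finset ℤ :=
  Finset.Ioc ⌊((k₁ + k₂ : ℤ) : ℚ) / 2⌋ (boundN k₁ k₂ + k₁ + k₂ - 1)

theorem mem_halfIndexSet (k₁ k₂ k : ℤ) :
    k ∈ halfIndexSet k₁ k₂ ↔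
      ((k₁ + k₂ : ℤ) : ℚ) / 2 < k ∧ k ≤ boundN k₁ k₂ + k₁ + k₂ - 1 := by
  rw [halfIndexSet, Finset.mem_Ioc, Int.floor_lt]

/-- The five cases in which the commutator vanishes. -/
def VanishingCase (k₁ k₂ : ℤ) (m : ℝ) (φ : ℝ → ℂ) : Prop :=
  (k₁ = 0 ∧ m = 0) ∨
  (k₂ = 0 ∧ ∃ C : ℂ, RadialEq φ (fun _ => C)) ∨
  (k₁ = 0 ∧ k₂ = 0) ∨
  (k₁ = k₂ ∧ k₂ ≠ 0 ∧ ∃ C : ℂ, RadialEq φ (fun r => C * ((r ^ m : ℝ) : ℂ))) ∨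
  (k₁ * k₂ = -1 ∧ ∃ C : ℂ, RadialEq φ (fun r =>
    C * ((m + 1) / 2 * (r : ℂ)⁻¹ - (m - 1) / 2 * (r : ℂ))))

/-- The four cases in which the commutator is a nonzero operator of finite rank. In the third
case an argument of a Gamma function in the denominator can be a pole of that function; the
quotient is then `0`, in agreement with the entire function `1/Γ`. -/
def NonvanishingCase (k₁ k₂ : ℤ) (m : ℝ) (φ : ℝ → ℂ) : Prop :=
  (k₁ * k₂ < -1 ∧ 2 ≤ |k₂| ∧ m + (|k₁| : ℤ) = 0 ∧
    ∃ C : ℂ, RadialEq φ (fun r => C * (r : ℂ) ^ k₂.natAbs)) ∨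
  (k₁ * k₂ < -1 ∧ |k₂| = 1 ∧
    ∃ C : ℂ, ∀ z : ℂ, 2 ≤ z.re → mellinTransform φ z =
      C * ((Complex.Gamma ((z - 1) / (2 * |k₁|)) *
            Complex.Gamma ((z + m + |k₁| + 1) / (2 * |k₁|))) /
          (Complex.Gamma ((z + 2 * |k₁| + 1) / (2 * |k₁|)) *
            Complex.Gamma ((z + m + |k₁| - 1) / (2 * |k₁|))))) ∨
  (0 < k₁ * k₂ ∧ k₁ ≠ k₂ ∧ (|k₂| : ℤ) < m + (|k₁| : ℤ) + 2 ∧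
    ∃ C : ℂ, ∀ z : ℂ, 2 ≤ z.re → mellinTransform φ z =
      C * ((Complex.Gamma ((z + |k₂|) / (2 * |k₁|)) *
            Complex.Gamma ((z + m + |k₁| - |k₂|) / (2 * |k₁|))) /
          (Complex.Gamma ((z + 2 * |k₁| - |k₂|) / (2 * |k₁|)) *
            Complex.Gamma ((z + m + |k₁| + |k₂|) / (2 * |k₁|))))) ∨
  (0 < k₁ * k₂ ∧ m + (|k₁| : ℤ) + 2 ≤ (|k₂| : ℤ) ∧
    ∃ n : ℕ, m = (2 * n + 1) * (|k₁| : ℤ) ∧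
      ∃ C : ℂ, ∀ z : ℂ, 2 ≤ z.re → mellinTransform φ z =
        C * ((∏ j ∈ Finset.Icc 1 n, ((z - |k₂|) / (2 * |k₁|) + j)) /
          (∏ j ∈ Finset.Icc 0 n, ((z + |k₂|) / (2 * |k₁|) + j))))

end HarmonicToeplitz

end

open HarmonicToeplitz

/-! The harmonic monomials e_l (`harmonicMonomial l`) are orthogonal and total in the harmonic
Bergman space, and the Toeplitz operator of e^{ikθ}φ sends e_l to a multiple of e_{k+l}, the
multiple being a weight times a value of the Mellin transform of φ at an integer. Hence the
commutator sends e_l to 4(|l+k₁+k₂|+1) d_l e_{l+k₁+k₂} with d_l given by `commCoeff`. It has finite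
rank exactly when d has finite support, and its range, rank and expansion into rank one operators
are all read off from the support of d and from the antisymmetry d_{-l-k₁-k₂} = -d_l.

Necessity. Changing all signs allows k₁ = p > 0, with q = k₂; the case k₁ = 0 is elementary. For
large l the equation d_l = 0 is a relation between F = φ̂ at z = 2l+q+2 and at z+2p: (z+q)(z+p-q+m)
F(z) = (z+2p-q)(z+p+q+m) F(z+2p). After division by z(z+1) the difference of the two sides is a
continuous functional applied to powers r^w on [0,1]. By Stone-Weierstrass for polynomials in r²,
vanishing along an arithmetic progression of step 2 forces vanishing in a half-plane, and by
analytic continuation on Re z ≥ 2 (`mellinTransform_functional_eq`). Dividing F by the explicit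
Gamma solution `gammaSolC` gives a function of s = z/(2p) with period 1 and polynomial growth on a
strip. It extends to an entire function, so it is a polynomial and therefore constant
(`exists_eq_const_mul_gammaSolC`). It remains to see which Gamma solutions are compatible with F
being finite on Re z ≥ 2: a zero of the left-hand factor there propagates to z+2p, z+4p, ... and
kills F, unless a right-hand factor vanishes too (`const_eq_zero_of_exceptional_zero`). Checking
this for the possible signs and sizes of q leaves precisely the nine cases.

Sufficiency and rank. In the first five cases d vanishes by direct computation. In the others F is a
multiple of the Gamma solution on the integers that matter, so d_l = 0 once l and l+q are
nonnegative, and by reflection outside the index set. On the index set d_l ≠ 0: after opening the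
absolute values, d_l = 0 becomes either a linear equation or an equality of two values of
Γ(x+d)Γ(x+b)/(Γ(x)Γ(x+b+d)), which is strictly increasing in x (`gammaCrossRatio_lt`), so that
equality would contradict the assumptions on the indices.

The operator theory behind this is the expansion of the kernel of Q into harmonic monomials, the
completeness of these monomials, and a decay estimate for Mellin coefficients which shows that
e^{ikθ}φ is a T-function whenever φ is. -/

namespace HarmonicToeplitz

/-! ### Quotients of Gamma functions -/

/-- The quotient `Γ(x+d) Γ(x+b) / (Γ(x) Γ(x+b+d))`. -/
noncomputable def gammaCrossRatio (b d x : ℝ) : ℝ :=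
  Real.Gamma (x + d) * Real.Gamma (x + b) / (Real.Gamma x * Real.Gamma (x + b + d))

/-- These quotients are the factors of the infinite product for `gammaCrossRatio`. Each is 1 minus a
decreasing positive term, so monotonicity can be checked factor by factor. -/
theorem crossRatio_lt {b d x y : ℝ} (hb : 0 < b) (hd : 0 < d) (hx : 0 < x) (hxy : x < y) :
    x * (x + b + d) / ((x + d) * (x + b)) < y * (y + b + d) / ((y + d) * (y + b)) := by
  have hy := hx.trans hxy
  have h : ∀ u : ℝ, 0 < u →
      u * (u + b + d) / ((u + d) * (u + b)) = 1 - b * d / ((u + d) * (u + b)) := by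
    intro u hu
    have h1 : u + d ≠ 0 := by positivity
    have h2 : u + b ≠ 0 := by positivity
    field_simp
    ring
  rw [h x hx, h y hy]
  gcongr

/-- Gauss's limit formula applied to all four Gamma factors. The factorials cancel, and so do the
powers of n, because the arguments in the numerator and in the denominator have the same sum. -/
theorem gammaCrossRatio_tendsto {b d x : ℝ} (hb : 0 < b) (hd : 0 < d) (hx : 0 < x) :
    Filter.Tendsto (fun n : ℕ => ∏ j ∈ Finset.range (n + 1),
      ((x + j) * (x + j + b + d) / ((x + j + d) * (x + j + b)))) Filter.atTop
      (nhds (gammaCrossRatio b d x)) := by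
  have h1 := (((Real.GammaSeq_tendsto_Gamma (x + d)).mul
    (Real.GammaSeq_tendsto_Gamma (x + b))).div ((Real.GammaSeq_tendsto_Gamma x).mul
    (Real.GammaSeq_tendsto_Gamma (x + b + d)))
    (mul_pos (Real.Gamma_pos_of_pos hx) (Real.Gamma_pos_of_pos (by positivity))).ne')
  refine h1.congr' ?_
  filter_upwards [Filter.eventually_gt_atTop 0] with n hn
  have hn' : (0 : ℝ) < n := by exact_mod_cast hn
  simp only [Pi.div_apply, Real.GammaSeq, Finset.prod_div_distrib,
    Finset.prod_mul_distrib]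
  have p1 : ∏ j ∈ Finset.range (n + 1), (x + (j : ℝ)) ≠ 0 :=
    Finset.prod_ne_zero_iff.mpr fun j _ => by positivity
  have p2 : ∏ j ∈ Finset.range (n + 1), (x + d + (j : ℝ)) ≠ 0 :=
    Finset.prod_ne_zero_iff.mpr fun j _ => by positivity
  have p3 : ∏ j ∈ Finset.range (n + 1), (x + b + (j : ℝ)) ≠ 0 :=
    Finset.prod_ne_zero_iff.mpr fun j _ => by positivity
  have p4 : ∏ j ∈ Finset.range (n + 1), (x + b + d + (j : ℝ)) ≠ 0 :=
    Finset.prod_ne_zero_iff.mpr fun j _ => by positivity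
  have e2 : ∏ j ∈ Finset.range (n + 1), (x + (j : ℝ) + d) =
    ∏ j ∈ Finset.range (n + 1), (x + d + (j : ℝ)) := Finset.prod_congr rfl fun j _ => by ring
  have e3 : ∏ j ∈ Finset.range (n + 1), (x + (j : ℝ) + b) =
    ∏ j ∈ Finset.range (n + 1), (x + b + (j : ℝ)) := Finset.prod_congr rfl fun j _ => by ring
  have e4 : ∏ j ∈ Finset.range (n + 1), (x + (j : ℝ) + b + d) =
    ∏ j ∈ Finset.range (n + 1), (x + b + d + (j : ℝ)) := Finset.prod_congr rfl fun j _ => by ring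
  rw [e2, e3, e4]
  have q : (n : ℝ) ^ (x + d) * (n : ℝ) ^ (x + b) = (n : ℝ) ^ x * (n : ℝ) ^ (x + b + d) := by
    rw [← Real.rpow_add hn', ← Real.rpow_add hn']
    congr 1
    ring
  have q1 := (Real.rpow_pos_of_pos hn' (x + d)).ne'
  have q2 := (Real.rpow_pos_of_pos hn' (x + b)).ne'
  have q3 := (Real.rpow_pos_of_pos hn' x).ne'
  have q4 := (Real.rpow_pos_of_pos hn' (x + b + d)).ne'
  have f0 : ((n.factorial : ℕ) : ℝ) ≠ 0 := by positivity
  generalize (n : ℝ) ^ (x + d) = A1 at *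
  generalize (n : ℝ) ^ (x + b) = A2 at *
  generalize (n : ℝ) ^ x = A3 at *
  generalize (n : ℝ) ^ (x + b + d) = A4 at *
  field_simp
  linear_combination q

theorem gammaCrossRatio_pos {b d x : ℝ} (hb : 0 < b) (hd : 0 < d) (hx : 0 < x) :
    0 < gammaCrossRatio b d x := by
  have h1 := Real.Gamma_pos_of_pos hx
  have h2 := Real.Gamma_pos_of_pos (add_pos hx hd)
  have h3 := Real.Gamma_pos_of_pos (add_pos hx hb)
  have h4 := Real.Gamma_pos_of_pos (add_pos (add_pos hx hb) hd)
  unfold gammaCrossRatio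
  positivity

/-- Comparing the partial products termwise gives only a weak inequality in the limit. The factor
with j = 0 is therefore split off: it alone supplies a fixed ratio smaller than 1. -/
theorem gammaCrossRatio_lt {b d x y : ℝ} (hb : 0 < b) (hd : 0 < d) (hx : 0 < x) (hxy : x < y) :
    gammaCrossRatio b d x < gammaCrossRatio b d y := by
  have hy := hx.trans hxy
  have hlim := (gammaCrossRatio_tendsto hb hd hy).const_mul
    ((x * (x + b + d) / ((x + d) * (x + b))) / (y * (y + b + d) / ((y + d) * (y + b))))
  have hle : gammaCrossRatio b d x ≤ _ :=
    le_of_tendsto_of_tendsto' (gammaCrossRatio_tendsto hb hd hx) hlim fun n => by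
      rw [Finset.prod_range_succ', Finset.prod_range_succ']
      simp only [Nat.cast_zero, add_zero]
      have hy0 : y * (y + b + d) / ((y + d) * (y + b)) ≠ 0 := by positivity
      have : ∀ A B P Q : ℝ, B ≠ 0 → A / B * (Q * B) = Q * A := by
        intro A B P Q hB
        field_simp
      rw [this _ _ 0 _ hy0]
      have hx0 : 0 ≤ x * (x + b + d) / ((x + d) * (x + b)) := by positivity
      refine mul_le_mul_of_nonneg_right ?_ hx0
      refine Finset.prod_le_prod (fun j _ => by positivity) fun j _ => ?_
      exact (crossRatio_lt hb hd (by positivity) (by linarith)).le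
  refine hle.trans_lt ?_
  have hy0 : 0 < y * (y + b + d) / ((y + d) * (y + b)) := by positivity
  have := crossRatio_lt hb hd hx hxy
  have h1 : (x * (x + b + d) / ((x + d) * (x + b))) / (y * (y + b + d) / ((y + d) * (y + b))) < 1 :=
    (div_lt_one hy0).mpr this
  nlinarith [gammaCrossRatio_pos hb hd hy]

theorem gammaCrossRatio_injOn {b d x y : ℝ} (hb : 0 < b) (hd : 0 < d) (hx : 0 < x) (hy : 0 < y)
    (h : gammaCrossRatio b d x = gammaCrossRatio b d y) : x = y := by
  rcases lt_trichotomy x y with h1 | h1 | h1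
  · exact absurd h (gammaCrossRatio_lt hb hd hx h1).ne
  · exact h1
  · exact absurd h.symm (gammaCrossRatio_lt hb hd hy h1).ne

/-- The quotient `Γ(x) / Γ(x+b)`. -/
noncomputable def gammaQuot (b : ℝ) (x : ℝ) : ℝ := Real.Gamma x / Real.Gamma (x + b)

theorem gammaQuot_pos {b x : ℝ} (hb : 0 ≤ b) (hx : 0 < x) : 0 < gammaQuot b x :=
  div_pos (Real.Gamma_pos_of_pos hx) (Real.Gamma_pos_of_pos (by positivity))

theorem gammaQuot_add_one {b x : ℝ} (hb : 0 ≤ b) (hx : 0 < x) :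
    (x + b) * gammaQuot b (x + 1) = x * gammaQuot b x := by
  have hxb : x + b ≠ 0 := by positivity
  have h3 := (Real.Gamma_pos_of_pos (show 0 < x + b by positivity)).ne'
  rw [gammaQuot, gammaQuot, Real.Gamma_add_one hx.ne',
    show x + 1 + b = x + b + 1 by ring, Real.Gamma_add_one hxb]
  field_simp

/-- The form in which strict monotonicity is used: a vanishing coefficient of the commutator yields
exactly such a cross-multiplied identity, which says that the cross ratio agrees at x and y. -/
theorem gammaQuot_mul_injective {b d x y : ℝ} (hb : 0 < b) (hd : 0 < d) (hx : 0 < x) (hy : 0 < y)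
    (h : gammaQuot b (x + d) * gammaQuot b y = gammaQuot b x * gammaQuot b (y + d)) : x = y := by
  refine gammaCrossRatio_injOn hb hd hx hy ?_
  have g : ∀ u : ℝ, 0 < u → Real.Gamma u ≠ 0 := fun u hu => (Real.Gamma_pos_of_pos hu).ne'
  have a1 := g x hx
  have a2 := g y hy
  have a3 := g (x + d) (by positivity)
  have a4 := g (y + d) (by positivity)
  have a5 := g (x + b) (by positivity)
  have a6 := g (y + b) (by positivity)
  have a7 := g (x + b + d) (by positivity)
  have a8 := g (y + b + d) (by positivity)
  unfold gammaQuot at h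
  unfold gammaCrossRatio
  rw [show x + d + b = x + b + d by ring, show y + d + b = y + b + d by ring] at h
  rw [div_eq_div_iff (by positivity) (by positivity)]
  field_simp at h
  linear_combination h

end HarmonicToeplitz

namespace HarmonicToeplitz

/-! ### The coefficients of the commutator -/

/-- The commutator of the Toeplitz operators with symbols `e^{ik₁θ} r^m` and `e^{ik₂θ} φ` maps
`r^{|l|} e^{ilθ}` to `4 (|l + k₁ + k₂| + 1)` times this number times the harmonic monomial of index
`l + k₁ + k₂`; here `F` is the Mellin transform of `φ`. -/
def commCoeff {R : Type*} [Field R] (F : ℤ → R) (k₁ k₂ : ℤ) (m : R) (l : ℤ) : R :=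
  ((|l + k₂| : ℤ) + 1) * F (|l| + |l + k₂| + 2) / ((|l + k₂| : ℤ) + (|l + k₁ + k₂| : ℤ) + 2 + m) -
  ((|l + k₁| : ℤ) + 1) * F (|l + k₁| + |l + k₁ + k₂| + 2) / ((|l| : ℤ) + (|l + k₁| : ℤ) + 2 + m)

section Field

variable {R : Type*} [Field R] (F : ℤ → R) (k₁ k₂ : ℤ) (m : R) (l : ℤ)

/-- The substitution exchanges |l| with |l+k₁+k₂| and |l+k₁| with |l+k₂|, hence swaps the two terms.
Behind it is the symmetry of Toeplitz operators for the bilinear pairing ∫fg, which makes their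
commutator antisymmetric. -/
theorem commCoeff_reflect : commCoeff F k₁ k₂ m (-l - k₁ - k₂) = -commCoeff F k₁ k₂ m l := by
  unfold commCoeff
  rw [show -l - k₁ - k₂ + k₂ = -(l + k₁) by ring, show -l - k₁ - k₂ + k₁ + k₂ = -l by ring,
    show -l - k₁ - k₂ + k₁ = -(l + k₂) by ring, show -l - k₁ - k₂ = -(l + k₁ + k₂) by ring]
  simp only [abs_neg]
  rw [show |l + k₁ + k₂| + |l + k₁| = |l + k₁| + |l + k₁ + k₂| by ring,
    show |l + k₂| + |l| = |l| + |l + k₂| by ring]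
  ring

theorem commCoeff_neg : commCoeff F (-k₁) (-k₂) m (-l) = commCoeff F k₁ k₂ m l := by
  unfold commCoeff
  rw [show -l + -k₂ = -(l + k₂) by ring, show -l + -k₁ + -k₂ = -(l + k₁ + k₂) by ring,
    show -l + -k₁ = -(l + k₁) by ring]
  simp only [abs_neg]

/-- By the triangle inequality, F is evaluated only at integers n ≥ |k₂|+2. There the Gamma solution
has n+q and n-q positive, which is why comparing with it is legitimate even when it has poles
further to the left. -/
theorem commCoeff_congr {F G : ℤ → R} (C : R) (h : ∀ n : ℤ, |k₂| + 2 ≤ n → F n = C * G n) :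
    commCoeff F k₁ k₂ m l = C * commCoeff G k₁ k₂ m l := by
  unfold commCoeff
  rw [h (|l| + |l + k₂| + 2), h (|l + k₁| + |l + k₁ + k₂| + 2)]
  · ring
  · have := abs_sub (l + k₁ + k₂) (l + k₁)
    rw [show l + k₁ + k₂ - (l + k₁) = k₂ by ring] at this
    linarith
  · have := abs_sub (l + k₂) l
    rw [show l + k₂ - l = k₂ by ring] at this
    linarith

end Field

theorem commCoeff_ofReal (F : ℤ → ℝ) (k₁ k₂ : ℤ) (m : ℝ) (l : ℤ) :
    commCoeff (fun n => (F n : ℂ)) k₁ k₂ (m : ℂ) l = (commCoeff F k₁ k₂ m l : ℝ) := by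
  unfold commCoeff
  simp only [Complex.ofReal_sub, Complex.ofReal_div, Complex.ofReal_mul, Complex.ofReal_add,
    Complex.ofReal_intCast, Complex.ofReal_one, Complex.ofReal_ofNat]

/-- The solution of the functional equation for the Mellin transform, on the integers. -/
noncomputable def gammaSol (p q : ℤ) (m : ℝ) (n : ℤ) : ℝ :=
  gammaQuot ((p + m) / (2 * p)) ((n + q) / (2 * p)) /
    ((n - q) / (2 * p) * gammaQuot ((p + m) / (2 * p)) ((n - q) / (2 * p)))

section Gamma

variable {p q : ℤ} {m : ℝ}

/-- With b = (p+m)/(2p), X = (n+q)/(2p), Y = (n-q)/(2p), the four linear factors are 2p times X,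
Y+b, Y+1, X+b, and shifting n by 2p shifts X and Y by 1. The claim is then the recursion for
Γ(x)/Γ(x+b), used at X and at Y. -/
theorem gammaSol_functional_eq (hp : 0 < p) (hpm : 0 ≤ p + m) {n : ℤ} (hn : |q| + 2 ≤ n) :
    ((n : ℝ) + q) * (n + p - q + m) * gammaSol p q m n =
      (n + 2 * p - q) * (n + p + q + m) * gammaSol p q m (n + 2 * p) := by
  have hp' : (0 : ℝ) < p := by exact_mod_cast hp
  have hq := abs_le.mp (show |q| ≤ n - 2 by linarith)
  have h1 : (0 : ℝ) < n + q := by exact_mod_cast (by linarith [hq.1] : 0 < n + q)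
  have h2 : (0 : ℝ) < n - q := by exact_mod_cast (by linarith [hq.2] : 0 < n - q)
  unfold gammaSol
  set b : ℝ := (p + m) / (2 * p) with hb
  have hb0 : 0 ≤ b := by positivity
  have hX : 0 < ((n : ℝ) + q) / (2 * p) := by positivity
  have hY : 0 < ((n : ℝ) - q) / (2 * p) := by positivity
  have e1 : (((n + 2 * p : ℤ) : ℝ) + q) / (2 * p) = (n + q) / (2 * p) + 1 := by
    push_cast; field_simp; ring
  have e2 : (((n + 2 * p : ℤ) : ℝ) - q) / (2 * p) = (n - q) / (2 * p) + 1 := by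
    push_cast; field_simp; ring
  rw [e1, e2]
  have g1 := gammaQuot_add_one hb0 hX
  have g2 := gammaQuot_add_one hb0 hY
  have q1 := gammaQuot_pos hb0 hX
  have q2 := gammaQuot_pos hb0 hY
  have q3 := gammaQuot_pos hb0 (show 0 < ((n : ℝ) + q) / (2 * p) + 1 by positivity)
  have q4 := gammaQuot_pos hb0 (show 0 < ((n : ℝ) - q) / (2 * p) + 1 by positivity)
  have f1 : (n : ℝ) + q = 2 * p * ((n + q) / (2 * p)) := by field_simp
  have f2 : (n : ℝ) + p - q + m = 2 * p * ((n - q) / (2 * p) + b) := by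
    rw [hb]; field_simp; ring
  have f3 : (n : ℝ) + 2 * p - q = 2 * p * ((n - q) / (2 * p) + 1) := by field_simp; ring
  have f4 : (n : ℝ) + p + q + m = 2 * p * ((n + q) / (2 * p) + b) := by
    rw [hb]; field_simp; ring
  rw [f2, f3, f4, show ((n : ℝ) + q) * (2 * p * ((n - q) / (2 * p) + b)) =
    2 * p * ((n + q) / (2 * p)) * (2 * p * ((n - q) / (2 * p) + b)) by rw [← f1]]
  generalize ((n : ℝ) + q) / (2 * p) = X at *
  generalize ((n : ℝ) - q) / (2 * p) = Y at *
  generalize gammaQuot b X = A1 at *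
  generalize gammaQuot b Y = A2 at *
  generalize gammaQuot b (X + 1) = A3 at *
  generalize gammaQuot b (Y + 1) = A4 at *
  field_simp
  linear_combination (-A2 * Y) * g1 + A1 * X * g2

/-- All four absolute values open with a plus sign, and the vanishing is the functional equation at
n = 2l+q+2, divided by 2. -/
theorem commCoeff_gammaSol_eq_zero (hp : 0 < p) (hpm : 0 ≤ p + m) {l : ℤ} (hl : 0 ≤ l)
    (hlq : 0 ≤ l + q) : commCoeff (gammaSol p q m) p q m l = 0 := by
  have hp' : (0 : ℝ) < p := by exact_mod_cast hp
  have h1 : (0 : ℝ) ≤ l := by exact_mod_cast hl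
  have h2 : (0 : ℝ) ≤ l + q := by exact_mod_cast hlq
  unfold commCoeff
  rw [abs_of_nonneg hl, abs_of_nonneg hlq, abs_of_nonneg (show 0 ≤ l + p by linarith),
    abs_of_nonneg (show 0 ≤ l + p + q by linarith)]
  have hn : |q| + 2 ≤ l + (l + q) + 2 := by
    have : |q| ≤ l + (l + q) := abs_le.mpr ⟨by linarith, by linarith⟩
    linarith
  have := gammaSol_functional_eq (m := m) hp hpm hn
  rw [show l + p + (l + p + q) + 2 = l + (l + q) + 2 + 2 * p by ring]
  generalize gammaSol p q m (l + (l + q) + 2) = A1 at *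
  generalize gammaSol p q m (l + (l + q) + 2 + 2 * p) = A2 at *
  push_cast at this ⊢
  have d1 : (l : ℝ) + q + (l + p + q) + 2 + m ≠ 0 := by linarith
  have d2 : (l : ℝ) + (l + p) + 2 + m ≠ 0 := by linarith
  rw [sub_eq_zero, div_eq_div_iff d1 d2]
  linear_combination this / 2

/-- First sign pattern: only l itself is negative. Vanishing reduces to `gammaQuot_mul_injective` at
X = (q-x+1)/p and Y = (p-x+1)/p with shift x/p, and X = Y would mean p = q. -/
theorem commCoeff_gammaSol_near (hp : 0 < p) (hpm : 0 < p + m) (hpq : p ≠ q) {x : ℤ} (hx : 0 < x)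
    (hxp : x ≤ p) (hxq : x ≤ q) : commCoeff (gammaSol p q m) p q m (-x) ≠ 0 := by
  have hp' : (0 : ℝ) < p := by exact_mod_cast hp
  have hx' : (0 : ℝ) < x := by exact_mod_cast hx
  have hxp' : (0 : ℝ) ≤ p - x := by exact_mod_cast (by linarith : 0 ≤ p - x)
  have hxq' : (0 : ℝ) ≤ q - x := by exact_mod_cast (by linarith : 0 ≤ q - x)
  unfold commCoeff
  rw [abs_of_nonpos (show -x ≤ 0 by linarith), abs_of_nonneg (show 0 ≤ -x + q by linarith),
    abs_of_nonneg (show 0 ≤ -x + p by linarith), abs_of_nonneg (show 0 ≤ -x + p + q by linarith)]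
  unfold gammaSol
  set b : ℝ := (p + m) / (2 * p) with hb
  have hb0 : 0 < b := by positivity
  set X : ℝ := (q - x + 1) / p with hX
  set Y : ℝ := (p - x + 1) / p with hY
  have hX0 : 0 < X := by positivity
  have hY0 : 0 < Y := by positivity
  have hd0 : 0 < (x : ℝ) / p := by positivity
  push_cast
  rw [show (- -(x : ℝ) + (-x + q) + 2 + q) / (2 * p) = X + x / p by rw [hX]; field_simp; ring,
    show (- -(x : ℝ) + (-x + q) + 2 - q) / (2 * p) = 1 / p by field_simp; ring,
    show (-(x : ℝ) + p + (-x + p + q) + 2 + q) / (2 * p) = X + 1 by rw [hX]; field_simp; ring,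
    show (-(x : ℝ) + p + (-x + p + q) + 2 - q) / (2 * p) = Y by rw [hY]; field_simp; ring,
    show -(x : ℝ) + q + 1 = p * X by rw [hX]; field_simp; ring,
    show -(x : ℝ) + p + 1 = p * Y by rw [hY]; field_simp; ring,
    show -(x : ℝ) + q + (-x + p + q) + 2 + m = 2 * p * (X + b) by rw [hX, hb]; field_simp; ring,
    show - -(x : ℝ) + (-x + p) + 2 + m = 2 * p * (1 / p + b) by rw [hb]; field_simp; ring]
  -- The recursion at X and at 1/p removes the values at X+1 and 1/p, since 1/p + 1 = Y + x/p. What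
  -- remains are the four values needed for the injectivity lemma.
  have g1 := gammaQuot_add_one hb0.le hX0
  have g2 := gammaQuot_add_one hb0.le (show 0 < 1 / (p : ℝ) by positivity)
  rw [show 1 / (p : ℝ) + 1 = Y + x / p by rw [hY]; field_simp; ring] at g2
  have q1 := gammaQuot_pos hb0.le hX0
  have q2 := gammaQuot_pos hb0.le hY0
  have q3 := gammaQuot_pos hb0.le (show 0 < 1 / (p : ℝ) by positivity)
  have q4 := gammaQuot_pos hb0.le (show 0 < Y + x / p by positivity)
  intro h
  have key : X = Y := by
    refine gammaQuot_mul_injective hb0 hd0 hX0 hY0 ?_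
    generalize gammaQuot b X = A1 at *
    generalize gammaQuot b Y = A2 at *
    generalize gammaQuot b (X + 1) = A3 at *
    generalize gammaQuot b (X + x / p) = A5 at *
    generalize gammaQuot b (Y + x / p) = A4 at *
    have hp0 : 1 / (p : ℝ) ≠ 0 := by positivity
    have hA3 : A3 = X * A1 / (X + b) := by
      rw [eq_div_iff (by positivity)]; linear_combination g1
    have hA : gammaQuot b (1 / (p : ℝ)) = (1 / p + b) * A4 / (1 / p) := by
      rw [eq_div_iff (by positivity)]; linear_combination -g2
    rw [hA, hA3] at h
    have hpb : 1 / (p : ℝ) + b ≠ 0 := by positivity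
    have hXb : X + b ≠ 0 := by positivity
    generalize 1 / (p : ℝ) + b = B at *
    generalize 1 / (p : ℝ) = B' at *
    field_simp at h
    rw [mul_zero] at h
    have h3 := (mul_eq_zero.mp h).resolve_left hX0.ne'
    linarith
  rw [hX, hY, div_left_inj' hp'.ne'] at key
  apply hpq
  have : (p : ℝ) = q := by linarith
  exact_mod_cast this

/-- Second sign pattern: -x and -x+q are nonpositive, the other two indices nonnegative. The two
denominators both equal p+2+m and drop out, and the injectivity lemma with shift q/p shows that only
the fixed point 2x = p+q of the reflection could give zero. -/
theorem commCoeff_gammaSol_far (hp : 0 < p) (hpm : 0 < p + m) (hq : q ≠ 0) {x : ℤ} (hx : 0 ≤ x)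
    (hxp : x ≤ p) (hxq : q ≤ x) (hxpq : x ≤ p + q) (hne : 2 * x ≠ p + q)
    (hq1 : -1 ≤ q) (hq2 : q = -1 → x < p) :
    commCoeff (gammaSol p q m) p q m (-x) ≠ 0 := by
  have hp' : (0 : ℝ) < p := by exact_mod_cast hp
  have hx' : (0 : ℝ) ≤ x := by exact_mod_cast hx
  have hxp' : (0 : ℝ) ≤ p - x := by exact_mod_cast (by linarith : 0 ≤ p - x)
  have hxq' : (0 : ℝ) ≤ x - q := by exact_mod_cast (by linarith : 0 ≤ x - q)
  have hpq' : (0 : ℝ) ≤ p + q - x := by exact_mod_cast (by linarith : 0 ≤ p + q - x)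
  unfold commCoeff
  rw [abs_of_nonpos (show -x ≤ 0 by linarith), abs_of_nonpos (show -x + q ≤ 0 by linarith),
    abs_of_nonneg (show 0 ≤ -x + p by linarith), abs_of_nonneg (show 0 ≤ -x + p + q by linarith)]
  unfold gammaSol
  set b : ℝ := (p + m) / (2 * p) with hb
  have hb0 : 0 < b := by positivity
  set Y : ℝ := (x - q + 1) / p with hY
  set Z : ℝ := (p - x + 1) / p with hZ
  have hY0 : 0 < Y := by positivity
  have hZ0 : 0 < Z := by positivity
  push_cast
  rw [show (- -(x : ℝ) + (-(-x + q)) + 2 + q) / (2 * p) = Y + q / p by rw [hY]; field_simp; ring,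
    show (- -(x : ℝ) + (-(-x + q)) + 2 - q) / (2 * p) = Y by rw [hY]; field_simp; ring,
    show (-(x : ℝ) + p + (-x + p + q) + 2 + q) / (2 * p) = Z + q / p by rw [hZ]; field_simp; ring,
    show (-(x : ℝ) + p + (-x + p + q) + 2 - q) / (2 * p) = Z by rw [hZ]; field_simp; ring,
    show -(-(x : ℝ) + q) + 1 = p * Y by rw [hY]; field_simp; ring,
    show -(x : ℝ) + p + 1 = p * Z by rw [hZ]; field_simp; ring,
    show -(-(x : ℝ) + q) + (-x + p + q) + 2 + m = p + 2 + m by ring,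
    show - -(x : ℝ) + (-x + p) + 2 + m = p + 2 + m by ring]
  have q1 := gammaQuot_pos hb0.le hY0
  have q2 := gammaQuot_pos hb0.le hZ0
  intro h
  have h' : gammaQuot b (Y + q / p) * gammaQuot b Z = gammaQuot b Y * gammaQuot b (Z + q / p) := by
    have hpm2 : (p : ℝ) + 2 + m ≠ 0 := by linarith
    generalize gammaQuot b (Y + q / p) = A3 at *
    generalize gammaQuot b (Z + q / p) = A4 at *
    generalize gammaQuot b Y = A1 at *
    generalize gammaQuot b Z = A2 at *
    field_simp at h
    rw [mul_zero] at h
    have h3 := (mul_eq_zero.mp h).resolve_left hp'.ne'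
    linarith
  have key : Y = Z := by
    -- For q = -1 the shift q/p is negative, so the injectivity lemma is applied at the shifted
    -- points with d = 1/p. These points are (x+1)/p and (p-x)/p, and the second is positive only
    -- because x < p.
    rcases hq.lt_or_gt with hq0 | hq0
    · have hq3 : q = -1 := by omega
      subst hq3
      have hxp2 : (0 : ℝ) ≤ p - x - 1 := by
        have := hq2 rfl
        exact_mod_cast (by linarith : 0 ≤ p - x - 1)
      have e1 : Y + (-1 : ℤ) / (p : ℝ) = (x + 1) / p := by
        rw [hY]; push_cast; field_simp; ring
      have e2 : Z + (-1 : ℤ) / (p : ℝ) = (p - x) / p := by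
        rw [hZ]; push_cast; field_simp; ring
      have h3 := gammaQuot_mul_injective hb0 (d := 1 / p) (by positivity)
        (x := Y + (-1 : ℤ) / (p : ℝ)) (y := Z + (-1 : ℤ) / (p : ℝ)) (by rw [e1]; positivity)
        (by rw [e2]; exact div_pos (by linarith) hp') (by
          rw [show Y + (-1 : ℤ) / (p : ℝ) + 1 / p = Y by push_cast; ring,
            show Z + (-1 : ℤ) / (p : ℝ) + 1 / p = Z by push_cast; ring]
          linear_combination -h')
      linarith
    · have hq' : (0 : ℝ) < q := by exact_mod_cast hq0
      exact gammaQuot_mul_injective hb0 (div_pos hq' hp') hY0 hZ0 h'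
  rw [hY, hZ, div_left_inj' hp'.ne'] at key
  apply hne
  have : (2 : ℝ) * x = p + q := by linarith
  exact_mod_cast this

/-- Third sign pattern: both terms involve the same value, at q+2, which is positive.
Cross-multiplying leaves the linear equation (p+q-2x)(p+m) = 0, so no Gamma inequality is needed. -/
theorem commCoeff_gammaSol_mid (hp : 0 < p) (hpm : 0 < p + m) {x : ℤ}
    (hxp : p ≤ x) (hxq : x ≤ q) (hne : 2 * x ≠ p + q) :
    commCoeff (gammaSol p q m) p q m (-x) ≠ 0 := by
  have hp' : (0 : ℝ) < p := by exact_mod_cast hp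
  have hxp' : (0 : ℝ) ≤ x - p := by exact_mod_cast (by linarith : 0 ≤ x - p)
  have hxq' : (0 : ℝ) ≤ q - x := by exact_mod_cast (by linarith : 0 ≤ q - x)
  have hq' : (0 : ℝ) ≤ q := by linarith
  unfold commCoeff
  rw [abs_of_nonpos (show -x ≤ 0 by linarith), abs_of_nonneg (show 0 ≤ -x + q by linarith),
    abs_of_nonpos (show -x + p ≤ 0 by linarith), abs_of_nonneg (show 0 ≤ -x + p + q by linarith),
    show -(-x + p) + (-x + p + q) + 2 = q + 2 by ring, show - -x + (-x + q) + 2 = q + 2 by ring]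
  have hf : gammaSol p q m (q + 2) ≠ 0 := by
    unfold gammaSol
    have hb0 : 0 ≤ ((p : ℝ) + m) / (2 * p) := by positivity
    push_cast
    have hX : 0 < ((q : ℝ) + 2 + q) / (2 * p) := by positivity
    have hY : 0 < ((q : ℝ) + 2 - q) / (2 * p) := by
      rw [show (q : ℝ) + 2 - q = 2 by ring]; positivity
    exact (div_pos (gammaQuot_pos hb0 hX) (mul_pos hY (gammaQuot_pos hb0 hY))).ne'
  generalize gammaSol p q m (q + 2) = A at *
  push_cast
  intro h
  have d1 : -(x : ℝ) + q + (-x + p + q) + 2 + m ≠ 0 := by linarith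
  have d2 : - -(x : ℝ) + -(-x + p) + 2 + m ≠ 0 := by linarith
  rw [sub_eq_zero, div_eq_div_iff d1 d2] at h
  have h2 : (q - 2 * x + p : ℝ) * (p + m) * A = 0 := by linear_combination h
  rcases mul_eq_zero.mp h2 with h3 | h3
  · rcases mul_eq_zero.mp h3 with h4 | h4
    · apply hne
      have : (2 : ℝ) * x = p + q := by linarith
      exact_mod_cast this
    · exact hpm.ne' h4
  · exact hf h3

end Gamma

end HarmonicToeplitz

namespace HarmonicToeplitz

open Filter Topology Set

/-! ### Mellin transforms of functions on the unit interval -/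

/-- Integrability of `r φ(r)` on the unit interval, that is, integrability of the radial function
`φ` on the disk. -/
def RadialIntegrable (φ : ℝ → ℂ) : Prop :=
  IntegrableOn (fun r : ℝ => (r : ℂ) * φ r) (Ioo (0 : ℝ) 1)

theorem mellinTransform_eq_setIntegral (φ : ℝ → ℂ) (z : ℂ) :
    mellinTransform φ z = ∫ r in Ioo (0 : ℝ) 1, (r : ℂ) * φ r * (r : ℂ) ^ (z - 2) := by
  rw [mellinTransform, intervalIntegral.integral_of_le zero_le_one, integral_Ioc_eq_integral_Ioo]
  refine setIntegral_congr_fun measurableSet_Ioo fun r hr => ?_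
  have h0 : (r : ℂ) ≠ 0 := Complex.ofReal_ne_zero.mpr hr.1.ne'
  rw [show z - 1 = 1 + (z - 2) by ring, Complex.cpow_add _ _ h0, Complex.cpow_one]
  ring

theorem mellinTransform_congr {φ ψ : ℝ → ℂ} (h : RadialEq φ ψ) (z : ℂ) :
    mellinTransform φ z = mellinTransform ψ z := by
  rw [mellinTransform_eq_setIntegral, mellinTransform_eq_setIntegral]
  refine integral_congr_ae ?_
  filter_upwards [h] with r hr
  rw [hr]

theorem RadialIntegrable.congr {φ ψ : ℝ → ℂ} (hφ : RadialIntegrable φ) (h : RadialEq φ ψ) :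
    RadialIntegrable ψ := by
  refine Integrable.congr hφ ?_
  filter_upwards [h] with r hr
  rw [hr]

theorem norm_ofReal_cpow_le_one {r : ℝ} (hr : r ∈ Ioo (0 : ℝ) 1) {w : ℂ} (hw : 0 ≤ w.re) :
    ‖(r : ℂ) ^ w‖ ≤ 1 := by
  rw [Complex.norm_cpow_eq_rpow_re_of_pos hr.1]
  exact Real.rpow_le_one hr.1.le hr.2.le hw

theorem aestronglyMeasurable_ofReal_cpow (w : ℂ) :
    AEStronglyMeasurable (fun r : ℝ => (r : ℂ) ^ w) (volume.restrict (Ioo (0 : ℝ) 1)) :=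
  (Measurable.pow_const Complex.measurable_ofReal w).aestronglyMeasurable

theorem RadialIntegrable.mul_cpow {φ : ℝ → ℂ} (hφ : RadialIntegrable φ) {w : ℂ} (hw : 0 ≤ w.re) :
    IntegrableOn (fun r : ℝ => (r : ℂ) * φ r * (r : ℂ) ^ w) (Ioo (0 : ℝ) 1) := by
  refine Integrable.mul_bdd (c := 1) hφ (aestronglyMeasurable_ofReal_cpow w) ?_
  filter_upwards [ae_restrict_mem measurableSet_Ioo] with r hr using norm_ofReal_cpow_le_one hr hw

theorem norm_mellinTransform_le {φ : ℝ → ℂ} (hφ : RadialIntegrable φ) {z : ℂ} (hz : 2 ≤ z.re) :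
    ‖mellinTransform φ z‖ ≤ ∫ r in Ioo (0 : ℝ) 1, ‖(r : ℂ) * φ r‖ := by
  rw [mellinTransform_eq_setIntegral]
  refine norm_integral_le_of_norm_le (Integrable.norm hφ) ?_
  filter_upwards [ae_restrict_mem measurableSet_Ioo] with r hr
  rw [norm_mul]
  exact mul_le_of_le_one_right (norm_nonneg _) (norm_ofReal_cpow_le_one hr (by simpa using hz))

theorem continuousOn_mellinTransform {φ : ℝ → ℂ} (hφ : RadialIntegrable φ) :
    ContinuousOn (mellinTransform φ) {z | 2 ≤ z.re} := by
  rw [show mellinTransform φ = fun z => ∫ r in Ioo (0 : ℝ) 1, (r : ℂ) * φ r * (r : ℂ) ^ (z - 2)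
    from funext (mellinTransform_eq_setIntegral φ)]
  refine continuousOn_of_dominated (bound := fun r : ℝ => ‖(r : ℂ) * φ r‖) (fun z hz => ?_)
    (fun z hz => ?_) (Integrable.norm hφ) ?_
  · exact (hφ.mul_cpow (by simpa using hz)).aestronglyMeasurable
  · filter_upwards [ae_restrict_mem measurableSet_Ioo] with r hr
    rw [norm_mul]
    exact mul_le_of_le_one_right (norm_nonneg _) (norm_ofReal_cpow_le_one hr (by simpa using hz))
  · filter_upwards [ae_restrict_mem measurableSet_Ioo] with r hr
    have h0 : (r : ℂ) ≠ 0 := Complex.ofReal_ne_zero.mpr hr.1.ne'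
    refine Continuous.continuousOn ?_
    exact continuous_const.mul ((continuous_id.sub continuous_const).const_cpow (Or.inl h0))

theorem differentiableOn_mellinTransform {φ : ℝ → ℂ} (hφ : RadialIntegrable φ) :
    DifferentiableOn ℂ (mellinTransform φ) {z | 2 < z.re} := by
  intro z hz
  refine DifferentiableAt.differentiableWithinAt ?_
  rw [show mellinTransform φ = fun z => ∫ r in Ioo (0 : ℝ) 1, (r : ℂ) * φ r * (r : ℂ) ^ (z - 2)
    from funext (mellinTransform_eq_setIntegral φ)]
  -- Half the distance to the line Re z = 2. On the ball of this radius Re (w-2) > ε, so r^(w-2) log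
  -- r is bounded by 1/ε uniformly in r, which dominates the derivative.
  set ε : ℝ := (z.re - 2) / 2 with hε
  have hz' : 2 < z.re := hz
  have hε0 : 0 < ε := by linarith
  have hball : ∀ w ∈ Metric.ball z ε, ε < (w - 2).re := by
    intro w hw
    have h1 : |(w - z).re| ≤ ‖w - z‖ := Complex.abs_re_le_norm _
    have h2 : ‖w - z‖ < ε := by simpa [dist_eq_norm] using hw
    have h3 := (abs_le.mp (h1.trans h2.le)).1
    simp only [Complex.sub_re, Complex.re_ofNat] at h3 ⊢
    have h4 := (abs_lt.mp (h1.trans_lt h2)).1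
    simp only [Complex.sub_re] at h4
    linarith
  refine (hasDerivAt_integral_of_dominated_loc_of_deriv_le (s := Metric.ball z ε)
    (F' := fun w (r : ℝ) => (r : ℂ) * φ r * ((r : ℂ) ^ (w - 2) * Complex.log r))
    (bound := fun r : ℝ => ‖(r : ℂ) * φ r‖ * (1 / ε)) (Metric.ball_mem_nhds z hε0)
    ?_ ?_ ?_ ?_ ?_ ?_).2.differentiableAt
  · filter_upwards [Metric.ball_mem_nhds z hε0] with w hw
    exact (hφ.mul_cpow (hε0.le.trans (hball w hw).le)).aestronglyMeasurable
  · exact hφ.mul_cpow (by simp; linarith)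
  · refine (Integrable.aestronglyMeasurable hφ).mul
      ((aestronglyMeasurable_ofReal_cpow _).mul ?_)
    exact (Complex.measurable_log.comp Complex.measurable_ofReal).aestronglyMeasurable
  · filter_upwards [ae_restrict_mem measurableSet_Ioo] with r hr w hw
    rw [norm_mul]
    refine mul_le_mul_of_nonneg_left ?_ (norm_nonneg _)
    rw [norm_mul, Complex.norm_cpow_eq_rpow_re_of_pos hr.1, ← Complex.ofReal_log hr.1.le,
      Complex.norm_real, Real.norm_eq_abs]
    have h1 := Real.abs_log_mul_self_rpow_lt r ε hr.1 hr.2.le hε0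
    rw [abs_mul, abs_of_pos (Real.rpow_pos_of_pos hr.1 _)] at h1
    have h2 : r ^ (w - 2).re ≤ r ^ ε :=
      Real.rpow_le_rpow_of_exponent_ge hr.1 hr.2.le (hball w hw).le
    nlinarith [abs_nonneg (Real.log r)]
  · exact (Integrable.norm hφ).mul_const _
  · filter_upwards [ae_restrict_mem measurableSet_Ioo] with r hr w hw
    have h0 : (r : ℂ) ≠ 0 := Complex.ofReal_ne_zero.mpr hr.1.ne'
    have := (((hasDerivAt_id w).sub_const 2).const_cpow (c := (r : ℂ)) (Or.inl h0)).const_mul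
      ((r : ℂ) * φ r)
    simpa using this

theorem integral_ofReal_cpow {w : ℂ} (hw : -1 < w.re) :
    ∫ r in Ioo (0 : ℝ) 1, (r : ℂ) ^ w = 1 / (w + 1) := by
  have h0 : w + 1 ≠ 0 := by
    intro h
    have := congrArg Complex.re h
    simp at this
    linarith
  rw [← integral_Ioc_eq_integral_Ioo, ← intervalIntegral.integral_of_le zero_le_one,
    integral_cpow (Or.inl hw)]
  simp [Complex.zero_cpow h0]

theorem mellinTransform_const_mul_cpow (C s : ℂ) {z : ℂ} (hz : 0 < (z + s).re) :
    mellinTransform (fun r => C * (r : ℂ) ^ s) z = C / (z + s) := by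
  rw [mellinTransform_eq_setIntegral]
  have : ∀ r ∈ Ioo (0 : ℝ) 1, (r : ℂ) * (C * (r : ℂ) ^ s) * (r : ℂ) ^ (z - 2) =
      C * (r : ℂ) ^ (z + s - 1) := by
    intro r hr
    have h0 : (r : ℂ) ≠ 0 := Complex.ofReal_ne_zero.mpr hr.1.ne'
    rw [show z + s - 1 = 1 + s + (z - 2) by ring, Complex.cpow_add _ _ h0,
      Complex.cpow_add _ _ h0, Complex.cpow_one]
    ring
  rw [setIntegral_congr_fun measurableSet_Ioo this, integral_const_mul,
    integral_ofReal_cpow (by simp at hz ⊢; linarith)]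
  rw [sub_add_cancel, mul_one_div]

theorem integrableOn_ofReal_cpow {w : ℂ} (hw : -1 < w.re) :
    IntegrableOn (fun r : ℝ => (r : ℂ) ^ w) (Ioo (0 : ℝ) 1) := by
  have := intervalIntegral.intervalIntegrable_cpow' (a := 0) (b := 1) hw
  rw [intervalIntegrable_iff_integrableOn_Ioo_of_le zero_le_one] at this
  exact this

theorem radialIntegrable_const_mul_cpow (C : ℂ) {s : ℂ} (hs : -2 < s.re) :
    RadialIntegrable (fun r => C * (r : ℂ) ^ s) := by
  have h := (integrableOn_ofReal_cpow (w := 1 + s) (by simp; linarith)).const_mul C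
  refine Integrable.congr h ?_
  filter_upwards [ae_restrict_mem measurableSet_Ioo] with r hr
  have h0 : (r : ℂ) ≠ 0 := Complex.ofReal_ne_zero.mpr hr.1.ne'
  rw [Complex.cpow_add _ _ h0, Complex.cpow_one]
  ring

theorem mellinTransform_add {φ ψ : ℝ → ℂ} (hφ : RadialIntegrable φ) (hψ : RadialIntegrable ψ)
    {z : ℂ} (hz : 2 ≤ z.re) :
    mellinTransform (fun r => φ r + ψ r) z = mellinTransform φ z + mellinTransform ψ z := by
  simp only [mellinTransform_eq_setIntegral]
  rw [← integral_add (hφ.mul_cpow (by simpa using hz)) (hψ.mul_cpow (by simpa using hz))]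
  congr 1
  ext r
  ring

theorem mellinTransform_neg (φ : ℝ → ℂ) (z : ℂ) :
    mellinTransform (fun r => -φ r) z = -mellinTransform φ z := by
  simp only [mellinTransform_eq_setIntegral]
  rw [← integral_neg]
  congr 1
  ext r
  ring

theorem RadialIntegrable.add {φ ψ : ℝ → ℂ} (hφ : RadialIntegrable φ) (hψ : RadialIntegrable ψ) :
    RadialIntegrable (fun r => φ r + ψ r) := by
  refine (Integrable.add hφ hψ).congr (ae_of_all _ fun r => ?_)
  simp only [Pi.add_apply]
  ring

theorem RadialIntegrable.neg {φ : ℝ → ℂ} (hφ : RadialIntegrable φ) :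
    RadialIntegrable (fun r => -φ r) := by
  refine (Integrable.neg hφ).congr (ae_of_all _ fun r => ?_)
  simp only [Pi.neg_apply]
  ring

/-! ### Uniqueness of moments -/

/-- The function `r ↦ r^w` on the unit interval. -/
noncomputable def cpowMap (w : ℂ) (hw : 0 < w.re) : C(unitInterval, ℂ) where
  toFun r := ((r : ℝ) : ℂ) ^ w
  continuous_toFun := by
    have h : Continuous fun x : ℝ => (x : ℂ) ^ w := by
      rw [continuous_iff_continuousAt]
      intro x
      exact Complex.continuousAt_ofReal_cpow_const x w (Or.inl hw)
    exact h.comp continuous_subtype_val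

/-- The function `r ↦ r²` on the unit interval. -/
def sqMap : C(unitInterval, ℂ) where
  toFun r := ((r : ℝ) : ℂ) ^ 2
  continuous_toFun := by fun_prop

/-- Stone-Weierstrass: r² is real and injective on [0,1], so polynomials in r² are dense. Steps of 2
are what the values z = 2l+q+2 provide. -/
theorem eq_zero_of_forall_sqMap_pow {L : C(unitInterval, ℂ) →L[ℂ] ℂ}
    (h : ∀ j : ℕ, L (sqMap ^ j) = 0) : L = 0 := by
  have hstar : star sqMap = sqMap := by
    ext r
    simp [sqMap]
  have hA : (StarAlgebra.adjoin ℂ {sqMap}).topologicalClosure = ⊤ := by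
    refine ContinuousMap.starSubalgebra_topologicalClosure_eq_top_of_separatesPoints _ ?_
    intro x y hxy
    refine ⟨_, ⟨sqMap, StarAlgebra.subset_adjoin ℂ _ (mem_singleton _), rfl⟩, ?_⟩
    intro hc
    apply hxy
    simp only [sqMap, ContinuousMap.coe_mk] at hc
    have hc' : (x : ℝ) ^ 2 = (y : ℝ) ^ 2 := by exact_mod_cast hc
    exact Subtype.ext ((pow_left_inj₀ x.2.1 y.2.1 two_ne_zero).mp hc')
  have hzero : ∀ f ∈ StarAlgebra.adjoin ℂ {sqMap}, L f = 0 := by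
    intro f hf
    have hf' : f ∈ (StarAlgebra.adjoin ℂ {sqMap}).toSubalgebra := hf
    rw [StarAlgebra.adjoin_toSubalgebra, star_singleton, hstar, union_self,
      Algebra.adjoin_singleton_eq_range_aeval] at hf'
    obtain ⟨P, rfl⟩ := hf'
    simp [Polynomial.aeval_eq_sum_range, map_sum, map_smul, h]
  ext f
  have hf : f ∈ (StarAlgebra.adjoin ℂ {sqMap}).topologicalClosure := hA ▸ trivial
  have hcl : IsClosed {f | L f = 0} := isClosed_eq L.continuous continuous_const
  exact (closure_minimal hzero hcl) hf

theorem cpowMap_mul_eq {a w : ℂ} (ha : 0 < a.re) (hw : 0 < w.re) :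
    cpowMap a ha * cpowMap w hw = cpowMap (a + w) (by simpa using add_pos ha hw) := by
  ext r
  simp only [cpowMap, ContinuousMap.mul_apply, ContinuousMap.coe_mk]
  by_cases hr : ((r : ℝ) : ℂ) = 0
  · have hn : ∀ u : ℂ, 0 < u.re → u ≠ 0 := by
      rintro u hu rfl
      simp at hu
    rw [hr, Complex.zero_cpow (hn a ha),
      Complex.zero_cpow (hn (a + w) (by simpa using add_pos ha hw)),
      zero_mul]
  · rw [Complex.cpow_add _ _ hr]

theorem cpowMap_mul_sqMap_pow {a : ℂ} (ha : 0 < a.re) (j : ℕ) :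
    cpowMap a ha * sqMap ^ j = cpowMap (a + 2 * j) (by simp; positivity) := by
  ext r
  simp only [cpowMap, sqMap, ContinuousMap.mul_apply, ContinuousMap.pow_apply, ContinuousMap.coe_mk]
  by_cases hr : ((r : ℝ) : ℂ) = 0
  · have hn : ∀ u : ℂ, 0 < u.re → u ≠ 0 := by
      rintro u hu rfl
      simp at hu
    rw [hr, Complex.zero_cpow (hn a ha), Complex.zero_cpow (hn (a + 2 * j) (by simp; positivity)),
      zero_mul]
  · rw [Complex.cpow_add _ _ hr, ← pow_mul]
    congr 1
    rw [← Complex.cpow_natCast]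
    push_cast
    rfl

/-- Vanishing on the powers a+2j says that the functional f ↦ L(r^a f) kills all polynomials in r².
-/
theorem mulLeft_eq_zero_of_moments {L : C(unitInterval, ℂ) →L[ℂ] ℂ} {a : ℂ} (ha : 0 < a.re)
    (h : ∀ (j : ℕ) (hj : 0 < (a + 2 * j).re), L (cpowMap (a + 2 * j) hj) = 0) :
    ∀ f, L (cpowMap a ha * f) = 0 := by
  have : L ∘L (ContinuousLinearMap.mul ℂ C(unitInterval, ℂ) (cpowMap a ha)) = 0 := by
    refine eq_zero_of_forall_sqMap_pow fun j => ?_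
    simp only [ContinuousLinearMap.comp_apply, ContinuousLinearMap.mul_apply']
    rw [cpowMap_mul_sqMap_pow]
    exact h j _
  intro f
  exact DFunLike.congr_fun this f

/-- `G(w + 2)` is the value of a continuous functional at `r^w`. -/
def IsMomentFunction (G : ℂ → ℂ) : Prop :=
  ∃ L : C(unitInterval, ℂ) →L[ℂ] ℂ, ∀ (w : ℂ) (hw : 0 < w.re), G (w + 2) = L (cpowMap w hw)

theorem IsMomentFunction.add {G H : ℂ → ℂ} (hG : IsMomentFunction G) (hH : IsMomentFunction H) :
    IsMomentFunction fun z => G z + H z := by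
  obtain ⟨L, hL⟩ := hG
  obtain ⟨M, hM⟩ := hH
  exact ⟨L + M, fun w hw => by simp [hL w hw, hM w hw]⟩

theorem IsMomentFunction.const_mul {G : ℂ → ℂ} (c : ℂ) (hG : IsMomentFunction G) :
    IsMomentFunction fun z => c * G z := by
  obtain ⟨L, hL⟩ := hG
  exact ⟨c • L, fun w hw => by simp [hL w hw]⟩

/-- The zeros say that L kills r^(a-2) times every continuous function; the function r^(z-a) is
continuous on [0,1] as soon as Re z > Re a, and the product is r^(z-2). -/
theorem IsMomentFunction.eq_zero {G : ℂ → ℂ} (hG : IsMomentFunction G) {a : ℂ} (ha : 2 < a.re)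
    (h : ∀ j : ℕ, G (a + 2 * j) = 0) {z : ℂ} (hz : a.re < z.re) : G z = 0 := by
  obtain ⟨L, hL⟩ := hG
  have ha' : 0 < (a - 2).re := by simpa using ha
  have := mulLeft_eq_zero_of_moments (L := L) ha' (fun j hj => by
    rw [← hL, ← h j]; congr 1; ring) (cpowMap (z - a) (by simpa using hz))
  rw [cpowMap_mul_eq, ← hL] at this
  rw [← this]
  congr 1
  ring

theorem exists_integral_functional {Ω : Type*} [MeasurableSpace Ω] {μ : Measure Ω} {g : Ω → ℂ}
    (hg : Integrable g μ) {ρ : Ω → unitInterval} (hρ : Measurable ρ) :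
    ∃ L : C(unitInterval, ℂ) →L[ℂ] ℂ, ∀ f, L f = ∫ ω, g ω * f (ρ ω) ∂μ := by
  have hint : ∀ f : C(unitInterval, ℂ), Integrable (fun ω => g ω * f (ρ ω)) μ := fun f =>
    Integrable.mul_bdd (c := ‖f‖) hg (f.continuous.measurable.comp hρ).aestronglyMeasurable
      (ae_of_all _ fun ω => f.norm_coe_le_norm _)
  refine ⟨LinearMap.mkContinuous
    { toFun := fun f => ∫ ω, g ω * f (ρ ω) ∂μ
      map_add' := fun f₁ f₂ => ?_
      map_smul' := fun c f => ?_ } (∫ ω, ‖g ω‖ ∂μ) fun f => ?_, fun f => rfl⟩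
  · rw [← integral_add (hint f₁) (hint f₂)]
    simp [mul_add]
  · rw [RingHom.id_apply, smul_eq_mul, ← integral_const_mul]
    congr 1
    ext ω
    simp
    ring
  · simp only [LinearMap.coe_mk, AddHom.coe_mk]
    rw [← integral_mul_const]
    refine norm_integral_le_of_norm_le (hg.norm.mul_const _) (ae_of_all _ fun ω => ?_)
    rw [norm_mul]
    exact mul_le_mul_of_nonneg_left (f.norm_coe_le_norm _) (norm_nonneg _)

theorem isMomentFunction_mellinTransform {φ : ℝ → ℂ} (hφ : RadialIntegrable φ) :
    IsMomentFunction (mellinTransform φ) := by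
  obtain ⟨L, hL⟩ := exists_integral_functional hφ
    (ρ := projIcc (0 : ℝ) 1 zero_le_one) continuous_projIcc.measurable
  refine ⟨L, fun w hw => ?_⟩
  rw [hL, mellinTransform_eq_setIntegral]
  refine setIntegral_congr_fun measurableSet_Ioo fun r hr => ?_
  simp only [cpowMap, ContinuousMap.coe_mk, projIcc_of_mem zero_le_one (Ioo_subset_Icc_self hr),
    add_sub_cancel_right]

/-- Since 1/(z+A) is the integral of s^(z+A-1) over the unit interval, the quotient is a double
integral of (rs)^(z-2) against an integrable density on the square. It defines a functional through
the map (r,s) ↦ rs. -/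
theorem isMomentFunction_mellinTransform_div {φ : ℝ → ℂ} (hφ : RadialIntegrable φ) {A : ℝ}
    (hA : 0 ≤ A) : IsMomentFunction fun z => mellinTransform φ z / (z + A) := by
  have hg : Integrable (fun x : ℝ × ℝ => (x.1 : ℂ) * φ x.1 * (x.2 : ℂ) ^ ((A : ℂ) + 1))
      ((volume.restrict (Ioo (0 : ℝ) 1)).prod (volume.restrict (Ioo (0 : ℝ) 1))) :=
    Integrable.mul_prod (f := fun r : ℝ => (r : ℂ) * φ r)
      (g := fun r : ℝ => (r : ℂ) ^ ((A : ℂ) + 1)) hφ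
      (integrableOn_ofReal_cpow (by simp; linarith))
  obtain ⟨L, hL⟩ := exists_integral_functional hg
    (ρ := fun x => projIcc (0 : ℝ) 1 zero_le_one (x.1 * x.2))
    (continuous_projIcc.measurable.comp (measurable_fst.mul measurable_snd))
  refine ⟨L, fun w hw => ?_⟩
  rw [hL]
  have h1 : mellinTransform φ (w + 2) / (w + 2 + A) =
      (∫ r in Ioo (0 : ℝ) 1, (r : ℂ) * φ r * (r : ℂ) ^ w) *
        ∫ s in Ioo (0 : ℝ) 1, (s : ℂ) ^ (A + 1 + w) := by
    rw [integral_ofReal_cpow (by simp; linarith), mellinTransform_eq_setIntegral,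
      add_sub_cancel_right, mul_one_div]
    congr 1
    ring
  refine h1.trans ?_
  rw [← integral_prod_mul (μ := volume.restrict (Ioo (0 : ℝ) 1))
    (ν := volume.restrict (Ioo (0 : ℝ) 1))]
  rw [Measure.prod_restrict]
  refine setIntegral_congr_fun (measurableSet_Ioo.prod measurableSet_Ioo) fun x hx => ?_
  obtain ⟨⟨h10, h11⟩, h20, h21⟩ := hx
  have hmem : x.1 * x.2 ∈ Icc (0 : ℝ) 1 :=
    ⟨(mul_pos h10 h20).le, mul_le_one₀ h11.le h20.le h21.le⟩
  simp only [cpowMap, ContinuousMap.coe_mk, projIcc_of_mem zero_le_one hmem]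
  have h0 : (x.2 : ℂ) ≠ 0 := Complex.ofReal_ne_zero.mpr h20.ne'
  rw [Complex.cpow_add _ _ h0, Complex.ofReal_mul, Complex.mul_cpow_ofReal_nonneg h10.le h20.le]
  ring

/-- A radial function whose Mellin transform vanishes at all large integers is zero. -/
theorem radialEq_zero_of_mellinTransform_eq_zero {φ : ℝ → ℂ} (hφ : RadialIntegrable φ) {n₀ : ℤ}
    (h : ∀ n : ℤ, n₀ ≤ n → mellinTransform φ n = 0) : RadialEq φ fun _ => 0 := by
  obtain ⟨L, hL⟩ := exists_integral_functional hφ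
    (ρ := projIcc (0 : ℝ) 1 zero_le_one) continuous_projIcc.measurable
  -- Positive, so that r^N is one of the continuous powers above, and large enough that all the
  -- exponents N+2j+2 lie in the range of the hypothesis.
  set N : ℕ := n₀.natAbs + 1
  have hN : 0 < ((N : ℕ) : ℂ).re := by
    simp only [Complex.natCast_re]
    positivity
  have key := mulLeft_eq_zero_of_moments (L := L) hN (fun j hj => by
    rw [hL, ← h (N + 2 * j + 2) (by omega), mellinTransform_eq_setIntegral]
    refine setIntegral_congr_fun measurableSet_Ioo fun r hr => ?_
    simp only [cpowMap, ContinuousMap.coe_mk, projIcc_of_mem zero_le_one (Ioo_subset_Icc_self hr)]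
    congr 2
    push_cast
    ring)
  have hint : Integrable (fun r : ℝ => (r : ℂ) * φ r * (r : ℂ) ^ (N : ℂ))
      (volume.restrict (Ioo (0 : ℝ) 1)) := hφ.mul_cpow hN.le
  -- The functional kills r^N times every continuous function, in particular times every test
  -- function, so the density r φ(r) r^N vanishes almost everywhere.
  have hae := ae_eq_zero_of_integral_contDiff_smul_eq_zero (μ := volume.restrict (Ioo (0 : ℝ) 1))
    hint.locallyIntegrable (fun f hf _ => by
      have hc : Continuous f := hf.continuous
      have := key ⟨fun r => (f r : ℂ), by fun_prop⟩
      rw [hL] at this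
      rw [← this]
      refine setIntegral_congr_fun measurableSet_Ioo fun r hr => ?_
      simp only [cpowMap, ContinuousMap.mul_apply, ContinuousMap.coe_mk, Complex.real_smul,
        projIcc_of_mem zero_le_one (Ioo_subset_Icc_self hr)]
      ring)
  unfold RadialEq
  filter_upwards [hae, ae_restrict_mem measurableSet_Ioo] with r hr hr'
  have h0 : (r : ℂ) ≠ 0 := Complex.ofReal_ne_zero.mpr hr'.1.ne'
  have h1 : (r : ℂ) ^ (N : ℂ) ≠ 0 := by simp [h0]
  simpa [h0, h1] using hr

end HarmonicToeplitz

namespace HarmonicToeplitz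

open Filter Topology Set

/-! ### Periodic functions of polynomial growth -/

/-- Cauchy's estimate on circles of radius r bounds the derivative by a multiple of (D+r)^N / r^n,
which tends to 0 as r grows. -/
theorem iteratedDeriv_eq_zero_of_norm_le {g : ℂ → ℂ} (hg : Differentiable ℂ g) {C D : ℝ} {N n : ℕ}
    (hb : ∀ s, ‖g s‖ ≤ C * (D + ‖s‖) ^ N) (hn : N < n) : iteratedDeriv n g 0 = 0 := by
  have h1 : ∀ r : ℝ, 0 < r → ‖iteratedDeriv n g 0‖ ≤ n.factorial * (C * (D + r) ^ N) / r ^ n :=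
    fun r hr => Complex.norm_iteratedDeriv_le_of_forall_mem_sphere_norm_le n hr
      hg.diffContOnCl fun z hz => by
        have : ‖z‖ = r := by simpa using hz
        rw [← this]
        exact hb z
  have h2 : Tendsto (fun r : ℝ => n.factorial * (C * (D + r) ^ N) / r ^ n) atTop (𝓝 0) := by
    have h3 : Tendsto (fun r : ℝ => (D * r⁻¹ + 1) ^ N) atTop (𝓝 ((D * 0 + 1) ^ N)) :=
      ((tendsto_inv_atTop_zero.const_mul D).add_const 1).pow N
    have h4 : Tendsto (fun r : ℝ => (r⁻¹) ^ (n - N)) atTop (𝓝 (0 ^ (n - N))) :=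
      tendsto_inv_atTop_zero.pow _
    rw [zero_pow (by omega)] at h4
    have h5 := (h3.mul h4).const_mul (n.factorial * C : ℝ)
    rw [mul_zero, mul_zero] at h5
    refine h5.congr' ?_
    filter_upwards [eventually_gt_atTop 0] with r hr
    have h6 : D * r⁻¹ + 1 = (D + r) / r := by field_simp
    have h7 : r ^ n = r ^ N * r ^ (n - N) := by rw [← pow_add]; congr 1; omega
    rw [h6, div_pow, h7, inv_pow]
    field_simp
  exact norm_le_zero_iff.mp (ge_of_tendsto h2 (by
    filter_upwards [eventually_gt_atTop 0] with r hr using h1 r hr))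

theorem exists_polynomial_eq_of_norm_le {g : ℂ → ℂ} (hg : Differentiable ℂ g) {C D : ℝ} {N : ℕ}
    (hb : ∀ s, ‖g s‖ ≤ C * (D + ‖s‖) ^ N) : ∃ P : Polynomial ℂ, ∀ s, g s = P.eval s := by
  refine ⟨∑ n ∈ Finset.range (N + 1),
    Polynomial.monomial n ((n.factorial : ℂ)⁻¹ * iteratedDeriv n g 0), fun s => ?_⟩
  have h := Complex.hasSum_taylorSeries_of_entire hg 0 s
  have h2 : HasSum (fun n : ℕ => (n.factorial : ℂ)⁻¹ • (s - 0) ^ n • iteratedDeriv n g 0)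
      (∑ n ∈ Finset.range (N + 1), (n.factorial : ℂ)⁻¹ • (s - 0) ^ n • iteratedDeriv n g 0) :=
    hasSum_sum_of_ne_finset_zero (by
      intro n hn
      rw [Finset.mem_range, not_lt] at hn
      rw [iteratedDeriv_eq_zero_of_norm_le hg hb (by omega : N < n), smul_zero, smul_zero])
  rw [h.unique h2, Polynomial.eval_finsetSum]
  refine Finset.sum_congr rfl fun n _ => ?_
  rw [Polynomial.eval_monomial, sub_zero, smul_eq_mul, smul_eq_mul]
  ring

theorem eq_const_of_periodic_of_norm_le {g : ℂ → ℂ} (hg : Differentiable ℂ g)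
    (hper : ∀ s, g (s + 1) = g s) {C D : ℝ} {N : ℕ} (hb : ∀ s, ‖g s‖ ≤ C * (D + ‖s‖) ^ N) (s : ℂ) :
    g s = g 0 := by
  obtain ⟨P, hP⟩ := exists_polynomial_eq_of_norm_le hg hb
  have hnat : ∀ n : ℕ, g n = g 0 := by
    intro n
    induction n with
    | zero => simp
    | succ n ih => rw [Nat.cast_succ, hper, ih]
  have : P = Polynomial.C (g 0) := by
    refine Polynomial.eq_of_infinite_eval_eq _ _ ?_
    refine (infinite_range_of_injective (f := fun n : ℕ => (n : ℂ)) Nat.cast_injective).mono ?_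
    rintro _ ⟨n, rfl⟩
    simp only [mem_ofPred_eq, Polynomial.eval_C]
    rw [← hP, hnat]
  rw [hP, this, Polynomial.eval_C]

/-- Integer translations continue f to an entire periodic function. A translation into the strip
leaves the imaginary part unchanged, so a growth bound on one strip gives polynomial growth on the
whole plane. -/
theorem eq_const_of_periodic_on_halfPlane {f : ℂ → ℂ} {R : ℝ}
    (hf : DifferentiableOn ℂ f {s | R < s.re}) (hper : ∀ s : ℂ, R < s.re → f (s + 1) = f s)
    {C : ℝ} {N : ℕ} (hb : ∀ s : ℂ, R + 1 ≤ s.re → s.re ≤ R + 2 → ‖f s‖ ≤ C * (1 + ‖s‖) ^ N) :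
    ∃ c, ∀ s : ℂ, R < s.re → f s = c := by
  have hpern : ∀ (n : ℕ) (s : ℂ), R < s.re → f (s + n) = f s := by
    intro n
    induction n with
    | zero => simp
    | succ n ih =>
      intro s hs
      rw [Nat.cast_succ, ← add_assoc, hper, ih s hs]
      simp
      linarith [(Nat.cast_nonneg n : (0 : ℝ) ≤ n)]
  have hperz : ∀ (k l : ℤ) (s : ℂ), R < (s + k).re → R < (s + l).re → f (s + k) = f (s + l) := by
    have aux : ∀ (k l : ℤ) (s : ℂ), k ≤ l → R < (s + k).re → f (s + k) = f (s + l) := by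
      intro k l s hkl hk
      rw [← hpern (l - k).toNat _ hk]
      congr 1
      have : (((l - k).toNat : ℤ) : ℂ) = ((l - k : ℤ) : ℂ) := by
        rw [Int.toNat_of_nonneg (by linarith)]
      rw [Int.cast_natCast] at this
      rw [this]
      push_cast
      ring
    intro k l s hk hl
    rcases le_total k l with h | h
    · exact aux k l s h hk
    · exact (aux l k s h hl).symm
  -- The translation that brings s into the strip between R+1 and R+2. Although it jumps, `hperz`
  -- lets it be replaced by a locally constant one, which gives differentiability.
  set n : ℂ → ℤ := fun s => ⌈R + 1 - s.re⌉ with hn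
  have hn1 : ∀ s : ℂ, R + 1 ≤ (s + n s).re := by
    intro s
    have := Int.le_ceil (R + 1 - s.re)
    simp only [Complex.add_re, Complex.intCast_re, hn]
    linarith
  have hn2 : ∀ s : ℂ, (s + n s).re ≤ R + 2 := by
    intro s
    have := Int.ceil_lt_add_one (R + 1 - s.re)
    simp only [Complex.add_re, Complex.intCast_re, hn]
    linarith
  set g : ℂ → ℂ := fun s => f (s + n s) with hgdef
  have hgf : ∀ (k : ℤ) (s : ℂ), R < (s + k).re → g s = f (s + k) := fun k s hk =>
    hperz _ _ s (by linarith [hn1 s]) hk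
  have hg : Differentiable ℂ g := by
    intro s
    have hk : R < (s + n s).re := by linarith [hn1 s]
    have hopen : IsOpen {s : ℂ | R < s.re} := isOpen_lt continuous_const Complex.continuous_re
    have h1 : DifferentiableAt ℂ (fun w => f (w + n s)) s := by
      have h2 : DifferentiableAt ℂ f (s + n s) := hf.differentiableAt (hopen.mem_nhds hk)
      exact h2.comp s ((differentiableAt_id).add_const _)
    refine h1.congr_of_eventuallyEq ?_
    have hmem : {w : ℂ | R < (w + n s).re} ∈ 𝓝 s :=
      (hopen.preimage (continuous_id.add continuous_const)).mem_nhds hk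
    filter_upwards [hmem] with w hw using hgf _ w hw
  have hgper : ∀ s, g (s + 1) = g s := by
    intro s
    rw [hgf (n s) (s + 1) (by have := hn1 s; simp at this ⊢; linarith),
      hgf (n s + 1) s (by have := hn1 s; simp at this ⊢; linarith)]
    congr 1
    push_cast
    ring
  have hgb : ∀ s, ‖g s‖ ≤ |C| * ((|R| + 3) + ‖s‖) ^ N := by
    intro s
    refine (hb _ (hn1 s) (hn2 s)).trans ?_
    have h1 : ‖s + n s‖ ≤ |(s + n s).re| + |(s + n s).im| := Complex.norm_le_abs_re_add_abs_im _
    have h2 : |(s + n s).im| ≤ ‖s‖ := by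
      simpa using Complex.abs_im_le_norm s
    have h3 : |(s + n s).re| ≤ |R| + 2 := by
      rw [abs_le]
      have := hn1 s
      have := hn2 s
      constructor <;> cases abs_cases R <;> linarith
    have h4 : (1 + ‖s + n s‖) ^ N ≤ ((|R| + 3) + ‖s‖) ^ N :=
      pow_le_pow_left₀ (by positivity) (by linarith) N
    calc C * (1 + ‖s + n s‖) ^ N ≤ |C| * (1 + ‖s + n s‖) ^ N :=
          mul_le_mul_of_nonneg_right (le_abs_self C) (by positivity)
      _ ≤ _ := mul_le_mul_of_nonneg_left h4 (abs_nonneg C)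
  refine ⟨g 0, fun s hs => ?_⟩
  rw [← eq_const_of_periodic_of_norm_le hg hgper hgb s, hgf 0 s (by simpa using hs)]
  simp

/-! ### Growth of quotients of Gamma functions -/

/-- The quotient is the Beta integral B(u+σ, τ-σ) divided by Γ(τ-σ). For Re(u+σ) ≥ 1 the factor
x^(u+σ-1) has modulus at most 1, which leaves a bound independent of u. -/
theorem norm_Gamma_div_Gamma_le_of_lt {σ τ : ℝ} (h : σ < τ) :
    ∃ C : ℝ, ∀ u : ℂ, 1 - σ ≤ u.re → ‖Complex.Gamma (u + σ) / Complex.Gamma (u + τ)‖ ≤ C := by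
  set d : ℝ := τ - σ with hd
  have hd0 : 0 < d := by linarith
  have hd0' : 0 < (d : ℂ).re := by simpa using hd0
  set K : ℝ := ∫ x in (0 : ℝ)..1, ‖(x : ℂ) ^ ((1 : ℂ) - 1) * (1 - (x : ℂ)) ^ ((d : ℂ) - 1)‖
  refine ⟨K / ‖Complex.Gamma d‖, fun u hu => ?_⟩
  have hv : 0 < (u + σ).re := by simp; linarith
  have e : u + σ + d = u + τ := by rw [hd]; push_cast; ring
  have h1 := Complex.Gamma_mul_Gamma_eq_betaIntegral hv hd0'
  rw [e] at h1
  have h2 : Complex.Gamma (u + τ) ≠ 0 := Complex.Gamma_ne_zero_of_re_pos (by simp; linarith)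
  have h3 : Complex.Gamma d ≠ 0 := Complex.Gamma_ne_zero_of_re_pos hd0'
  have h4 : Complex.Gamma (u + σ) / Complex.Gamma (u + τ) =
      Complex.betaIntegral (u + σ) d / Complex.Gamma d := by
    rw [div_eq_div_iff h2 h3, h1, mul_comm]
  rw [h4, norm_div]
  refine div_le_div_of_nonneg_right ?_ (norm_nonneg _)
  have hi := (Complex.betaIntegral_convergent (u := 1) (v := d) (by simp) hd0').norm
  rw [Complex.betaIntegral]
  refine intervalIntegral.norm_integral_le_of_norm_le zero_le_one (ae_of_all _ fun x hx => ?_) hi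
  rw [norm_mul, norm_mul]
  refine mul_le_mul_of_nonneg_right ?_ (norm_nonneg _)
  rw [sub_self, Complex.cpow_zero, norm_one, Complex.norm_cpow_eq_rpow_re_of_pos hx.1]
  exact Real.rpow_le_one hx.1.le hx.2 (by simp; linarith)

/-- Lowering σ by one costs a linear factor u+σ-1; finitely many such reductions lead to σ < τ,
where the Beta integral applies. -/
theorem norm_Gamma_div_Gamma_le (σ τ : ℝ) :
    ∃ (C R : ℝ) (N : ℕ), 0 ≤ C ∧ ∀ u : ℂ, R ≤ u.re →
      ‖Complex.Gamma (u + σ) / Complex.Gamma (u + τ)‖ ≤ C * (1 + ‖u‖) ^ N := by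
  obtain ⟨n, hn⟩ := exists_nat_gt (σ - τ)
  induction n generalizing σ with
  | zero =>
    obtain ⟨C, hC⟩ := norm_Gamma_div_Gamma_le_of_lt (σ := σ) (τ := τ) (by simp at hn; linarith)
    exact ⟨|C|, 1 - σ, 0, abs_nonneg C, fun u hu => by
      simpa using (hC u hu).trans (le_abs_self C)⟩
  | succ n ih =>
    obtain ⟨C, R, N, hC, h⟩ := ih (σ - 1) (by push_cast at hn; linarith)
    refine ⟨C * (|σ - 1| + 1), max R (2 - σ), N + 1, by positivity, fun u hu => ?_⟩
    have hu1 : R ≤ u.re := (le_max_left _ _).trans hu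
    have hu2 : 2 - σ ≤ u.re := (le_max_right _ _).trans hu
    have h0 : u + ((σ - 1 : ℝ) : ℂ) ≠ 0 := by
      intro h0
      have := congrArg Complex.re h0
      simp at this
      linarith
    have h1 : Complex.Gamma (u + σ) =
        (u + ((σ - 1 : ℝ) : ℂ)) * Complex.Gamma (u + ((σ - 1 : ℝ) : ℂ)) := by
      rw [← Complex.Gamma_add_one _ h0]
      congr 1
      push_cast
      ring
    rw [h1, mul_div_assoc, norm_mul]
    have h2 : ‖u + ((σ - 1 : ℝ) : ℂ)‖ ≤ (|σ - 1| + 1) * (1 + ‖u‖) := by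
      refine (norm_add_le _ _).trans ?_
      rw [Complex.norm_real, Real.norm_eq_abs]
      nlinarith [abs_nonneg (σ - 1), norm_nonneg u]
    calc _ ≤ ((|σ - 1| + 1) * (1 + ‖u‖)) * (C * (1 + ‖u‖) ^ N) :=
          mul_le_mul h2 (h u hu1) (norm_nonneg _) (by positivity)
      _ = _ := by ring

/-! ### The functional equation -/

/-- The solution of the functional equation for the Mellin transform. -/
noncomputable def gammaSolC (p q : ℤ) (m : ℝ) (z : ℂ) : ℂ :=
  (Complex.Gamma ((z + q) / (2 * p)) * Complex.Gamma ((z + m + p - q) / (2 * p))) /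
    (Complex.Gamma ((z + 2 * p - q) / (2 * p)) * Complex.Gamma ((z + m + p + q) / (2 * p)))

/-- Both F and the Gamma solution satisfy the same first order difference equation of step 2p, so
their quotient is periodic. Boundedness of F together with polynomial growth of Gamma quotients
excludes nonconstant periodic factors. -/
theorem exists_eq_const_mul_gammaSolC {F : ℂ → ℂ} {p q : ℤ} {m M : ℝ} (hp : 0 < p)
    (hF : DifferentiableOn ℂ F {z | 2 < z.re}) (hM : ∀ z : ℂ, 2 ≤ z.re → ‖F z‖ ≤ M)
    (hE : ∀ z : ℂ, 2 < z.re → (z + q) * (z + p - q + m) * F z =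
      (z + 2 * p - q) * (z + p + q + m) * F (z + 2 * p)) :
    ∃ (C : ℂ) (R : ℝ), ∀ z : ℂ, R < z.re → F z = C * gammaSolC p q m z := by
  have hp' : (0 : ℝ) < p := by exact_mod_cast hp
  have hpC : (p : ℂ) ≠ 0 := by exact_mod_cast hp.ne'
  set a : ℝ := q / (2 * p) with ha
  set b : ℝ := (p + m) / (2 * p) with hb
  obtain ⟨C₁, R₁, N₁, hC₁, h₁⟩ := norm_Gamma_div_Gamma_le (1 - a) (b - a)
  obtain ⟨C₂, R₂, N₂, hC₂, h₂⟩ := norm_Gamma_div_Gamma_le (b + a) a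
  -- Beyond this abscissa both growth bounds hold, all four Gamma arguments have positive real part,
  -- and 2ps lies in the half-plane Re z > 2 where F is controlled.
  set R : ℝ := max (max R₁ R₂) (|a| + |b| + 2 / p + 1) with hR
  have hRp : 0 < R := lt_of_lt_of_le (by positivity) (le_max_right _ _)
  have hre : ∀ s : ℂ, R < s.re → |a| + |b| + 2 / p + 1 < s.re := fun s hs =>
    (le_max_right _ _).trans_lt hs
  have hpos : ∀ s : ℂ, R < s.re → 0 < (s + (1 - a : ℝ)).re ∧ 0 < (s + (b - a : ℝ)).re ∧
      0 < (s + (b + a : ℝ)).re ∧ 0 < (s + (a : ℝ)).re ∧ 2 < (2 * p * s).re := by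
    intro s hs
    have h3 := hre s hs
    have h4 : 0 < 2 / (p : ℝ) := by positivity
    have h5 : (2 * p * s).re = 2 * p * s.re := by
      rw [show (2 * p * s : ℂ) = ((2 * p : ℝ) : ℂ) * s by push_cast; ring, Complex.re_ofReal_mul]
    have h6 : p * (2 / (p : ℝ)) = 2 := by field_simp
    refine ⟨?_, ?_, ?_, ?_, ?_⟩
    · simp only [Complex.add_re, Complex.ofReal_re]
      cases abs_cases a <;> cases abs_cases b <;> linarith
    · simp only [Complex.add_re, Complex.ofReal_re]
      cases abs_cases a <;> cases abs_cases b <;> linarith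
    · simp only [Complex.add_re, Complex.ofReal_re]
      cases abs_cases a <;> cases abs_cases b <;> linarith
    · simp only [Complex.add_re, Complex.ofReal_re]
      cases abs_cases a <;> cases abs_cases b <;> linarith
    · rw [h5]
      have : 2 / (p : ℝ) < s.re := by linarith [abs_nonneg a, abs_nonneg b]
      nlinarith
  -- This is F divided by the Gamma solution, in the variable s = z/(2p). The Gamma factors are
  -- paired so that each quotient has polynomial growth.
  set f : ℂ → ℂ := fun s => F (2 * p * s) *
    (Complex.Gamma (s + (1 - a : ℝ)) / Complex.Gamma (s + (b - a : ℝ))) *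
    (Complex.Gamma (s + (b + a : ℝ)) / Complex.Gamma (s + (a : ℝ))) with hf
  have hΓ : ∀ {u : ℂ}, 0 < u.re → Complex.Gamma u ≠ 0 := fun hu =>
    Complex.Gamma_ne_zero_of_re_pos hu
  have hne : ∀ {u : ℂ}, 0 < u.re → u ≠ 0 := by
    rintro u hu rfl
    simp at hu
  have hdΓ : ∀ (c : ℝ), (∀ s : ℂ, R < s.re → 0 < (s + c).re) →
      DifferentiableOn ℂ (fun s : ℂ => Complex.Gamma (s + c)) {s | R < s.re} := by
    intro c hc s hs
    have h3 : DifferentiableAt ℂ Complex.Gamma (s + c) := by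
      refine Complex.differentiableAt_Gamma _ fun k hk => ?_
      have h4 := hc s hs
      rw [hk] at h4
      simp at h4
      linarith [(Nat.cast_nonneg k : (0 : ℝ) ≤ k)]
    exact (h3.comp s (differentiableAt_id.add_const _)).differentiableWithinAt
  have hfd : DifferentiableOn ℂ f {s | R < s.re} := by
    refine (DifferentiableOn.mul ?_ ?_).mul ?_
    · exact hF.comp (differentiableOn_id.const_mul _) fun s hs => (hpos s hs).2.2.2.2
    · exact (hdΓ _ fun s hs => (hpos s hs).1).div (hdΓ _ fun s hs => (hpos s hs).2.1)
        fun s hs => hΓ (hpos s hs).2.1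
    · exact (hdΓ _ fun s hs => (hpos s hs).2.2.1).div (hdΓ _ fun s hs => (hpos s hs).2.2.2.1)
        fun s hs => hΓ (hpos s hs).2.2.2.1
  have hfp : ∀ s : ℂ, R < s.re → f (s + 1) = f s := by
    intro s hs
    obtain ⟨p1, p2, p3, p4, p5⟩ := hpos s hs
    have hE' := hE (2 * p * s) p5
    rw [show 2 * p * s + 2 * p = 2 * p * (s + 1) by ring,
      show 2 * p * s + q = 2 * p * (s + (a : ℝ)) by rw [ha]; push_cast; field_simp,
      show 2 * p * s + p - q + m = 2 * p * (s + (b - a : ℝ)) by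
        rw [ha, hb]; push_cast; field_simp; ring,
      show 2 * p * (s + 1) - q = 2 * p * (s + (1 - a : ℝ)) by
        rw [ha]; push_cast; field_simp; ring,
      show 2 * p * s + p + q + m = 2 * p * (s + (b + a : ℝ)) by
        rw [ha, hb]; push_cast; field_simp; ring] at hE'
    have hE'' : (s + (a : ℝ)) * (s + (b - a : ℝ)) * F (2 * p * s) =
        (s + (1 - a : ℝ)) * (s + (b + a : ℝ)) * F (2 * p * (s + 1)) := by
      have h4 : (2 * p * (2 * p) : ℂ) ≠ 0 := by simp [hpC]
      apply mul_left_cancel₀ h4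
      linear_combination hE'
    simp only [hf]
    rw [show s + 1 + ((1 - a : ℝ) : ℂ) = s + (1 - a : ℝ) + 1 by ring,
      show s + 1 + ((b - a : ℝ) : ℂ) = s + (b - a : ℝ) + 1 by ring,
      show s + 1 + ((b + a : ℝ) : ℂ) = s + (b + a : ℝ) + 1 by ring,
      show s + 1 + (a : ℂ) = s + a + 1 by ring, Complex.Gamma_add_one _ (hne p1),
      Complex.Gamma_add_one _ (hne p2), Complex.Gamma_add_one _ (hne p3),
      Complex.Gamma_add_one _ (hne p4)]
    have n2 := hne p2
    have n4 := hne p4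
    have g2 := hΓ p2
    have g4 := hΓ p4
    generalize Complex.Gamma (s + (1 - a : ℝ)) = G1 at *
    generalize Complex.Gamma (s + (b - a : ℝ)) = G2 at *
    generalize Complex.Gamma (s + (b + a : ℝ)) = G3 at *
    generalize Complex.Gamma (s + (a : ℝ)) = G4 at *
    generalize F (2 * p * (s + 1)) = A at *
    generalize F (2 * p * s) = B at *
    generalize s + ((1 - a : ℝ) : ℂ) = x1 at *
    generalize s + ((b - a : ℝ) : ℂ) = x2 at *
    generalize s + ((b + a : ℝ) : ℂ) = x3 at *
    generalize s + (a : ℂ) = x4 at *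
    field_simp
    linear_combination -G1 * G3 * hE''
  have hfb : ∀ s : ℂ, R + 1 ≤ s.re → s.re ≤ R + 2 →
      ‖f s‖ ≤ (M * C₁ * C₂) * (1 + ‖s‖) ^ (N₁ + N₂) := by
    intro s hs _
    have hs' : R < s.re := by linarith
    have i1 := hM (2 * p * s) (hpos s hs').2.2.2.2.le
    have i2 := h₁ s (((le_max_left _ _).trans (le_max_left _ _)).trans hs'.le)
    have i3 := h₂ s (((le_max_right _ _).trans (le_max_left _ _)).trans hs'.le)
    have hM0 : 0 ≤ M := (norm_nonneg _).trans i1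
    simp only [hf]
    rw [norm_mul, norm_mul]
    calc _ ≤ M * (C₁ * (1 + ‖s‖) ^ N₁) * (C₂ * (1 + ‖s‖) ^ N₂) :=
          mul_le_mul (mul_le_mul i1 i2 (norm_nonneg _) hM0) i3 (norm_nonneg _) (by positivity)
      _ = _ := by rw [pow_add]; ring
  obtain ⟨c, hc⟩ := eq_const_of_periodic_on_halfPlane hfd hfp hfb
  refine ⟨c, 2 * p * R, fun z hz => ?_⟩
  have hs : R < (z / (2 * p)).re := by
    rw [show z / (2 * p) = z / ((2 * p : ℝ) : ℂ) by push_cast; ring, Complex.div_ofReal_re,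
      lt_div_iff₀ (by positivity)]
    linarith
  obtain ⟨p1, p2, p3, p4, p5⟩ := hpos _ hs
  have := hc _ hs
  simp only [hf] at this
  rw [show 2 * p * (z / (2 * p)) = z by field_simp] at this
  unfold gammaSolC
  rw [show (z + q) / (2 * p) = z / (2 * p) + (a : ℝ) by rw [ha]; push_cast; field_simp,
      show (z + m + p - q) / (2 * p) = z / (2 * p) + (b - a : ℝ) by
        rw [ha, hb]; push_cast; field_simp; ring,
      show (z + 2 * p - q) / (2 * p) = z / (2 * p) + (1 - a : ℝ) by
        rw [ha]; push_cast; field_simp; ring,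
      show (z + m + p + q) / (2 * p) = z / (2 * p) + (b + a : ℝ) by
        rw [ha, hb]; push_cast; field_simp; ring]
  have g1 := hΓ p1
  have g2 := hΓ p2
  have g3 := hΓ p3
  have g4 := hΓ p4
  rw [← this]
  generalize Complex.Gamma (z / (2 * p) + (1 - a : ℝ)) = G1 at *
  generalize Complex.Gamma (z / (2 * p) + (b - a : ℝ)) = G2 at *
  generalize Complex.Gamma (z / (2 * p) + (b + a : ℝ)) = G3 at *
  generalize Complex.Gamma (z / (2 * p) + (a : ℝ)) = G4 at *
  field_simp

end HarmonicToeplitz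

namespace HarmonicToeplitz

open Filter Topology Set

/-! ### Extension of identities to the half-plane -/

/-- The identity theorem on the open half-plane, then continuity for the boundary line Re z = 2,
where the Mellin transform of an integrable radial function is continuous but need not be analytic.
-/
theorem eqOn_halfPlane_of_eq_far {f g : ℂ → ℂ} (hf : DifferentiableOn ℂ f {z | 2 < z.re})
    (hf' : ContinuousOn f {z | 2 ≤ z.re}) (hg : DifferentiableOn ℂ g {z | 2 < z.re})
    (hg' : ContinuousOn g {z | 2 ≤ z.re}) {R : ℝ} (h : ∀ z : ℂ, R < z.re → f z = g z) :
    ∀ z : ℂ, 2 ≤ z.re → f z = g z := by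
  have hopen : ∀ c : ℝ, IsOpen {z : ℂ | c < z.re} := fun c =>
    isOpen_lt continuous_const Complex.continuous_re
  have hconv : IsPreconnected {z : ℂ | 2 < z.re} :=
    (convex_halfSpace_re_gt 2).isPreconnected
  have hz₀ : 2 < ((max 2 R + 1 : ℝ) : ℂ).re := by
    rw [Complex.ofReal_re]
    linarith [le_max_left 2 R]
  have hz₁ : R < ((max 2 R + 1 : ℝ) : ℂ).re := by
    rw [Complex.ofReal_re]
    linarith [le_max_right 2 R]
  have h1 : EqOn f g {z | 2 < z.re} :=
    (hf.analyticOnNhd (hopen 2)).eqOn_of_preconnected_of_eventuallyEq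
      (hg.analyticOnNhd (hopen 2)) hconv hz₀ (by
        filter_upwards [(hopen R).mem_nhds hz₁] with z hz using h z hz)
  have h2 : EqOn f g {z | 2 ≤ z.re} := by
    refine h1.of_subset_closure hf' hg' (fun z (hz : 2 < z.re) => hz.le) ?_
    rw [Complex.closure_setOfPred_lt_re]
  exact fun z hz => h2 hz

theorem radialEq_of_mellinTransform_eq {φ ψ : ℝ → ℂ} (hφ : RadialIntegrable φ)
    (hψ : RadialIntegrable ψ) {R : ℝ}
    (h : ∀ z : ℂ, R < z.re → mellinTransform φ z = mellinTransform ψ z) : RadialEq φ ψ := by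
  have h1 : RadialEq (fun r => φ r + -ψ r) fun _ => 0 := by
    refine radialEq_zero_of_mellinTransform_eq_zero (hφ.add hψ.neg) (n₀ := max 2 (⌈R⌉ + 1))
      fun n hn => ?_
    have hn2 : (2 : ℤ) ≤ n := (le_max_left _ _).trans hn
    have hnR : ⌈R⌉ + 1 ≤ n := (le_max_right _ _).trans hn
    have h2 : (2 : ℝ) ≤ n := by exact_mod_cast hn2
    have h3 : R < n := by
      have h4 : ((⌈R⌉ + 1 : ℤ) : ℝ) ≤ n := by exact_mod_cast hnR
      push_cast at h4
      linarith [Int.le_ceil R]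
    rw [mellinTransform_add hφ hψ.neg (by simpa using h2), mellinTransform_neg,
      h n (by simpa using h3), add_neg_cancel]
  unfold RadialEq at *
  filter_upwards [h1] with r hr
  linear_combination hr

/-- The bracket is the partial fraction expansion of (z+c)(z+d)/(z(z+1)). Dividing the quadratic
polynomials of the functional equation by z(z+1) is what brings them within reach of moment
functionals. -/
theorem isMomentFunction_quadratic {φ : ℝ → ℂ} (hφ : RadialIntegrable φ) (c d : ℂ) :
    IsMomentFunction fun z =>
      mellinTransform φ z * (1 + c * d / z - (c - 1) * (d - 1) / (z + 1)) := by
  have h1 := isMomentFunction_mellinTransform hφ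
  have h2 := (isMomentFunction_mellinTransform_div hφ le_rfl).const_mul (c * d)
  have h3 := (isMomentFunction_mellinTransform_div hφ zero_le_one).const_mul
    (-((c - 1) * (d - 1)))
  convert (h1.add h2).add h3 using 2
  push_cast
  ring

theorem RadialIntegrable.cpow_mul {φ : ℝ → ℂ} (hφ : RadialIntegrable φ) {w : ℂ} (hw : 0 ≤ w.re) :
    RadialIntegrable fun r => (r : ℂ) ^ w * φ r := by
  refine Integrable.congr (hφ.mul_cpow hw) (ae_of_all _ fun r => ?_)
  ring

theorem mellinTransform_cpow_mul (φ : ℝ → ℂ) (w z : ℂ) :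
    mellinTransform (fun r => (r : ℂ) ^ w * φ r) z = mellinTransform φ (z + w) := by
  rw [mellinTransform_eq_setIntegral, mellinTransform_eq_setIntegral]
  refine setIntegral_congr_fun measurableSet_Ioo fun r hr => ?_
  have h0 : (r : ℂ) ≠ 0 := Complex.ofReal_ne_zero.mpr hr.1.ne'
  rw [show z + w - 2 = (z - 2) + w by ring, Complex.cpow_add _ _ h0]
  ring

/-- The functional equation for the Mellin transform, extended from the integers to the
half-plane. -/
theorem mellinTransform_functional_eq {φ : ℝ → ℂ} (hφ : RadialIntegrable φ) {p q : ℤ} {m : ℝ}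
    (hp : 0 < p) (hpm : 0 ≤ p + m) {l₀ : ℤ}
    (h : ∀ l : ℤ, l₀ ≤ l → commCoeff (fun n => mellinTransform φ n) p q (m : ℂ) l = 0) :
    ∀ z : ℂ, 2 ≤ z.re → (z + q) * (z + p - q + m) * mellinTransform φ z =
      (z + 2 * p - q) * (z + p + q + m) * mellinTransform φ (z + 2 * p) := by
  have hp' : (0 : ℝ) < p := by exact_mod_cast hp
  set φ₂ : ℝ → ℂ := fun r => (r : ℂ) ^ (2 * p : ℂ) * φ r with hφ₂
  have hφ₂i : RadialIntegrable φ₂ := hφ.cpow_mul (by simp; linarith)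
  have hm2 : ∀ z, mellinTransform φ (z + 2 * p) = mellinTransform φ₂ z := fun z =>
    (mellinTransform_cpow_mul φ _ z).symm
  -- The difference of the two sides of the functional equation, divided by z(z+1). The shifted
  -- value F(z+2p) enters as the Mellin transform of r^(2p) φ at z, so that both terms are moment
  -- functions.
  set G : ℂ → ℂ := fun z =>
    mellinTransform φ z * (1 + (q : ℂ) * (p - q + m) / z - (q - 1) * (p - q + m - 1) / (z + 1)) +
    -1 * (mellinTransform φ₂ z * (1 + (2 * p - q : ℂ) * (p + q + m) / z -
      (2 * p - q - 1) * (p + q + m - 1) / (z + 1))) with hG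
  have hGm : IsMomentFunction G := (isMomentFunction_quadratic hφ _ _).add
    ((isMomentFunction_quadratic hφ₂i _ _).const_mul (-1))
  have hGE : ∀ z : ℂ, 0 < z.re → z * (z + 1) * G z =
      (z + q) * (z + p - q + m) * mellinTransform φ z -
      (z + 2 * p - q) * (z + p + q + m) * mellinTransform φ (z + 2 * p) := by
    intro z hz
    have h0 : z ≠ 0 := by
      rintro rfl
      simp at hz
    have h1 : z + 1 ≠ 0 := by
      intro h1
      have := congrArg Complex.re h1
      simp at this
      linarith
    rw [hm2, hG]
    field_simp
    ring
  set N : ℤ := max l₀ (|p| + |q| + 1) with hN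
  have hN1 : l₀ ≤ N := le_max_left _ _
  have hN2 : |p| + |q| + 1 ≤ N := le_max_right _ _
  have hq := abs_le.mp (le_refl |q|)
  rw [abs_of_pos hp] at hN2
  -- For l ≥ N every absolute value in the coefficient opens with a plus sign, and d_l = 0 becomes,
  -- after doubling, the functional equation at z = 2l+q+2.
  have hint : ∀ l : ℤ, N ≤ l → G ((2 * l + q + 2 : ℤ) : ℂ) = 0 := by
    intro l hl
    have e := h l (hN1.trans hl)
    unfold commCoeff at e
    rw [abs_of_nonneg (show 0 ≤ l by linarith [abs_nonneg q]),
      abs_of_nonneg (show 0 ≤ l + q by linarith [hq.1]),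
      abs_of_nonneg (show 0 ≤ l + p by linarith [abs_nonneg q]),
      abs_of_nonneg (show 0 ≤ l + p + q by linarith [hq.1])] at e
    have hl1 : (0 : ℝ) ≤ l := by exact_mod_cast (by linarith [abs_nonneg q] : 0 ≤ l)
    have hl2 : (0 : ℝ) ≤ l + q := by exact_mod_cast (by linarith [hq.1] : 0 ≤ l + q)
    have d1 : ((l + q : ℤ) : ℂ) + ((l + p + q : ℤ) : ℂ) + 2 + (m : ℂ) ≠ 0 := by
      have : ((l : ℝ) + q + (l + p + q) + 2 + m) ≠ 0 := by linarith
      exact_mod_cast this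
    have d2 : (l : ℂ) + ((l + p : ℤ) : ℂ) + 2 + (m : ℂ) ≠ 0 := by
      have : ((l : ℝ) + (l + p) + 2 + m) ≠ 0 := by linarith
      exact_mod_cast this
    have hzre : 0 < ((2 * l + q + 2 : ℤ) : ℂ).re := by
      simp only [Complex.intCast_re]
      push_cast
      linarith
    have hz0 : ((2 * l + q + 2 : ℤ) : ℂ) ≠ 0 := by
      intro h0
      rw [h0] at hzre
      simp at hzre
    have hz1 : ((2 * l + q + 2 : ℤ) : ℂ) + 1 ≠ 0 := by
      intro h0
      have := congrArg Complex.re h0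
      simp only [Complex.add_re, Complex.one_re, Complex.zero_re] at this
      linarith
    have hE := hGE _ hzre
    rw [sub_eq_zero, div_eq_div_iff d1 d2] at e
    have : ((2 * l + q + 2 : ℤ) : ℂ) * (((2 * l + q + 2 : ℤ) : ℂ) + 1) *
        G ((2 * l + q + 2 : ℤ) : ℂ) = 0 := by
      rw [hE]
      rw [show l + (l + q) + 2 = 2 * l + q + 2 by ring] at e
      beta_reduce at e
      rw [show ((l + p + (l + p + q) + 2 : ℤ) : ℂ) = ((2 * l + q + 2 : ℤ) : ℂ) + 2 * p by
        push_cast; ring] at e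
      generalize mellinTransform φ (((2 * l + q + 2 : ℤ) : ℂ) + 2 * p) = A at *
      generalize mellinTransform φ ((2 * l + q + 2 : ℤ) : ℂ) = B at *
      push_cast at e ⊢
      linear_combination 2 * e
    exact (mul_eq_zero.mp this).resolve_left (mul_ne_zero hz0 hz1)
  have haR : 2 < ((2 * N + q + 2 : ℤ) : ℂ).re := by
    simp only [Complex.intCast_re]
    exact_mod_cast (by linarith [hq.1] : 2 < 2 * N + q + 2)
  have hfar := fun z => hGm.eq_zero (z := z) haR fun j => by
    rw [← hint (N + j) (by omega)]
    congr 1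
    push_cast
    ring
  have hshift : ∀ z : ℂ, (z + 2 * p).re = z.re + 2 * p := by
    intro z
    simp
  have c1 := continuousOn_mellinTransform hφ
  have c2 := continuousOn_mellinTransform hφ₂i
  have d1 := differentiableOn_mellinTransform hφ
  have d2 := differentiableOn_mellinTransform hφ₂i
  intro z hz
  simp only [hm2]
  refine eqOn_halfPlane_of_eq_far
    (f := fun z => (z + q) * (z + p - q + m) * mellinTransform φ z)
    (g := fun z => (z + 2 * p - q) * (z + p + q + m) * mellinTransform φ₂ z)
    (R := ((2 * N + q + 2 : ℤ) : ℂ).re) ?_ ?_ ?_ ?_ ?_ z hz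
  · exact DifferentiableOn.mul (by fun_prop) d1
  · exact ContinuousOn.mul (by fun_prop) c1
  · exact DifferentiableOn.mul (by fun_prop) d2
  · exact ContinuousOn.mul (by fun_prop) c2
  · intro w hw
    have hE := hGE w (by linarith)
    rw [hfar w hw, mul_zero] at hE
    rw [← hm2]
    linear_combination -hE

end HarmonicToeplitz

namespace HarmonicToeplitz

open Filter Topology Set

/-! ### Values of the solution of the functional equation -/

theorem Gamma_div_add_one {u : ℂ} (hu : 0 < u.re) :
    Complex.Gamma u / Complex.Gamma (u + 1) = 1 / u := by
  have h0 : u ≠ 0 := by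
    rintro rfl
    simp at hu
  rw [Complex.Gamma_add_one _ h0]
  have := Complex.Gamma_ne_zero_of_re_pos hu
  field_simp

theorem Gamma_add_natCast_eq_prod {u : ℂ} (hu : 0 < u.re) (n : ℕ) :
    Complex.Gamma (u + 1 + n) = (∏ j ∈ Finset.Icc 1 n, (u + j)) * Complex.Gamma (u + 1) := by
  induction n with
  | zero => simp
  | succ n ih =>
    have h0 : u + 1 + n ≠ 0 := by
      intro h0
      have := congrArg Complex.re h0
      simp at this
      linarith [(Nat.cast_nonneg n : (0 : ℝ) ≤ n)]
    rw [Nat.cast_succ, ← add_assoc, Complex.Gamma_add_one _ h0, ih,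
      Finset.prod_Icc_succ_top (by omega)]
    push_cast
    ring

theorem Gamma_add_natCast_succ_eq_prod {u : ℂ} (hu : 0 < u.re) (n : ℕ) :
    Complex.Gamma (u + 1 + n) = (∏ j ∈ Finset.Icc 0 n, (u + j)) * Complex.Gamma u := by
  have h0 : u ≠ 0 := by
    rintro rfl
    simp at hu
  rw [Gamma_add_natCast_eq_prod hu, Complex.Gamma_add_one _ h0,
    ← Finset.mul_prod_Ioc_eq_prod_Icc (Nat.zero_le n), ← Finset.Icc_succ_left_eq_Ioc]
  simp
  ring

section

variable {p q : ℤ} {m : ℝ}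

theorem re_div_two_mul (p : ℤ) (z : ℂ) : (z / (2 * p)).re = z.re / (2 * p) := by
  rw [show z / (2 * p) = z / ((2 * p : ℝ) : ℂ) by push_cast; ring, Complex.div_ofReal_re]

theorem re_div_two_mul_pos (hp : 0 < p) {z : ℂ} (hz : 0 < z.re) : 0 < (z / (2 * p)).re := by
  have hp' : (0 : ℝ) < p := by exact_mod_cast hp
  rw [re_div_two_mul]
  positivity

theorem gammaSolC_natural (hp : 0 < p) (hpm : 0 ≤ p + m) {n : ℤ} (hn : |q| + 2 ≤ n) :
    gammaSolC p q m n = (gammaSol p q m n : ℝ) := by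
  have hp' : (0 : ℝ) < p := by exact_mod_cast hp
  have hq := abs_le.mp (show |q| ≤ n - 2 by linarith)
  have h1 : (0 : ℝ) < n + q := by exact_mod_cast (by linarith [hq.1] : 0 < n + q)
  have h2 : (0 : ℝ) < n - q := by exact_mod_cast (by linarith [hq.2] : 0 < n - q)
  unfold gammaSol gammaQuot gammaSolC
  have hX : 0 < ((n : ℝ) + q) / (2 * p) := by positivity
  have hY : 0 < ((n : ℝ) - q) / (2 * p) := by positivity
  have e1 : ((n : ℝ) + 2 * p - q) / (2 * p) = (n - q) / (2 * p) + 1 := by field_simp; ring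
  have e2 : ((n : ℝ) + m + p - q) / (2 * p) = (n - q) / (2 * p) + (p + m) / (2 * p) := by
    field_simp; ring
  have e3 : ((n : ℝ) + m + p + q) / (2 * p) = (n + q) / (2 * p) + (p + m) / (2 * p) := by
    field_simp; ring
  have g1 : ((n : ℂ) + q) / (2 * p) = ((((n : ℝ) + q) / (2 * p) : ℝ) : ℂ) := by push_cast; rfl
  have g2 : ((n : ℂ) + m + p - q) / (2 * p) =
    ((((n : ℝ) - q) / (2 * p) + (p + m) / (2 * p) : ℝ) : ℂ) := by rw [← e2]; push_cast; rfl
  have g3 : ((n : ℂ) + 2 * p - q) / (2 * p) = ((((n : ℝ) - q) / (2 * p) + 1 : ℝ) : ℂ) := by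
    rw [← e1]; push_cast; rfl
  have g4 : ((n : ℂ) + m + p + q) / (2 * p) =
    ((((n : ℝ) + q) / (2 * p) + (p + m) / (2 * p) : ℝ) : ℂ) := by rw [← e3]; push_cast; rfl
  rw [g1, g2, g3, g4]
  simp only [Complex.Gamma_ofReal]
  rw [Real.Gamma_add_one hY.ne']
  norm_cast
  have k1 := (Real.Gamma_pos_of_pos hY).ne'
  have k2 := (Real.Gamma_pos_of_pos (show 0 < ((n : ℝ) - q) / (2 * p) + (p + m) / (2 * p) by
    positivity)).ne'
  have k3 := (Real.Gamma_pos_of_pos (show 0 < ((n : ℝ) + q) / (2 * p) + (p + m) / (2 * p) by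
    positivity)).ne'
  generalize Real.Gamma (((n : ℝ) - q) / (2 * p)) = G1 at *
  generalize Real.Gamma (((n : ℝ) - q) / (2 * p) + (p + m) / (2 * p)) = G2 at *
  generalize Real.Gamma (((n : ℝ) + q) / (2 * p) + (p + m) / (2 * p)) = G3 at *
  generalize Real.Gamma (((n : ℝ) + q) / (2 * p)) = G4 at *
  have hY' := hY.ne'
  generalize ((n : ℝ) - q) / (2 * p) = Y at *
  field_simp

theorem gammaSolC_ne_zero (hp : 0 < p) {z : ℂ} (h1 : 0 < z.re + q) (h2 : 0 < z.re + m + p - q)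
    (h3 : 0 < z.re + 2 * p - q) (h4 : 0 < z.re + m + p + q) : gammaSolC p q m z ≠ 0 := by
  have g : ∀ {u : ℂ}, 0 < u.re → Complex.Gamma (u / (2 * p)) ≠ 0 := fun hu =>
    Complex.Gamma_ne_zero_of_re_pos (re_div_two_mul_pos hp hu)
  exact div_ne_zero (mul_ne_zero (g (by simpa using h1)) (g (by simpa using h2)))
    (mul_ne_zero (g (by simpa using h3)) (g (by simpa using h4)))

/-- Because 1/Γ is entire, only the two Gamma factors in the numerator can produce poles; hence just
two positivity conditions. -/
theorem gammaSolC_differentiableAt (hp : 0 < p) {z : ℂ} (h1 : 0 < z.re + q)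
    (h2 : 0 < z.re + m + p - q) : DifferentiableAt ℂ (gammaSolC p q m) z := by
  have g : ∀ {u : ℂ}, 0 < u.re → DifferentiableAt ℂ Complex.Gamma (u / (2 * p)) := fun hu =>
    Complex.differentiableAt_Gamma _ fun k hk => by
      have h4 := re_div_two_mul_pos hp hu
      rw [hk] at h4
      simp at h4
      linarith [(Nat.cast_nonneg k : (0 : ℝ) ≤ k)]
  have hfun : gammaSolC p q m = fun z : ℂ =>
      (Complex.Gamma ((z + q) / (2 * p)) * Complex.Gamma ((z + m + p - q) / (2 * p))) *
      ((Complex.Gamma ((z + 2 * p - q) / (2 * p)))⁻¹ *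
        (Complex.Gamma ((z + m + p + q) / (2 * p)))⁻¹) := by
    ext z
    rw [gammaSolC, div_eq_mul_inv, mul_inv]
  rw [hfun]
  refine DifferentiableAt.mul (DifferentiableAt.mul ?_ ?_) (DifferentiableAt.mul ?_ ?_)
  · exact (g (u := z + q) (by simpa using h1)).comp z
      (f := fun z : ℂ => (z + q) / (2 * p)) (by fun_prop)
  · exact (g (u := z + m + p - q) (by simpa using h2)).comp z
      (f := fun z : ℂ => (z + m + p - q) / (2 * p)) (by fun_prop)
  · exact (Complex.differentiable_one_div_Gamma _).comp z
      (f := fun z : ℂ => (z + 2 * p - q) / (2 * p)) (by fun_prop)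
  · exact (Complex.differentiable_one_div_Gamma _).comp z
      (f := fun z : ℂ => (z + m + p + q) / (2 * p)) (by fun_prop)

/-- For q = 0 one pair of Gamma factors cancels and the other pair differs by a shift of 1. The next
lemmas treat the further parameters for which the solution is rational, so that φ can be recovered
as a combination of powers of r. -/
theorem gammaSolC_zero_right (hp : 0 < p) {z : ℂ} (h1 : 0 < z.re) (h2 : 0 < z.re + m + p) :
    gammaSolC p 0 m z = 2 * p / z := by
  have hpC : (p : ℂ) ≠ 0 := by exact_mod_cast hp.ne'
  have h3 := Gamma_div_add_one (re_div_two_mul_pos hp h1)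
  have h4 := Complex.Gamma_ne_zero_of_re_pos
    (re_div_two_mul_pos (z := z + m + p) hp (by simpa using h2))
  unfold gammaSolC
  rw [show z + 2 * p - ((0 : ℤ) : ℂ) = z + 2 * p by push_cast; ring,
    show z + ((0 : ℤ) : ℂ) = z by push_cast; ring,
    show z + m + p + ((0 : ℤ) : ℂ) = z + m + p by push_cast; ring,
    show z + m + p - ((0 : ℤ) : ℂ) = z + m + p by push_cast; ring,
    mul_div_mul_right _ _ h4, show (z + 2 * p) / (2 * p) = z / (2 * p) + 1 by field_simp, h3]
  field_simp

theorem gammaSolC_self (hp : 0 < p) {z : ℂ} (h1 : 0 < z.re + p) (h2 : 0 < z.re + m) :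
    gammaSolC p p m z = 2 * p / (z + m) := by
  have hpC : (p : ℂ) ≠ 0 := by exact_mod_cast hp.ne'
  have h3 := Gamma_div_add_one (re_div_two_mul_pos (z := z + m) hp (by simpa using h2))
  have h4 := Complex.Gamma_ne_zero_of_re_pos
    (re_div_two_mul_pos (z := z + p) hp (by simpa using h1))
  unfold gammaSolC
  rw [show z + 2 * p - p = z + p by ring, mul_div_mul_left _ _ h4,
    show z + m + p - p = z + m by ring,
    show (z + m + p + p) / (2 * p) = (z + m) / (2 * p) + 1 by field_simp; ring, h3]
  field_simp

theorem gammaSolC_one_neg {z : ℂ} (h1 : 0 < z.re + q) (h2 : 0 < z.re - q) :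
    gammaSolC 1 q (-1) z = 2 / (z - q) := by
  have h3 := Gamma_div_add_one (re_div_two_mul_pos (p := 1) (z := z - q) one_pos
    (by simpa using h2))
  have h4 := Complex.Gamma_ne_zero_of_re_pos
    (re_div_two_mul_pos (p := 1) (z := z + q) one_pos (by simpa using h1))
  unfold gammaSolC
  push_cast at *
  rw [show z + -1 + 1 - q = z - q by ring, show z + -1 + 1 + q = z + q by ring,
    mul_comm, mul_div_mul_right _ _ h4,
    show (z + 2 * 1 - q) / (2 * 1) = (z - q) / (2 * 1) + 1 by ring, h3]
  field_simp

theorem gammaSolC_one_neg_one {z : ℂ} (h1 : 1 < z.re) (h2 : 0 < z.re + m) :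
    gammaSolC 1 (-1) m z = 2 * (z + m) / ((z - 1) * (z + 1)) := by
  have a1 : 0 < ((z - 1) / (2 * (1 : ℤ))).re := re_div_two_mul_pos one_pos (by simpa using h1)
  have a2 : 0 < ((z + 1) / (2 * (1 : ℤ))).re :=
    re_div_two_mul_pos one_pos (by simp; linarith)
  have a3 : 0 < ((z + m) / (2 * (1 : ℤ))).re := re_div_two_mul_pos one_pos (by simpa using h2)
  have hne : ∀ {u : ℂ}, 0 < (u / (2 * (1 : ℤ))).re → u ≠ 0 := by
    rintro u hu rfl
    simp at hu
  have n1 := hne a1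
  have n2 := hne a2
  have n3 := hne a3
  have hh : ∀ {u : ℂ}, u ≠ 0 → Complex.Gamma (u / 2 + 1) = u / 2 * Complex.Gamma (u / 2) :=
    fun hu => Complex.Gamma_add_one _ (div_ne_zero hu two_ne_zero)
  have g1 := Complex.Gamma_ne_zero_of_re_pos a1
  have g3 := Complex.Gamma_ne_zero_of_re_pos a3
  unfold gammaSolC
  push_cast at *
  simp only [mul_one] at *
  rw [show (z + m + 1 - -1) / 2 = (z + m) / 2 + 1 by ring,
    show (z + 2 - -1) / 2 = (z + 1) / 2 + 1 by ring,
    show (z + m + 1 + -1) / 2 = (z + m) / 2 by ring, show z + -1 = z - 1 by ring, hh n3, hh n2,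
    show (z + 1) / 2 = (z - 1) / 2 + 1 by ring, hh n1]
  generalize Complex.Gamma ((z - 1) / 2) = G1 at *
  generalize Complex.Gamma ((z + m) / 2) = G3 at *
  have e : (z - 1) / 2 + 1 = (z + 1) / 2 := by ring
  rw [e]
  field_simp

/-- For m = (2n+1)p the arguments containing m exceed (z±q)/(2p) by the integer n+1, so the quotient
is rational. This rational form is free of the poles that the Gamma factors seem to have for large
q. -/
theorem gammaSolC_odd_multiple (hp : 0 < p) {n : ℕ} (hm : m = (2 * n + 1) * p) {z : ℂ}
    (h1 : 0 < z.re + q) (h2 : 0 < z.re - q) :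
    gammaSolC p q m z = (∏ j ∈ Finset.Icc 1 n, ((z - q) / (2 * p) + j)) /
      ∏ j ∈ Finset.Icc 0 n, ((z + q) / (2 * p) + j) := by
  have hpC : (p : ℂ) ≠ 0 := by exact_mod_cast hp.ne'
  have a1 : 0 < ((z + q) / (2 * p)).re := re_div_two_mul_pos hp (by simpa using h1)
  have a2 : 0 < ((z - q) / (2 * p)).re := re_div_two_mul_pos hp (by simpa using h2)
  have b1 := Gamma_add_natCast_succ_eq_prod a1 n
  have b2 := Gamma_add_natCast_eq_prod a2 n
  have g1 := Complex.Gamma_ne_zero_of_re_pos a1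
  have g2 : Complex.Gamma ((z - q) / (2 * p) + 1) ≠ 0 :=
    Complex.Gamma_ne_zero_of_re_pos (by rw [Complex.add_re, Complex.one_re]; linarith)
  unfold gammaSolC
  have hmC : (m : ℂ) = (2 * n + 1) * p := by rw [hm]; push_cast; ring
  rw [show (z + m + p - q) / (2 * p) = (z - q) / (2 * p) + 1 + n by
      rw [hmC]; field_simp; ring,
    show (z + 2 * p - q) / (2 * p) = (z - q) / (2 * p) + 1 by field_simp; ring,
    show (z + m + p + q) / (2 * p) = (z + q) / (2 * p) + 1 + n by
      rw [hmC]; field_simp; ring, b1, b2]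
  generalize Complex.Gamma ((z + q) / (2 * p)) = G1 at *
  generalize Complex.Gamma ((z - q) / (2 * p) + 1) = G2 at *
  rw [show G1 * ((∏ j ∈ Finset.Icc 1 n, ((z - q) / (2 * p) + j)) * G2) =
      (∏ j ∈ Finset.Icc 1 n, ((z - q) / (2 * p) + j)) * (G2 * G1) by ring,
    show G2 * ((∏ j ∈ Finset.Icc 0 n, ((z + q) / (2 * p) + j)) * G1) =
      (∏ j ∈ Finset.Icc 0 n, ((z + q) / (2 * p) + j)) * (G2 * G1) by ring,
    mul_div_mul_right _ _ (mul_ne_zero g2 g1)]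

/-- A zero of the left-hand side of the functional equation in the half-plane forces the solution
to vanish, unless a factor of the right-hand side vanishes as well. -/
theorem const_eq_zero_of_exceptional_zero {F : ℂ → ℂ} {C : ℂ} {R : ℝ} (hp : 0 < p)
    (hpm : 0 ≤ p + m)
    (hE : ∀ z : ℂ, 2 ≤ z.re → (z + q) * (z + p - q + m) * F z =
      (z + 2 * p - q) * (z + p + q + m) * F (z + 2 * p))
    (hC : ∀ z : ℂ, R < z.re → F z = C * gammaSolC p q m z) {x : ℝ} (hx : 2 ≤ x)
    (hx0 : (x + q) * (x + p - q + m) = 0)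
    (hx1 : ∀ j : ℕ, (x + 2 * p * j + 2 * p - q) * (x + 2 * p * j + p + q + m) ≠ 0) : C = 0 := by
  have hp' : (0 : ℝ) < p := by exact_mod_cast hp
  have hzero : ∀ j : ℕ, F ((x + 2 * p * j + 2 * p : ℝ) : ℂ) = 0 := by
    intro j
    induction j with
    | zero =>
      have h := hE ((x : ℝ) : ℂ) (by simpa using hx)
      have h0 : ((x : ℂ) + q) * (x + p - q + m) = 0 := by
        exact_mod_cast congrArg (fun y : ℝ => (y : ℂ)) hx0
      have h1 : ((x : ℂ) + 2 * p - q) * (x + p + q + m) ≠ 0 := by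
        have := hx1 0
        simp only [Nat.cast_zero, mul_zero, add_zero] at this
        exact_mod_cast this
      rw [h0, zero_mul] at h
      have := (mul_eq_zero.mp h.symm).resolve_left h1
      rw [← this]
      congr 1
      push_cast
      ring
    | succ j ih =>
      have hj : 0 ≤ 2 * (p : ℝ) * j := by positivity
      have h := hE ((x + 2 * p * j + 2 * p : ℝ) : ℂ) (by
        rw [Complex.ofReal_re]
        linarith)
      have h1 : (((x + 2 * p * j + 2 * p : ℝ) : ℂ) + 2 * p - q) *
          (((x + 2 * p * j + 2 * p : ℝ) : ℂ) + p + q + m) ≠ 0 := by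
        have := hx1 (j + 1)
        rw [show x + 2 * p * ((j + 1 : ℕ) : ℝ) = x + 2 * p * j + 2 * p by push_cast; ring] at this
        exact_mod_cast this
      rw [ih, mul_zero] at h
      have := (mul_eq_zero.mp h.symm).resolve_left h1
      rw [← this]
      congr 1
      push_cast
      ring
  -- So far to the right, F is C times the Gamma solution, and all Gamma arguments are positive; the
  -- Gamma solution is nonzero while F vanishes, so C = 0.
  obtain ⟨j, hj⟩ := exists_nat_gt (max R (|(q : ℝ)|))
  have hjp : (j : ℝ) ≤ 2 * p * j := by
    have h1 : (1 : ℝ) ≤ p := by exact_mod_cast hp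
    nlinarith [(Nat.cast_nonneg j : (0 : ℝ) ≤ j)]
  have hjR : R < j := (le_max_left _ _).trans_lt hj
  have hjq : |(q : ℝ)| < j := (le_max_right _ _).trans_lt hj
  have hjq' := abs_lt.mp hjq
  have h := hC ((x + 2 * p * j + 2 * p : ℝ) : ℂ) (by
    rw [Complex.ofReal_re]
    linarith)
  rw [hzero j] at h
  refine (mul_eq_zero.mp h.symm).resolve_right (gammaSolC_ne_zero hp ?_ ?_ ?_ ?_) <;>
  · rw [Complex.ofReal_re]
    linarith [hjq'.1, hjq'.2]

end

end HarmonicToeplitz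

namespace HarmonicToeplitz

open Filter Topology Set

/-! ### Classification of the symbols -/

theorem radialEq_const_mul_cpow {φ : ℝ → ℂ} (hφ : RadialIntegrable φ) {C s : ℂ} (hs : -2 < s.re)
    {R : ℝ} (h : ∀ z : ℂ, R < z.re → mellinTransform φ z = C / (z + s)) :
    RadialEq φ fun r => C * (r : ℂ) ^ s := by
  refine radialEq_of_mellinTransform_eq hφ (radialIntegrable_const_mul_cpow C hs)
    (R := max R 2) fun z hz => ?_
  have h1 : R < z.re := (le_max_left _ _).trans_lt hz
  have h2 : 2 < z.re := (le_max_right _ _).trans_lt hz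
  rw [h z h1, mellinTransform_const_mul_cpow _ _ (by rw [Complex.add_re]; linarith)]

theorem RadialEq.congr_right {φ ψ χ : ℝ → ℂ} (h : RadialEq φ ψ)
    (h' : ∀ r ∈ Ioo (0 : ℝ) 1, ψ r = χ r) : RadialEq φ χ := by
  unfold RadialEq at *
  filter_upwards [h, ae_restrict_mem measurableSet_Ioo] with r hr hr'
  rw [hr, h' r hr']

/-- The two inequalities keep the numerator of the Gamma solution free of poles on Re z ≥ 2, so an
identity known only far to the right extends to the whole closed half-plane. -/
theorem mellinTransform_eq_const_mul_gammaSolC {φ : ℝ → ℂ} (hφ : RadialIntegrable φ) {p q : ℤ}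
    {m : ℝ} {C : ℂ} {R : ℝ} (hp : 0 < p)
    (hC : ∀ z : ℂ, R < z.re → mellinTransform φ z = C * gammaSolC p q m z)
    (h1 : 0 < (2 : ℝ) + q) (h2 : 0 < 2 + m + p - q) :
    ∀ z : ℂ, 2 ≤ z.re → mellinTransform φ z = C * gammaSolC p q m z := by
  have hd : ∀ z : ℂ, 2 ≤ z.re → DifferentiableAt ℂ (fun z => C * gammaSolC p q m z) z := fun z hz =>
    (gammaSolC_differentiableAt hp (by linarith) (by linarith)).const_mul C
  exact eqOn_halfPlane_of_eq_far (differentiableOn_mellinTransform hφ)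
    (continuousOn_mellinTransform hφ)
    (fun z (hz : 2 < z.re) => (hd z hz.le).differentiableWithinAt)
    (fun z hz => (hd z hz).continuousAt.continuousWithinAt) hC

/-- With φ̂ equal to C times the Gamma solution far to the right and C ≠ 0, what remains is a
discussion of q: rational solutions give explicit φ, pole-free ones give the Gamma formulas, and the
others are excluded by an exceptional zero. -/
theorem cases_of_commCoeff_eq_zero_of_pos {φ : ℝ → ℂ} (hφ : RadialIntegrable φ)
    (hφ0 : ¬ RadialEq φ fun _ => 0) {p q : ℤ} {m : ℝ} (hp : 0 < p) (hm : -1 ≤ m) {l₀ : ℤ}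
    (h : ∀ l : ℤ, l₀ ≤ l → commCoeff (fun n => mellinTransform φ n) p q (m : ℂ) l = 0) :
    VanishingCase p q m φ ∨ NonvanishingCase p q m φ := by
  have hp1 : (1 : ℝ) ≤ p := by exact_mod_cast hp
  have hpm : 0 ≤ p + m := by linarith
  have hpC : (p : ℂ) ≠ 0 := by exact_mod_cast hp.ne'
  have hE := mellinTransform_functional_eq hφ hp hpm h
  obtain ⟨C, R, hC⟩ := exists_eq_const_mul_gammaSolC hp (differentiableOn_mellinTransform hφ)
    (fun z hz => norm_mellinTransform_le hφ hz) (fun z hz => hE z hz.le)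
  have hC0 : C ≠ 0 := by
    rintro rfl
    apply hφ0
    refine radialEq_zero_of_mellinTransform_eq_zero hφ (n₀ := ⌈R⌉ + 1) fun n hn => ?_
    have h4 : ((⌈R⌉ + 1 : ℤ) : ℝ) ≤ n := by exact_mod_cast hn
    push_cast at h4
    rw [hC _ (by rw [Complex.intCast_re]; linarith [Int.le_ceil R]), zero_mul]
  have hqa := abs_le.mp (le_refl |(q : ℝ)|)
  rcases lt_trichotomy q 0 with hq | hq | hq
  · have hqR : (q : ℝ) ≤ -1 := by exact_mod_cast (by linarith : q ≤ -1)
    rcases lt_or_ge q (-1) with hq1 | hq1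
    · have hq2 : (q : ℝ) ≤ -2 := by exact_mod_cast (by linarith : q ≤ -2)
      -- For q ≤ -2 the factor z+q vanishes at -q ≥ 2. The right-hand factors at the points reached
      -- from there are positive unless p+m = 0, and m ≥ -1 then forces p = 1 and m = -1.
      have hpm0 : (p : ℝ) + m = 0 := by
        by_contra hne
        have hpos : 0 < (p : ℝ) + m := lt_of_le_of_ne hpm (Ne.symm hne)
        refine hC0 (const_eq_zero_of_exceptional_zero hp hpm hE hC (x := -q) (by linarith)
          (by ring) fun j => ?_)
        have hj : 0 ≤ 2 * (p : ℝ) * j := by positivity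
        refine mul_ne_zero ?_ ?_ <;> linarith
      have hpe : p = 1 := by
        have : (p : ℝ) ≤ 1 := by linarith
        have : p ≤ 1 := by exact_mod_cast this
        omega
      subst hpe
      have hme : m = -1 := by push_cast at hpm0; linarith
      subst hme
      refine Or.inr (Or.inl ⟨by linarith, by rw [abs_of_neg hq]; linarith, by simp, 2 * C, ?_⟩)
      have := radialEq_const_mul_cpow hφ (C := 2 * C) (s := (-q : ℤ)) (by
        rw [Complex.intCast_re]; push_cast; linarith) (R := max R (-q)) fun z hz => by
          have h1 : R < z.re := (le_max_left _ _).trans_lt hz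
          have h2 : -(q : ℝ) < z.re := (le_max_right _ _).trans_lt hz
          rw [hC z h1, gammaSolC_one_neg (by linarith) (by linarith)]
          push_cast
          ring
      refine this.congr_right fun r hr => ?_
      rw [← Complex.cpow_natCast]
      congr 2
      have : ((q.natAbs : ℤ)) = -q := by omega
      rw [← this]
      simp
    · have hqe : q = -1 := by omega
      subst hqe
      rcases eq_or_lt_of_le (show 1 ≤ p from hp) with hpe | hp2
      · subst hpe
        refine Or.inl (Or.inr (Or.inr (Or.inr (Or.inr ⟨by norm_num, 2 * C, ?_⟩))))
        -- Partial fractions: 2(z+m)/((z-1)(z+1)) = (m+1)/(z-1) - (m-1)/(z+1), the Mellin transform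
        -- of a combination of r⁻¹ and r.
        have hψ1 : RadialIntegrable fun r => (C * (m + 1)) * (r : ℂ) ^ (-1 : ℂ) :=
          radialIntegrable_const_mul_cpow _ (by simp)
        have hψ2 : RadialIntegrable fun r => (-C * (m - 1)) * (r : ℂ) ^ (1 : ℂ) :=
          radialIntegrable_const_mul_cpow _ (by simp; norm_num)
        have := radialEq_of_mellinTransform_eq hφ (hψ1.add hψ2) (R := max R 2) fun z hz => by
          have h1 : R < z.re := (le_max_left _ _).trans_lt hz
          have h2 : 2 < z.re := (le_max_right _ _).trans_lt hz
          have n1 : z - 1 ≠ 0 := by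
            intro h0
            have := congrArg Complex.re h0
            simp at this
            linarith
          have n2 : z + 1 ≠ 0 := by
            intro h0
            have := congrArg Complex.re h0
            simp at this
            linarith
          rw [hC z h1, mellinTransform_add hψ1 hψ2 h2.le, mellinTransform_const_mul_cpow _ _
            (by simp; linarith), mellinTransform_const_mul_cpow _ _ (by simp; linarith),
            gammaSolC_one_neg_one (by linarith) (by linarith), ← sub_eq_add_neg]
          field_simp
          ring
        refine this.congr_right fun r hr => ?_
        rw [Complex.cpow_neg_one, Complex.cpow_one]
        ring
      · refine Or.inr (Or.inr (Or.inl ⟨by omega, by norm_num, C, fun z hz => ?_⟩))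
        have hp2' : (2 : ℝ) ≤ p := by exact_mod_cast hp2
        rw [mellinTransform_eq_const_mul_gammaSolC hφ hp hC (by norm_num)
          (by push_cast; linarith) z hz, abs_of_pos hp, gammaSolC]
        push_cast
        congr 5 <;> ring
  · subst hq
    refine Or.inl (Or.inr (Or.inl ⟨rfl, 2 * p * C, ?_⟩))
    have := radialEq_const_mul_cpow hφ (C := 2 * p * C) (s := 0) (by simp) (R := max R 2)
      fun z hz => by
        have h1 : R < z.re := (le_max_left _ _).trans_lt hz
        have h2 : 2 < z.re := (le_max_right _ _).trans_lt hz
        rw [hC z h1, gammaSolC_zero_right hp (by linarith) (by linarith)]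
        rw [add_zero]
        ring
    exact this.congr_right fun r hr => by rw [Complex.cpow_zero, mul_one]
  · have hqR : (1 : ℝ) ≤ q := by exact_mod_cast hq
    by_cases hpq : p = q
    · subst hpq
      refine Or.inl (Or.inr (Or.inr (Or.inr (Or.inl ⟨rfl, hp.ne', 2 * p * C, ?_⟩))))
      have := radialEq_const_mul_cpow hφ (C := 2 * p * C) (s := m) (by
        rw [Complex.ofReal_re]; linarith) (R := max R 2) fun z hz => by
          have h1 : R < z.re := (le_max_left _ _).trans_lt hz
          have h2 : 2 < z.re := (le_max_right _ _).trans_lt hz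
          rw [hC z h1, gammaSolC_self hp (by linarith) (by linarith)]
          ring
      exact this.congr_right fun r hr => by rw [Complex.ofReal_cpow hr.1.le]
    · rcases lt_or_ge (q : ℝ) (m + p + 2) with hlt | hge
      · refine Or.inr (Or.inr (Or.inr (Or.inl ⟨mul_pos hp hq, hpq, ?_, C, fun z hz => ?_⟩)))
        · rwa [abs_of_pos hp, abs_of_pos hq]
        · rw [mellinTransform_eq_const_mul_gammaSolC hφ hp hC (by linarith)
            (by linarith) z hz, abs_of_pos hp, abs_of_pos hq, gammaSolC]
      · by_cases hn : ∃ n : ℕ, m = (2 * n + 1) * p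
        · obtain ⟨n, hn⟩ := hn
          refine Or.inr (Or.inr (Or.inr (Or.inr ⟨mul_pos hp hq, ?_, n, ?_, C, ?_⟩)))
          · rwa [abs_of_pos hp, abs_of_pos hq]
          · rwa [abs_of_pos hp]
          · rw [abs_of_pos hp, abs_of_pos hq]
            have hden : ∀ z : ℂ, 2 ≤ z.re →
                ∏ j ∈ Finset.Icc 0 n, ((z + q) / (2 * p) + (j : ℂ)) ≠ 0 := by
              intro z hz
              refine Finset.prod_ne_zero_iff.mpr fun j _ h0 => ?_
              have h1 := re_div_two_mul_pos (z := z + q) hp (by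
                rw [Complex.add_re, Complex.intCast_re]; linarith)
              have h2 := congrArg Complex.re h0
              rw [Complex.add_re, Complex.natCast_re, Complex.zero_re] at h2
              linarith [(Nat.cast_nonneg j : (0 : ℝ) ≤ j)]
            have hd : ∀ z : ℂ, 2 ≤ z.re → DifferentiableAt ℂ (fun z : ℂ =>
                C * ((∏ j ∈ Finset.Icc 1 n, ((z - q) / (2 * p) + j)) /
                  ∏ j ∈ Finset.Icc 0 n, ((z + q) / (2 * p) + j))) z := by
              intro z hz
              have d1 : DifferentiableAt ℂ (fun z : ℂ =>
                  ∏ j ∈ Finset.Icc 1 n, ((z - q) / (2 * p) + (j : ℂ))) z :=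
                DifferentiableAt.fun_finsetProd fun j _ => by fun_prop
              have d2 : DifferentiableAt ℂ (fun z : ℂ =>
                  ∏ j ∈ Finset.Icc 0 n, ((z + q) / (2 * p) + (j : ℂ))) z :=
                DifferentiableAt.fun_finsetProd fun j _ => by fun_prop
              exact (d1.fun_div d2 (hden z hz)).const_mul C
            -- The Gamma quotient is known to equal the rational function only for Re z > q. The
            -- rational function has no poles on Re z ≥ 2, so the identity theorem carries the
            -- formula down to there.
            refine eqOn_halfPlane_of_eq_far (R := max R (q + 1))
              (differentiableOn_mellinTransform hφ) (continuousOn_mellinTransform hφ)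
              (fun z (hz : 2 < z.re) => (hd z hz.le).differentiableWithinAt)
              (fun z hz => (hd z hz).continuousAt.continuousWithinAt) fun z hz => ?_
            have h1 : R < z.re := (le_max_left _ _).trans_lt hz
            have h2 : (q : ℝ) + 1 < z.re := (le_max_right _ _).trans_lt hz
            rw [hC z h1, gammaSolC_odd_multiple hp hn (by linarith) (by linarith)]
        · exfalso
          -- The exceptional zero is q-p-m ≥ 2. One right-hand factor along the orbit is (2j+1)p -
          -- m, which vanishes exactly when m is an odd multiple of p, the excluded situation; the
          -- other is positive.
          refine hC0 (const_eq_zero_of_exceptional_zero hp hpm hE hC (x := q - p - m) (by linarith)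
            (by ring) fun j => ?_)
          have hj : 0 ≤ 2 * (p : ℝ) * j := by positivity
          refine mul_ne_zero ?_ ?_
          · intro h0
            exact hn ⟨j, by linarith⟩
          · linarith

theorem vanishingCase_neg {k₁ k₂ : ℤ} {m : ℝ} {φ : ℝ → ℂ} :
    VanishingCase (-k₁) (-k₂) m φ ↔ VanishingCase k₁ k₂ m φ := by
  unfold VanishingCase
  simp only [neg_eq_zero, neg_mul_neg, neg_inj, ne_eq]

theorem nonvanishingCase_neg {k₁ k₂ : ℤ} {m : ℝ} {φ : ℝ → ℂ} :
    NonvanishingCase (-k₁) (-k₂) m φ ↔ NonvanishingCase k₁ k₂ m φ := by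
  unfold NonvanishingCase
  simp only [neg_mul_neg, abs_neg, neg_inj, ne_eq, Int.natAbs_neg]

theorem exists_forall_ge_eq_zero {D : ℤ → ℂ} (h : {l | D l ≠ 0}.Finite) :
    ∃ l₀ : ℤ, ∀ l, l₀ ≤ l → D l = 0 := by
  obtain ⟨b, hb⟩ := h.bddAbove
  refine ⟨b + 1, fun l hl => ?_⟩
  by_contra hne
  have := hb hne
  linarith

/-- If almost all coefficients of the commutator vanish, one of the nine cases occurs. -/
theorem cases_of_commCoeff_finite_support {φ : ℝ → ℂ} (hφ : RadialIntegrable φ)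
    (hφ0 : ¬ RadialEq φ fun _ => 0) {k₁ k₂ : ℤ} {m : ℝ} (hm : -1 ≤ m)
    (h : {l | commCoeff (fun n => mellinTransform φ n) k₁ k₂ (m : ℂ) l ≠ 0}.Finite) :
    VanishingCase k₁ k₂ m φ ∨ NonvanishingCase k₁ k₂ m φ := by
  rcases lt_trichotomy k₁ 0 with hk | hk | hk
  · rw [← vanishingCase_neg, ← nonvanishingCase_neg]
    have h' : {l | commCoeff (fun n => mellinTransform φ n) (-k₁) (-k₂) (m : ℂ) l ≠ 0}.Finite := by
      refine (h.image fun l => -l).subset fun l hl => ⟨-l, ?_, neg_neg l⟩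
      have := commCoeff_neg (fun n => mellinTransform φ n) k₁ k₂ (m : ℂ) (-l)
      rw [neg_neg] at this
      rw [mem_ofPred_eq] at hl ⊢
      rwa [← this]
    obtain ⟨l₀, hl₀⟩ := exists_forall_ge_eq_zero h'
    exact cases_of_commCoeff_eq_zero_of_pos hφ hφ0 (by omega) hm hl₀
  · subst hk
    left
    by_cases hm0 : m = 0
    · exact Or.inl ⟨rfl, hm0⟩
    by_cases hk2 : k₂ = 0
    · exact Or.inr (Or.inr (Or.inl ⟨rfl, hk2⟩))
    exfalso
    obtain ⟨l₀, hl₀⟩ := exists_forall_ge_eq_zero h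
    set N : ℤ := max l₀ (|k₂| + 1) with hN
    have hN1 : l₀ ≤ N := le_max_left _ _
    have hN2 : |k₂| + 1 ≤ N := le_max_right _ _
    have hq := abs_le.mp (le_refl |k₂|)
    -- For k₁ = 0 both terms contain the same Mellin value, and cross-multiplying leaves k₂ m times
    -- it. The zeros along a progression of step 2 then force φ = 0.
    have hzero : ∀ l : ℤ, N ≤ l → mellinTransform φ ((2 * l + k₂ + 2 : ℤ) : ℂ) = 0 := by
      intro l hl
      have e := hl₀ l (hN1.trans hl)
      unfold commCoeff at e
      simp only [add_zero] at e
      rw [abs_of_nonneg (show 0 ≤ l by linarith [abs_nonneg k₂]),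
        abs_of_nonneg (show 0 ≤ l + k₂ by linarith [hq.1]),
        show l + (l + k₂) + 2 = 2 * l + k₂ + 2 by ring] at e
      have hl1 : (0 : ℝ) ≤ l := by exact_mod_cast (by linarith [abs_nonneg k₂] : 0 ≤ l)
      have hl2 : (0 : ℝ) ≤ l + k₂ := by exact_mod_cast (by linarith [hq.1] : 0 ≤ l + k₂)
      have d1 : ((l + k₂ : ℤ) : ℂ) + ((l + k₂ : ℤ) : ℂ) + 2 + (m : ℂ) ≠ 0 := by
        have : ((l : ℝ) + k₂ + (l + k₂) + 2 + m) ≠ 0 := by linarith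
        exact_mod_cast this
      have d2 : (l : ℂ) + (l : ℂ) + 2 + (m : ℂ) ≠ 0 := by
        have : ((l : ℝ) + l + 2 + m) ≠ 0 := by linarith
        exact_mod_cast this
      rw [sub_eq_zero, div_eq_div_iff d1 d2] at e
      have hkm : (k₂ : ℂ) * m ≠ 0 :=
        mul_ne_zero (by exact_mod_cast hk2) (by exact_mod_cast hm0)
      have : (k₂ : ℂ) * m * mellinTransform φ ((2 * l + k₂ + 2 : ℤ) : ℂ) = 0 := by
        generalize mellinTransform φ ((2 * l + k₂ + 2 : ℤ) : ℂ) = A at *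
        push_cast at e
        linear_combination e
      exact (mul_eq_zero.mp this).resolve_left hkm
    have haR : 2 < ((2 * N + k₂ + 2 : ℤ) : ℂ).re := by
      simp only [Complex.intCast_re]
      exact_mod_cast (by linarith [hq.1] : 2 < 2 * N + k₂ + 2)
    refine hφ0 (radialEq_zero_of_mellinTransform_eq_zero hφ (n₀ := 2 * N + k₂ + 3) fun n hn => ?_)
    refine (isMomentFunction_mellinTransform hφ).eq_zero haR (fun j => ?_) ?_
    · rw [← hzero (N + j) (by omega)]
      congr 1
      push_cast
      ring
    · simp only [Complex.intCast_re]
      exact_mod_cast (by omega : 2 * N + k₂ + 2 < n)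
  · obtain ⟨l₀, hl₀⟩ := exists_forall_ge_eq_zero h
    exact cases_of_commCoeff_eq_zero_of_pos hφ hφ0 hk hm hl₀

end HarmonicToeplitz

namespace HarmonicToeplitz

open Filter Topology Set

/-! ### Coefficients of the commutator in the nine cases -/

theorem mellinTransform_of_radialEq_cpow {φ : ℝ → ℂ} {C s : ℂ}
    (h : RadialEq φ fun r => C * (r : ℂ) ^ s) {z : ℂ} (hz : 0 < (z + s).re) :
    mellinTransform φ z = C / (z + s) := by
  rw [mellinTransform_congr h, mellinTransform_const_mul_cpow C s hz]

theorem two_le_re_intCast {n : ℤ} (hn : 2 ≤ n) : 2 ≤ ((n : ℤ) : ℂ).re := by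
  rw [Complex.intCast_re]
  exact_mod_cast hn

theorem ofReal_add_intCast_ne_zero {m : ℝ} (hm : -1 ≤ m) {n : ℤ} (hn : 2 ≤ n) :
    (n : ℂ) + m ≠ 0 := by
  have h2 : (2 : ℝ) ≤ n := by exact_mod_cast hn
  have : (n : ℝ) + m ≠ 0 := by linarith
  exact_mod_cast this

theorem commCoeff_one_neg_one_eq_zero {F : ℤ → ℂ} {m : ℝ} (hm : -1 ≤ m) {C : ℂ}
    (hF : ∀ n : ℤ, 2 ≤ n → F n = C * (n + m) / ((n - 1) * (n + 1))) (l : ℤ) :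
    commCoeff F 1 (-1) (m : ℂ) l = 0 := by
  have hpos : ∀ l : ℤ, 1 ≤ l → commCoeff F 1 (-1) (m : ℂ) l = 0 := by
    intro l hl
    unfold commCoeff
    rw [abs_of_nonneg (show 0 ≤ l by linarith), abs_of_nonneg (show 0 ≤ l + -1 by linarith),
      abs_of_nonneg (show 0 ≤ l + 1 by linarith), abs_of_nonneg (show 0 ≤ l + 1 + -1 by linarith),
      hF _ (by linarith), hF _ (by linarith)]
    have h1 : (l : ℂ) ≠ 0 := by exact_mod_cast (by omega : l ≠ 0)
    have h2 : (l : ℂ) + 1 ≠ 0 := by exact_mod_cast (by omega : l + 1 ≠ 0)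
    have h3 : (l : ℂ) + 2 ≠ 0 := by exact_mod_cast (by omega : l + 2 ≠ 0)
    have h4 := ofReal_add_intCast_ne_zero hm (n := l + (l + -1) + 2) (by linarith)
    have h5 := ofReal_add_intCast_ne_zero hm (n := l + 1 + (l + 1 + -1) + 2) (by linarith)
    rw [show ((l + -1 : ℤ) : ℂ) + ((l + 1 + -1 : ℤ) : ℂ) + 2 + m =
        ((l + (l + -1) + 2 : ℤ) : ℂ) + m by push_cast; ring,
      show (l : ℂ) + ((l + 1 : ℤ) : ℂ) + 2 + m = ((l + 1 + (l + 1 + -1) + 2 : ℤ) : ℂ) + m by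
        push_cast; ring]
    generalize hA : ((l + (l + -1) + 2 : ℤ) : ℂ) + m = A at *
    generalize hB : ((l + 1 + (l + 1 + -1) + 2 : ℤ) : ℂ) + m = B at *
    rw [show ((l + (l + -1) + 2 : ℤ) : ℂ) - 1 = 2 * l by push_cast; ring,
      show ((l + (l + -1) + 2 : ℤ) : ℂ) + 1 = 2 * (l + 1) by push_cast; ring,
      show ((l + 1 + (l + 1 + -1) + 2 : ℤ) : ℂ) - 1 = 2 * (l + 1) by push_cast; ring,
      show ((l + 1 + (l + 1 + -1) + 2 : ℤ) : ℂ) + 1 = 2 * (l + 2) by push_cast; ring]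
    push_cast
    field_simp
    ring
  have href := commCoeff_reflect F 1 (-1) (m : ℂ) l
  rw [show -l - 1 - -1 = -l by ring] at href
  rcases lt_trichotomy l 0 with hl | hl | hl
  · rw [hpos (-l) (by linarith)] at href
    exact neg_eq_zero.mp href.symm
  -- The index 0 is the fixed point of the reflection when k₁+k₂ = 0, so the coefficient equals its
  -- own negative.
  · subst hl
    rw [neg_zero] at href
    linear_combination href / 2
  · exact hpos l hl

theorem commCoeff_eq_zero_of_vanishingCase {φ : ℝ → ℂ} {k₁ k₂ : ℤ} {m : ℝ} (hm : -1 ≤ m)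
    (h : VanishingCase k₁ k₂ m φ) (l : ℤ) :
    commCoeff (fun n => mellinTransform φ n) k₁ k₂ (m : ℂ) l = 0 := by
  rcases h with ⟨rfl, rfl⟩ | ⟨rfl, C, hC⟩ | ⟨rfl, rfl⟩ | ⟨rfl, -, C, hC⟩ | ⟨hk, C, hC⟩
  · have h1 : ((|l| : ℤ) : ℂ) + 1 ≠ 0 := by exact_mod_cast (by positivity : |l| + 1 ≠ 0)
    have h2 : ((|l + k₂| : ℤ) : ℂ) + 1 ≠ 0 := by
      exact_mod_cast (by positivity : |l + k₂| + 1 ≠ 0)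
    unfold commCoeff
    simp only [add_zero, Complex.ofReal_zero]
    rw [show ((|l| : ℤ) : ℂ) + (|l| : ℤ) + 2 = 2 * ((|l| : ℤ) + 1) by ring,
      show ((|l + k₂| : ℤ) : ℂ) + (|l + k₂| : ℤ) + 2 = 2 * ((|l + k₂| : ℤ) + 1) by ring]
    field_simp
    ring
  · have hF : ∀ n : ℤ, 0 ≤ n → ((n : ℂ) + 1) * mellinTransform φ ((n + n + 2 : ℤ) : ℂ) = C / 2 := by
      intro n hn
      have hnR : (0 : ℝ) ≤ n := by exact_mod_cast hn
      have hC' : RadialEq φ fun r => C * (r : ℂ) ^ (0 : ℂ) :=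
        hC.congr_right fun r _ => by rw [Complex.cpow_zero, mul_one]
      rw [mellinTransform_of_radialEq_cpow hC' (by
        rw [add_zero, Complex.intCast_re]; push_cast; linarith)]
      have h1 : (n : ℂ) + 1 ≠ 0 := by exact_mod_cast (by omega : n + 1 ≠ 0)
      push_cast
      rw [show (n : ℂ) + n + 2 + 0 = 2 * (n + 1) by ring]
      field_simp
    unfold commCoeff
    simp only [add_zero]
    rw [hF _ (abs_nonneg l), hF _ (abs_nonneg (l + k₁)), sub_self]
  · unfold commCoeff
    simp
  · have hC' : RadialEq φ fun r => C * (r : ℂ) ^ (m : ℂ) :=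
      hC.congr_right fun r hr => by rw [Complex.ofReal_cpow hr.1.le]
    have hF : ∀ n : ℤ, 2 ≤ n → mellinTransform φ (n : ℂ) = C / (n + m) := by
      intro n hn
      have h2 : (2 : ℝ) ≤ n := by exact_mod_cast hn
      exact mellinTransform_of_radialEq_cpow hC' (by
        rw [Complex.add_re, Complex.intCast_re, Complex.ofReal_re]; linarith)
    unfold commCoeff
    beta_reduce
    rw [hF _ (le_add_of_nonneg_left (by positivity)), hF _ (le_add_of_nonneg_left (by positivity))]
    push_cast
    ring
  · have hF : ∀ n : ℤ, 2 ≤ n →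
        mellinTransform φ (n : ℂ) = C * (n + m) / ((n - 1) * (n + 1)) := by
      intro n hn
      have h2 : (2 : ℝ) ≤ n := by exact_mod_cast hn
      have hψ1 : RadialIntegrable fun r => (C * ((m + 1) / 2)) * (r : ℂ) ^ (-1 : ℂ) :=
        radialIntegrable_const_mul_cpow _ (by simp)
      have hψ2 : RadialIntegrable fun r => (-C * ((m - 1) / 2)) * (r : ℂ) ^ (1 : ℂ) :=
        radialIntegrable_const_mul_cpow _ (by simp; norm_num)
      have hC' := hC.congr_right (χ := fun r => (C * ((m + 1) / 2)) * (r : ℂ) ^ (-1 : ℂ) +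
        (-C * ((m - 1) / 2)) * (r : ℂ) ^ (1 : ℂ)) fun r _ => by
          rw [Complex.cpow_neg_one, Complex.cpow_one]
          ring
      rw [mellinTransform_congr hC', mellinTransform_add hψ1 hψ2 (two_le_re_intCast hn),
        mellinTransform_const_mul_cpow _ _ (by simp; linarith),
        mellinTransform_const_mul_cpow _ _ (by simp; linarith)]
      have n1 : (n : ℂ) - 1 ≠ 0 := by exact_mod_cast (by omega : n - 1 ≠ 0)
      have n2 : (n : ℂ) + 1 ≠ 0 := by exact_mod_cast (by omega : n + 1 ≠ 0)
      rw [← sub_eq_add_neg]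
      field_simp
      ring
    rcases Int.mul_eq_neg_one_iff_eq_one_or_neg_one.mp hk with ⟨rfl, rfl⟩ | ⟨rfl, rfl⟩
    · exact commCoeff_one_neg_one_eq_zero hm hF l
    · have := commCoeff_neg (fun n => mellinTransform φ n) (-1) 1 (m : ℂ) l
      rw [← this]
      exact commCoeff_one_neg_one_eq_zero hm hF (-l)

theorem mem_indexSet {k₁ k₂ k : ℤ} : k ∈ indexSet k₁ k₂ ↔
    -boundN k₁ k₂ + 1 ≤ k ∧ k ≤ boundN k₁ k₂ + k₁ + k₂ - 1 ∧ 2 * k ≠ k₁ + k₂ := by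
  have : (k : ℚ) ≠ (k₁ + k₂) / 2 ↔ 2 * k ≠ k₁ + k₂ := by
    rw [ne_eq, ne_eq, eq_div_iff two_ne_zero]
    constructor
    · intro h1 h2
      apply h1
      exact_mod_cast (by linarith : k * 2 = k₁ + k₂)
    · intro h1 h2
      apply h1
      have h3 : k * 2 = k₁ + k₂ := by exact_mod_cast h2
      linarith
  unfold indexSet
  rw [mem_ofPred_eq, this]

theorem mem_indexSet_neg {k₁ k₂ k : ℤ} : k ∈ indexSet (-k₁) (-k₂) ↔ -k ∈ indexSet k₁ k₂ := by
  rw [mem_indexSet, mem_indexSet]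
  unfold boundN
  omega

/-- An index outside the set falls under the functional equation, either directly or after the
reflection, or is the midpoint (p+q)/2, where antisymmetry alone gives zero. -/
theorem commCoeff_gammaSol_eq_zero_of_notMem {p q : ℤ} {m : ℝ} (hp : 0 < p) (hpm : 0 ≤ p + m)
    {l : ℤ} (hl : l + p + q ∉ indexSet p q) : commCoeff (gammaSol p q m) p q m l = 0 := by
  rw [mem_indexSet] at hl
  have href := commCoeff_reflect (gammaSol p q m) p q m l
  have hcases : (0 ≤ l ∧ 0 ≤ l + q) ∨ (0 ≤ -l - p - q ∧ 0 ≤ -l - p - q + q) ∨ -l - p - q = l := by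
    unfold boundN at hl
    omega
  rcases hcases with ⟨h1, h2⟩ | ⟨h1, h2⟩ | h1
  · exact commCoeff_gammaSol_eq_zero hp hpm h1 h2
  · rw [commCoeff_gammaSol_eq_zero hp hpm h1 h2] at href
    exact neg_eq_zero.mp href.symm
  · rw [h1] at href
    linarith

/-- By reflection it suffices to treat the half 2x < p+q, where l = -x. The three sign patterns
near, far and mid cover it. -/
theorem commCoeff_gammaSol_ne_zero_of_pos {p q : ℤ} {m : ℝ} (hp : 0 < p) (hpm : 0 < p + m)
    (hq : 0 < q) (hpq : p ≠ q) {l : ℤ} (hl : l + p + q ∈ indexSet p q) :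
    commCoeff (gammaSol p q m) p q m l ≠ 0 := by
  have hhalf : ∀ x : ℤ, 0 < x → 2 * x < p + q → commCoeff (gammaSol p q m) p q m (-x) ≠ 0 := by
    intro x hx hx2
    by_cases h1 : x ≤ p
    · by_cases h2 : x ≤ q
      · exact commCoeff_gammaSol_near hp hpm hpq hx h1 h2
      · exact commCoeff_gammaSol_far hp hpm hq.ne' hx.le h1 (by omega) (by omega) (by omega)
          (by omega) (by omega)
    · exact commCoeff_gammaSol_mid hp hpm (by omega) (by omega) (by omega)
  rw [mem_indexSet] at hl
  unfold boundN at hl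
  have hl' : 0 < -l ∧ 0 < l + p + q ∧ 2 * -l ≠ p + q := by omega
  obtain ⟨h1, h2, h3⟩ := hl'
  rcases lt_or_gt_of_ne h3 with h4 | h4
  · have := hhalf (-l) h1 h4
    rwa [neg_neg] at this
  · have := hhalf (l + p + q) h2 (by omega)
    rw [show -(l + p + q) = -l - p - q by ring, commCoeff_reflect, neg_ne_zero] at this
    exact this

theorem commCoeff_gammaSol_ne_zero_of_neg_one {p : ℤ} {m : ℝ} (hp : 2 ≤ p) (hpm : 0 < p + m)
    {l : ℤ} (hl : l + p + -1 ∈ indexSet p (-1)) :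
    commCoeff (gammaSol p (-1) m) p (-1) m l ≠ 0 := by
  rw [mem_indexSet] at hl
  unfold boundN at hl
  have := commCoeff_gammaSol_far (p := p) (q := -1) (m := m) (x := -l) (by omega) hpm (by norm_num)
    (by omega) (by omega) (by omega) (by omega) (by omega) (by omega) (by omega)
  rwa [neg_neg] at this

/-- Here p+m = 0, so the parameter b is 0 and strict monotonicity of the Gamma cross ratio is
unavailable. But both Mellin values equal C/(2(1-q)), and the remaining equation is linear in l. -/
theorem commCoeff_ne_zero_of_one {q : ℤ} (hq : q ≤ -2) {l : ℤ} (hl : l + 1 + q ∈ indexSet 1 q)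
    {F : ℤ → ℂ} {C : ℂ} (hC : C ≠ 0) (hF : ∀ n : ℤ, 2 ≤ n → F n = C / (n - q)) :
    commCoeff F 1 q ((-1 : ℝ) : ℂ) l ≠ 0 := by
  rw [mem_indexSet] at hl
  unfold boundN at hl
  have hl' : 0 ≤ l ∧ l + q + 1 ≤ 0 ∧ 2 * l + 1 + q ≠ 0 := by omega
  obtain ⟨h1, h2, h3⟩ := hl'
  unfold commCoeff
  rw [abs_of_nonneg h1, abs_of_nonpos (show l + q ≤ 0 by linarith),
    abs_of_nonneg (show 0 ≤ l + 1 by linarith), abs_of_nonpos (show l + 1 + q ≤ 0 by linarith),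
    hF _ (by linarith), hF _ (by linarith)]
  have n1 : (l : ℂ) + 1 ≠ 0 := by exact_mod_cast (by omega : l + 1 ≠ 0)
  have n2 : (l : ℂ) + q ≠ 0 := by exact_mod_cast (by omega : l + q ≠ 0)
  have n3 : (1 : ℂ) - q ≠ 0 := by exact_mod_cast (by omega : 1 - q ≠ 0)
  have n4 : (2 : ℂ) * l + 1 + q ≠ 0 := by exact_mod_cast h3
  intro h
  push_cast at h
  rw [show (l : ℂ) + -(l + q) + 2 - q = 2 * (1 - q) by ring,
    show (l : ℂ) + 1 + -(l + 1 + q) + 2 - q = 2 * (1 - q) by ring,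
    show -((l : ℂ) + q) + -(l + 1 + q) + 2 + -1 = 2 * -(l + q) by ring,
    show (l : ℂ) + (l + 1) + 2 + -1 = 2 * (l + 1) by ring] at h
  have h5 : C * (2 * l + 1 + q) = 0 := by
    field_simp at h
    linear_combination -h
  exact mul_ne_zero hC n4 h5

theorem commCoeff_ne_zero_iff_of_gammaSol {F : ℤ → ℂ} {p q : ℤ} {m : ℝ} {C : ℂ} (hp : 0 < p)
    (hpm : 0 ≤ p + m) (hC : C ≠ 0) (hF : ∀ n : ℤ, |q| + 2 ≤ n → F n = C * (gammaSol p q m n : ℝ))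
    {l : ℤ} (h : l + p + q ∈ indexSet p q → commCoeff (gammaSol p q m) p q m l ≠ 0) :
    commCoeff F p q (m : ℂ) l ≠ 0 ↔ l + p + q ∈ indexSet p q := by
  rw [commCoeff_congr p q (m : ℂ) l C hF, commCoeff_ofReal]
  constructor
  · intro h1
    by_contra h2
    rw [commCoeff_gammaSol_eq_zero_of_notMem hp hpm h2] at h1
    simp at h1
  · intro h1
    exact mul_ne_zero hC (by exact_mod_cast h h1)

theorem commCoeff_ne_zero_iff_of_pos {φ : ℝ → ℂ} (hφ : RadialIntegrable φ)
    (hφ0 : ¬ RadialEq φ fun _ => 0) {p q : ℤ} {m : ℝ} (hp : 0 < p) (hm : -1 ≤ m)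
    (h : NonvanishingCase p q m φ) (l : ℤ) :
    commCoeff (fun n => mellinTransform φ n) p q (m : ℂ) l ≠ 0 ↔ l + p + q ∈ indexSet p q := by
  have hp1 : (1 : ℝ) ≤ p := by exact_mod_cast hp
  have hpm : 0 ≤ p + m := by linarith
  have hne : ∀ {C : ℂ} {G : ℂ → ℂ}, (∀ z : ℂ, 2 ≤ z.re → mellinTransform φ z = C * G z) →
      C ≠ 0 := by
    rintro C G hG rfl
    refine hφ0 (radialEq_zero_of_mellinTransform_eq_zero hφ (n₀ := 2) fun n hn => ?_)
    rw [hG _ (two_le_re_intCast hn), zero_mul]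
  have hn2 : ∀ {n : ℤ}, |q| + 2 ≤ n → 2 ≤ ((n : ℤ) : ℂ).re := fun hn =>
    two_le_re_intCast (by linarith [abs_nonneg q])
  rcases h with ⟨h1, h2, h3, C, hC⟩ | ⟨h1, h2, C, hC⟩ | ⟨h1, h2, hlt, C, hC⟩ |
     ⟨h1, h2, n, h3, C, hC⟩
  · rw [abs_of_pos hp] at h3
    have hpe : p = 1 := by
      have : (p : ℝ) ≤ 1 := by linarith
      have : p ≤ 1 := by exact_mod_cast this
      omega
    subst hpe
    have hq : q ≤ -2 := by omega
    have hme : m = -1 := by push_cast at h3; linarith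
    subst hme
    have hC0 : C ≠ 0 := by
      rintro rfl
      exact hφ0 (hC.congr_right fun r _ => zero_mul _)
    have hqR : (q : ℝ) ≤ -2 := by exact_mod_cast hq
    have hC' : RadialEq φ fun r => C * (r : ℂ) ^ ((-q : ℤ) : ℂ) := hC.congr_right fun r _ => by
      rw [← Complex.cpow_natCast]
      congr 2
      have : ((q.natAbs : ℤ)) = -q := by omega
      rw [← this]
      simp
    have hF : ∀ n : ℤ, 2 ≤ n → mellinTransform φ (n : ℂ) = C / (n - q) := by
      intro n hn
      have : (2 : ℝ) ≤ n := by exact_mod_cast hn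
      rw [mellinTransform_of_radialEq_cpow hC' (by
        rw [Complex.add_re, Complex.intCast_re, Complex.intCast_re]; push_cast; linarith)]
      push_cast
      rw [sub_eq_add_neg]
    refine ⟨fun h4 => ?_, fun h4 => commCoeff_ne_zero_of_one hq h4 hC0 hF⟩
    by_contra h5
    apply h4
    rw [commCoeff_congr (G := fun n => ((gammaSol 1 q (-1) n : ℝ) : ℂ)) 1 q _ l (C / 2),
      commCoeff_ofReal, commCoeff_gammaSol_eq_zero_of_notMem one_pos hpm h5]
    · simp
    · intro n hn
      have hn' := hn2 hn
      have hq' : |q| = -q := abs_of_neg (by omega)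
      have hnq : (0 : ℝ) < n + q := by exact_mod_cast (by omega : 0 < n + q)
      have hnq' : (0 : ℝ) < n - q := by exact_mod_cast (by omega : 0 < n - q)
      rw [hF n (by omega), ← gammaSolC_natural one_pos hpm hn, gammaSolC_one_neg
        (by rwa [Complex.intCast_re]) (by rwa [Complex.intCast_re])]
      ring
  · have hqe : q = -1 := by
      rcases (abs_eq one_pos.le).mp h2 with h4 | h4
      · subst h4; omega
      · exact h4
    subst hqe
    have hp2 : 2 ≤ p := by omega
    have hp2' : (2 : ℝ) ≤ p := by exact_mod_cast hp2
    refine commCoeff_ne_zero_iff_of_gammaSol hp hpm (hne hC) (fun n hn => ?_)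
      fun h4 => commCoeff_gammaSol_ne_zero_of_neg_one hp2 (by linarith) h4
    rw [hC _ (hn2 hn), ← gammaSolC_natural hp hpm hn, abs_of_pos hp, gammaSolC]
    push_cast
    congr 5 <;> ring
  · have hq : 0 < q := by
      by_contra h4
      nlinarith
    rw [abs_of_pos hp, abs_of_pos hq] at hC
    -- If p+m = 0 then p = 1, and the bound on q gives q < 2, hence q = p, which this case excludes.
    have hpm' : 0 < (p : ℝ) + m := by
      refine lt_of_le_of_ne hpm fun h5 => h2 ?_
      rw [abs_of_pos hp, abs_of_pos hq] at hlt
      have h6 : (q : ℝ) < 2 := by linarith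
      have h7 : q < 2 := by exact_mod_cast h6
      have h8 : (p : ℝ) ≤ 1 := by linarith
      have h9 : p ≤ 1 := by exact_mod_cast h8
      omega
    refine commCoeff_ne_zero_iff_of_gammaSol hp hpm (hne hC) (fun n hn => ?_)
      fun h4 => commCoeff_gammaSol_ne_zero_of_pos hp hpm' hq h2 h4
    rw [hC _ (hn2 hn), ← gammaSolC_natural hp hpm hn, gammaSolC]
  · have hq : 0 < q := by
      by_contra h4
      nlinarith
    rw [abs_of_pos hp] at h3
    rw [abs_of_pos hp, abs_of_pos hq] at hC h2
    have hm0 : 0 < m := by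
      rw [h3]
      positivity
    have hpq : p ≠ q := by
      rintro rfl
      linarith
    refine commCoeff_ne_zero_iff_of_gammaSol hp hpm (hne hC) (fun n hn => ?_)
      fun h4 => commCoeff_gammaSol_ne_zero_of_pos hp (by linarith) hq hpq h4
    rw [abs_of_pos hq] at hn
    have hnq : (0 : ℝ) < n + q := by exact_mod_cast (by omega : 0 < n + q)
    have hnq' : (0 : ℝ) < n - q := by exact_mod_cast (by omega : 0 < n - q)
    rw [hC _ (two_le_re_intCast (by omega)), ← gammaSolC_natural hp hpm
      (by rwa [abs_of_pos hq]), gammaSolC_odd_multiple hp h3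
      (by rwa [Complex.intCast_re]) (by rwa [Complex.intCast_re])]

theorem commCoeff_ne_zero_iff {φ : ℝ → ℂ} (hφ : RadialIntegrable φ)
    (hφ0 : ¬ RadialEq φ fun _ => 0) {k₁ k₂ : ℤ} {m : ℝ} (hm : -1 ≤ m)
    (h : NonvanishingCase k₁ k₂ m φ) (l : ℤ) :
    commCoeff (fun n => mellinTransform φ n) k₁ k₂ (m : ℂ) l ≠ 0 ↔
      l + k₁ + k₂ ∈ indexSet k₁ k₂ := by
  rcases lt_trichotomy k₁ 0 with hk | hk | hk
  · rw [← commCoeff_neg, commCoeff_ne_zero_iff_of_pos hφ hφ0 (by omega) hm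
      (nonvanishingCase_neg.mpr h), mem_indexSet_neg]
    rw [show -(-l + -k₁ + -k₂) = l + k₁ + k₂ by ring]
  · subst hk
    rcases h with ⟨h, -⟩ | ⟨h, -⟩ | ⟨h, -⟩ | ⟨h, -⟩ <;> simp at h
  · exact commCoeff_ne_zero_iff_of_pos hφ hφ0 hk hm h l

theorem nonvanishingCase_mul_ne {k₁ k₂ : ℤ} {m : ℝ} {φ : ℝ → ℂ}
    (h : NonvanishingCase k₁ k₂ m φ) : k₁ * k₂ < -1 ∨ 0 < k₁ * k₂ := by
  rcases h with ⟨h, -⟩ | ⟨h, -⟩ | ⟨h, -⟩ | ⟨h, -⟩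
  exacts [Or.inl h, Or.inl h, Or.inr h, Or.inr h]

end HarmonicToeplitz

namespace HarmonicToeplitz

open Filter Topology Set

/-! ### Integrals over the disk -/

theorem integral_diskMeasure (f : ℂ → ℂ) :
    ∫ z, f z ∂diskMeasure = (Real.pi : ℂ)⁻¹ * ∫ z in Metric.ball (0 : ℂ) 1, f z := by
  rw [diskMeasure, integral_smul_measure, Complex.volume_ball]
  simp [Complex.real_smul]

theorem integrable_diskMeasure_iff {E : Type*} [NormedAddCommGroup E] (f : ℂ → E) :
    Integrable f diskMeasure ↔ IntegrableOn f (Metric.ball (0 : ℂ) 1) := by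
  rw [diskMeasure, integrable_smul_measure, IntegrableOn]
  · exact ENNReal.inv_ne_zero.mpr measure_ball_lt_top.ne
  · simpa using (Metric.measure_ball_pos (volume : Measure ℂ) 0 one_pos).ne'

theorem integrable_radial_iff (φ : ℝ → ℂ) :
    Integrable (fun z : ℂ => φ ‖z‖) diskMeasure ↔ RadialIntegrable φ := by
  rw [integrable_diskMeasure_iff, integrableOn_fun_norm_addHaar, Complex.finrank_real_complex,
    RadialIntegrable]
  simp [Complex.real_smul]

theorem integral_radial (φ : ℝ → ℂ) :
    ∫ z : ℂ, φ ‖z‖ ∂diskMeasure = 2 * mellinTransform φ 2 := by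
  have h1 : ∀ z : ℂ, (Metric.ball (0 : ℂ) 1).indicator (fun z => φ ‖z‖) z =
      ((Iio (1 : ℝ)).indicator φ) ‖z‖ := by
    intro z
    by_cases hz : ‖z‖ < 1 <;> simp [indicator, hz]
  rw [integral_diskMeasure, ← integral_indicator measurableSet_ball, integral_congr_ae
    (ae_of_all _ h1), integral_fun_norm_addHaar volume ((Iio (1 : ℝ)).indicator φ),
    Complex.finrank_real_complex, mellinTransform_eq_setIntegral]
  have h2 : ∀ r : ℝ, r ^ (2 - 1) • (Iio (1 : ℝ)).indicator φ r =
      (Iio (1 : ℝ)).indicator (fun r => (r : ℂ) * φ r * (r : ℂ) ^ ((2 : ℂ) - 2)) r := by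
    intro r
    by_cases hr : r < 1 <;> simp [indicator, hr, Complex.real_smul]
  simp only [h2]
  rw [setIntegral_indicator measurableSet_Iio, Ioi_inter_Iio, Measure.real, Complex.volume_ball]
  have : (Real.pi : ℂ) ≠ 0 := by exact_mod_cast Real.pi_ne_zero
  simp [Complex.real_smul]
  field_simp

theorem quasihomogeneous_mul (k l : ℤ) (φ ψ : ℝ → ℂ) (z : ℂ) :
    quasihomogeneous k φ z * quasihomogeneous l ψ z =
      quasihomogeneous (k + l) (fun r => φ r * ψ r) z := by
  unfold quasihomogeneous
  rw [show Complex.I * ((k + l : ℤ) : ℂ) * Complex.arg z =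
    Complex.I * k * Complex.arg z + Complex.I * l * Complex.arg z by push_cast; ring,
    Complex.exp_add]
  ring

theorem quasihomogeneous_zero (φ : ℝ → ℂ) (z : ℂ) : quasihomogeneous 0 φ z = φ ‖z‖ := by
  simp [quasihomogeneous]

theorem norm_exp_I_mul_int_mul_arg (k : ℤ) (z : ℂ) :
    ‖Complex.exp (Complex.I * k * Complex.arg z)‖ = 1 := by
  rw [show Complex.I * (k : ℂ) * Complex.arg z = ((k * Complex.arg z : ℝ) : ℂ) * Complex.I by
    push_cast; ring, Complex.norm_exp_ofReal_mul_I]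

theorem measurable_exp_I_mul_int_mul_arg (k : ℤ) :
    Measurable fun z : ℂ => Complex.exp (Complex.I * k * Complex.arg z) :=
  Complex.measurable_exp.comp (measurable_const.mul (Complex.measurable_ofReal.comp
    Complex.measurable_arg))

theorem integrable_quasihomogeneous {φ : ℝ → ℂ} (hφ : RadialIntegrable φ) (k : ℤ) :
    Integrable (quasihomogeneous k φ) diskMeasure :=
  Integrable.bdd_mul (c := 1) ((integrable_radial_iff φ).mpr hφ)
    (measurable_exp_I_mul_int_mul_arg k).aestronglyMeasurable
    (ae_of_all _ fun z => (norm_exp_I_mul_int_mul_arg k z).le)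

theorem quasihomogeneous_eq_zpow (k : ℤ) (φ : ℝ → ℂ) {z : ℂ} (hz : z ≠ 0) :
    quasihomogeneous k φ z = (z / ‖z‖) ^ k * φ ‖z‖ := by
  unfold quasihomogeneous
  have h : z / ‖z‖ = Complex.exp (Complex.arg z * Complex.I) := by
    have h0 : (‖z‖ : ℂ) ≠ 0 := by exact_mod_cast norm_ne_zero_iff.mpr hz
    rw [div_eq_iff h0]
    conv_lhs => rw [← Complex.norm_mul_exp_arg_mul_I z]
    ring
  rw [h, ← Complex.exp_int_mul]
  congr 2
  ring

theorem quasihomogeneous_circle_mul (k : ℤ) (φ : ℝ → ℂ) (c : Circle) {z : ℂ} (hz : z ≠ 0) :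
    quasihomogeneous k φ (c * z) = (c : ℂ) ^ k * quasihomogeneous k φ z := by
  have hc : (c : ℂ) ≠ 0 := Circle.coe_ne_zero c
  rw [quasihomogeneous_eq_zpow k φ hz, quasihomogeneous_eq_zpow k φ (mul_ne_zero hc hz), norm_mul,
    Circle.norm_coe, one_mul, mul_div_assoc, mul_zpow, mul_assoc]

theorem integral_diskMeasure_circle_mul (c : Circle) (f : ℂ → ℂ) :
    ∫ z, f (c * z) ∂diskMeasure = ∫ z, f z ∂diskMeasure := by
  rw [integral_diskMeasure, integral_diskMeasure, ← integral_indicator measurableSet_ball,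
    ← integral_indicator measurableSet_ball]
  congr 1
  have := (rotation c).measurePreserving.integral_comp
    (rotation c).toHomeomorph.measurableEmbedding ((Metric.ball (0 : ℂ) 1).indicator f)
  rw [← this]
  congr 1
  ext z
  have hn : ‖(c : ℂ) * z‖ = ‖z‖ := by rw [norm_mul, Circle.norm_coe, one_mul]
  rw [rotation_apply]
  simp only [indicator, mem_ball_zero_iff, hn]

/-- Rotation by the angle π/k preserves the measure and multiplies the integrand by -1. No
integrability is needed. -/
theorem integral_quasihomogeneous_of_ne_zero {k : ℤ} (hk : k ≠ 0) (φ : ℝ → ℂ) :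
    ∫ z, quasihomogeneous k φ z ∂diskMeasure = 0 := by
  set c : Circle := Circle.exp (Real.pi / k) with hc
  have hck : (c : ℂ) ^ k = -1 := by
    have hk' : (k : ℂ) ≠ 0 := by exact_mod_cast hk
    rw [hc, Circle.coe_exp, ← Complex.exp_int_mul, ← Complex.exp_pi_mul_I]
    congr 1
    push_cast
    field_simp
  have h1 := integral_diskMeasure_circle_mul c (quasihomogeneous k φ)
  have h2 : ∫ z, quasihomogeneous k φ (c * z) ∂diskMeasure =
      ∫ z, -quasihomogeneous k φ z ∂diskMeasure := by
    refine integral_congr_ae ?_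
    have hne : ∀ᵐ z ∂diskMeasure, z ≠ (0 : ℂ) := by
      refine Measure.ae_smul_measure (ae_restrict_of_ae ?_) _
      simp [ae_iff]
    filter_upwards [hne] with z hz
    rw [quasihomogeneous_circle_mul k φ c hz, hck, neg_one_mul]
  rw [h2, integral_neg] at h1
  linear_combination -h1 / 2

theorem integral_quasihomogeneous (k : ℤ) (φ : ℝ → ℂ) :
    ∫ z, quasihomogeneous k φ z ∂diskMeasure = if k = 0 then 2 * mellinTransform φ 2 else 0 := by
  split_ifs with h
  · subst h
    rw [← integral_radial]
    simp only [quasihomogeneous_zero]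
  · exact integral_quasihomogeneous_of_ne_zero h φ

theorem mellinTransform_mul_pow (φ : ℝ → ℂ) (n : ℕ) (z : ℂ) :
    mellinTransform (fun r => φ r * (r : ℂ) ^ n) z = mellinTransform φ (z + n) := by
  rw [← mellinTransform_cpow_mul φ n z]
  congr 1
  ext r
  rw [Complex.cpow_natCast, mul_comm]

theorem RadialIntegrable.mul_pow {φ : ℝ → ℂ} (hφ : RadialIntegrable φ) (n : ℕ) :
    RadialIntegrable fun r => φ r * (r : ℂ) ^ n := by
  have := hφ.cpow_mul (w := n) (by simp)
  convert this using 2 with r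
  rw [Complex.cpow_natCast, mul_comm]

/-! ### The harmonic monomials and the projection -/

theorem norm_harmonicMonomialFun (l : ℤ) (z : ℂ) :
    ‖harmonicMonomialFun l z‖ = ‖z‖ ^ l.natAbs := by
  rw [harmonicMonomialFun, quasihomogeneous, norm_mul, norm_exp_I_mul_int_mul_arg, one_mul,
    norm_pow, Complex.norm_real, norm_norm]

theorem continuous_harmonicMonomialFun (l : ℤ) : Continuous (harmonicMonomialFun l) := by
  rw [← continuousOn_univ]
  exact (harmonicOnNhd_harmonicMonomialFun l Set.univ).continuousOn

theorem conj_harmonicMonomialFun (l : ℤ) (z : ℂ) :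
    conj (harmonicMonomialFun l z) = harmonicMonomialFun (-l) z := by
  obtain ⟨n, rfl | rfl⟩ := l.eq_nat_or_neg
  · rw [harmonicMonomialFun_neg_natCast, harmonicMonomialFun_natCast]
  · rw [neg_neg, harmonicMonomialFun_neg_natCast, harmonicMonomialFun_natCast, Complex.conj_conj]

theorem norm_harmonicMonomialFun_le_one (l : ℤ) {z : ℂ} (hz : ‖z‖ ≤ 1) :
    ‖harmonicMonomialFun l z‖ ≤ 1 := by
  rw [norm_harmonicMonomialFun]
  exact pow_le_one₀ (norm_nonneg _) hz

theorem ae_diskMeasure_norm_lt_one : ∀ᵐ z ∂diskMeasure, ‖z‖ < 1 := by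
  filter_upwards [ae_diskMeasure_mem_ball] with z hz using mem_ball_zero_iff.mp hz

theorem integrable_harmonicMonomialFun_mul {f : ℂ → ℂ} (hf : Integrable f diskMeasure) (l : ℤ) :
    Integrable (fun w => harmonicMonomialFun l w * f w) diskMeasure := by
  refine Integrable.bdd_mul (c := 1) hf (continuous_harmonicMonomialFun l).aestronglyMeasurable ?_
  filter_upwards [ae_diskMeasure_norm_lt_one] with z hz
  exact norm_harmonicMonomialFun_le_one l hz.le

theorem hasSum_succ_mul_geometric {x : ℂ} (hx : ‖x‖ < 1) :
    HasSum (fun n : ℕ => ((n : ℂ) + 1) * x ^ n) (1 / (1 - x) ^ 2) := by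
  have := hasSum_choose_mul_geometric_of_norm_lt_one 1 hx
  simpa using this

/-- The two squared geometric series give the indices l ≥ 0 and l ≤ 0; the term -1 compensates for
counting l = 0 twice. -/
theorem hasSum_kernel {z w : ℂ} (hz : ‖z‖ < 1) (hw : ‖w‖ ≤ 1) :
    HasSum (fun l : ℤ => ((l.natAbs : ℂ) + 1) * harmonicMonomialFun l z *
      harmonicMonomialFun (-l) w)
      (1 / (1 - z * conj w) ^ 2 + 1 / (1 - conj z * w) ^ 2 - 1) := by
  have hx : ‖z * conj w‖ < 1 := by
    rw [norm_mul, RCLike.norm_conj]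
    exact mul_lt_one_of_nonneg_of_lt_one_left (norm_nonneg _) hz hw
  have hy : ‖conj z * w‖ < 1 := by
    rw [norm_mul, RCLike.norm_conj]
    exact mul_lt_one_of_nonneg_of_lt_one_left (norm_nonneg _) hz hw
  have h0 : harmonicMonomialFun 0 = fun _ => 1 := funext fun z => by
    simpa using harmonicMonomialFun_natCast 0 z
  set f : ℤ → ℂ := fun l => ((l.natAbs : ℂ) + 1) * harmonicMonomialFun l z *
    harmonicMonomialFun (-l) w with hf
  have h1 : HasSum (fun n : ℕ => f n) (1 / (1 - z * conj w) ^ 2) := by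
    convert hasSum_succ_mul_geometric hx using 2 with n
    simp only [hf]
    rw [harmonicMonomialFun_natCast, harmonicMonomialFun_neg_natCast, mul_pow, map_pow,
      Int.natAbs_natCast]
    ring
  have h2 : HasSum (fun n : ℕ => f (-n)) (1 / (1 - conj z * w) ^ 2) := by
    convert hasSum_succ_mul_geometric hy using 2 with n
    simp only [hf]
    rw [neg_neg, harmonicMonomialFun_natCast, harmonicMonomialFun_neg_natCast, mul_pow, map_pow,
      Int.natAbs_neg, Int.natAbs_natCast]
    ring
  have h3 : f 0 = 1 := by simp [hf, h0]
  have h := h1.of_nat_of_neg h2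
  rwa [h3] at h

theorem summable_succ_mul_pow_natAbs {x : ℝ} (hx0 : 0 ≤ x) (hx : x < 1) :
    Summable fun l : ℤ => ((l.natAbs : ℝ) + 1) * x ^ l.natAbs := by
  have h : Summable fun n : ℕ => ((n : ℝ) + 1) * x ^ n := by
    have := (hasSum_choose_mul_geometric_of_norm_lt_one 1
      (show ‖x‖ < 1 by rwa [Real.norm_of_nonneg hx0])).summable
    simpa using this
  refine Summable.of_nat_of_neg ?_ ?_
  · simpa using h
  · simpa using h

/-- The expansion of `Q f` into harmonic monomials. -/
theorem hasSum_harmonicProjection {f : ℂ → ℂ} (hf : Integrable f diskMeasure) {z : ℂ}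
    (hz : ‖z‖ < 1) :
    HasSum (fun l : ℤ => ((l.natAbs : ℂ) + 1) * harmonicMonomialFun l z *
      ∫ w, harmonicMonomialFun (-l) w * f w ∂diskMeasure) (harmonicProjection f z) := by
  set G : ℤ → ℂ → ℂ := fun l w => ((l.natAbs : ℂ) + 1) * harmonicMonomialFun l z *
    (harmonicMonomialFun (-l) w * f w) with hG
  have hint : ∀ l, Integrable (G l) diskMeasure := fun l =>
    (integrable_harmonicMonomialFun_mul hf (-l)).const_mul _
  have hle : ∀ l, ∫ w, ‖G l w‖ ∂diskMeasure ≤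
      (((l.natAbs : ℝ) + 1) * ‖z‖ ^ l.natAbs) * ∫ w, ‖f w‖ ∂diskMeasure := by
    intro l
    rw [← integral_const_mul]
    refine integral_mono_ae (hint l).norm (hf.norm.const_mul _) ?_
    filter_upwards [ae_diskMeasure_norm_lt_one] with w hw
    simp only [hG, norm_mul]
    rw [norm_harmonicMonomialFun l z, show ‖(l.natAbs : ℂ) + 1‖ = (l.natAbs : ℝ) + 1 by
      rw [show (l.natAbs : ℂ) + 1 = (((l.natAbs : ℝ) + 1 : ℝ) : ℂ) by push_cast; rfl,
        Complex.norm_real, Real.norm_of_nonneg (by positivity)]]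
    refine mul_le_mul_of_nonneg_left ?_ (by positivity)
    exact mul_le_of_le_one_left (norm_nonneg _) (norm_harmonicMonomialFun_le_one _ hw.le)
  have hsum : Summable fun l => ∫ w, ‖G l w‖ ∂diskMeasure :=
    Summable.of_nonneg_of_le (fun l => integral_nonneg fun w => norm_nonneg _) hle
      ((summable_succ_mul_pow_natAbs (norm_nonneg z) hz).mul_right _)
  have h := hasSum_integral_of_summable_integral_norm hint hsum
  have e : ∫ w, ∑' l, G l w ∂diskMeasure = harmonicProjection f z := by
    refine integral_congr_ae ?_
    filter_upwards [ae_diskMeasure_norm_lt_one] with w hw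
    rw [← ((hasSum_kernel hz hw.le).mul_right (f w)).tsum_eq]
    refine tsum_congr fun l => ?_
    simp only [hG]
    ring
  rw [e] at h
  refine h.congr_fun fun l => ?_
  simp only [hG]
  rw [integral_const_mul]

theorem harmonicMonomialFun_mul_quasihomogeneous (l k : ℤ) (φ : ℝ → ℂ) (z : ℂ) :
    quasihomogeneous k φ z * harmonicMonomialFun l z =
      quasihomogeneous (k + l) (fun r => φ r * (r : ℂ) ^ l.natAbs) z :=
  quasihomogeneous_mul _ _ _ _ _

theorem integral_harmonicMonomialFun_mul_quasihomogeneous (l k : ℤ) (φ : ℝ → ℂ) :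
    ∫ w, harmonicMonomialFun (-l) w * quasihomogeneous k φ w ∂diskMeasure =
      if k = l then 2 * mellinTransform φ (l.natAbs + 2) else 0 := by
  have : ∀ w, harmonicMonomialFun (-l) w * quasihomogeneous k φ w =
      quasihomogeneous (k + -l) (fun r => φ r * (r : ℂ) ^ (-l).natAbs) w := fun w => by
    rw [mul_comm]
    exact harmonicMonomialFun_mul_quasihomogeneous _ _ _ _
  simp only [this]
  rw [integral_quasihomogeneous, mellinTransform_mul_pow, Int.natAbs_neg, add_comm (2 : ℂ)]
  simp only [← sub_eq_add_neg, sub_eq_zero]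

theorem harmonicProjection_quasihomogeneous {φ : ℝ → ℂ} (hφ : RadialIntegrable φ) (k : ℤ) {z : ℂ}
    (hz : ‖z‖ < 1) : harmonicProjection (quasihomogeneous k φ) z =
      2 * ((k.natAbs : ℂ) + 1) * mellinTransform φ (k.natAbs + 2) * harmonicMonomialFun k z := by
  have h := hasSum_harmonicProjection (integrable_quasihomogeneous hφ k) hz
  rw [← h.tsum_eq, tsum_eq_single k]
  · rw [integral_harmonicMonomialFun_mul_quasihomogeneous, if_pos rfl]
    ring
  · intro l hl
    rw [integral_harmonicMonomialFun_mul_quasihomogeneous, if_neg hl.symm, mul_zero]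

/-- `Q` applied to the product of a symbol `e^{ikθ} φ` and a harmonic monomial. -/
theorem harmonicProjection_quasihomogeneous_mul {φ : ℝ → ℂ} (hφ : RadialIntegrable φ) (k l : ℤ)
    {z : ℂ} (hz : ‖z‖ < 1) :
    harmonicProjection (fun w => quasihomogeneous k φ w * harmonicMonomialFun l w) z =
      2 * (((|k + l| : ℤ) : ℂ) + 1) * mellinTransform φ ((|l| + |k + l| + 2 : ℤ) : ℂ) *
        harmonicMonomialFun (k + l) z := by
  have : (fun w => quasihomogeneous k φ w * harmonicMonomialFun l w) =
      quasihomogeneous (k + l) (fun r => φ r * (r : ℂ) ^ l.natAbs) :=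
    funext fun w => harmonicMonomialFun_mul_quasihomogeneous l k φ w
  have e : ∀ n : ℤ, ((|n| : ℤ) : ℂ) = n.natAbs := fun n => by
    rw [Int.abs_eq_natAbs, Int.cast_natCast]
  rw [this, harmonicProjection_quasihomogeneous (hφ.mul_pow _) _ hz, mellinTransform_mul_pow]
  push_cast [e]
  congr 3
  ring

end HarmonicToeplitz

namespace HarmonicToeplitz

open Filter Topology Set

/-! ### The projection is harmonic -/

theorem summable_succ_mul_pow {c : ℕ → ℂ} {M : ℝ} (hc : ∀ n, ‖c n‖ ≤ M) {z : ℂ} (hz : ‖z‖ < 1) :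
    Summable fun n : ℕ => ((n : ℂ) + 1) * c n * z ^ n := by
  refine Summable.of_norm_bounded
    (((hasSum_choose_mul_geometric_of_norm_lt_one 1 (r := ‖z‖)
      (by rwa [norm_norm])).summable).mul_left M) fun n => ?_
  rw [norm_mul, norm_mul, norm_pow, show ‖(n : ℂ) + 1‖ = (n : ℝ) + 1 by
      rw [show (n : ℂ) + 1 = (((n : ℝ) + 1 : ℝ) : ℂ) by push_cast; rfl,
        Complex.norm_real, Real.norm_of_nonneg (by positivity)]]
  simp only [Nat.choose_one_right]
  push_cast
  rw [mul_comm ((n : ℝ) + 1) ‖c n‖, mul_assoc]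
  exact mul_le_mul_of_nonneg_right (hc n) (by positivity)

theorem differentiableOn_tsum_succ_mul_pow {c : ℕ → ℂ} {M : ℝ} (hc : ∀ n, ‖c n‖ ≤ M) :
    DifferentiableOn ℂ (fun z => ∑' n : ℕ, ((n : ℂ) + 1) * c n * z ^ n) (Metric.ball 0 1) := by
  intro z hz
  rw [mem_ball_zero_iff] at hz
  obtain ⟨ρ, hzρ, hρ⟩ := exists_between hz
  have hρ0 : 0 ≤ ρ := (norm_nonneg z).trans hzρ.le
  have hρn : ‖(ρ : ℂ)‖ < 1 := by rwa [Complex.norm_real, Real.norm_of_nonneg hρ0]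
  have hs := (summable_succ_mul_pow hc hρn).norm
  have h := Complex.differentiableOn_tsum_of_summable_norm (U := Metric.ball (0 : ℂ) ρ)
    (F := fun (n : ℕ) (z : ℂ) => ((n : ℂ) + 1) * c n * z ^ n) hs (fun n => by fun_prop)
    Metric.isOpen_ball (fun n w hw => by
      rw [mem_ball_zero_iff] at hw
      simp only [norm_mul, norm_pow, Complex.norm_real, Real.norm_of_nonneg hρ0]
      gcongr)
  exact (h.differentiableAt (Metric.isOpen_ball.mem_nhds
    (mem_ball_zero_iff.mpr hzρ))).differentiableWithinAt

theorem harmonicOnNhd_add_conj {A B : ℂ → ℂ} (hA : DifferentiableOn ℂ A (Metric.ball 0 1))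
    (hB : DifferentiableOn ℂ B (Metric.ball 0 1)) :
    InnerProductSpace.HarmonicOnNhd (fun z => A z + conj (B z)) (Metric.ball (0 : ℂ) 1) := by
  have h1 : InnerProductSpace.HarmonicOnNhd A (Metric.ball (0 : ℂ) 1) := fun z hz =>
    (hA.analyticAt (Metric.isOpen_ball.mem_nhds hz)).harmonicAt
  have h2 : InnerProductSpace.HarmonicOnNhd B (Metric.ball (0 : ℂ) 1) := fun z hz =>
    (hB.analyticAt (Metric.isOpen_ball.mem_nhds hz)).harmonicAt
  exact h1.add (h2.comp_CLM Complex.conjCLE.toContinuousLinearMap)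

theorem norm_integral_harmonicMonomialFun_mul_le {f : ℂ → ℂ} (hf : Integrable f diskMeasure)
    (l : ℤ) : ‖∫ w, harmonicMonomialFun l w * f w ∂diskMeasure‖ ≤ ∫ w, ‖f w‖ ∂diskMeasure := by
  refine norm_integral_le_of_norm_le hf.norm ?_
  filter_upwards [ae_diskMeasure_norm_lt_one] with w hw
  rw [norm_mul]
  exact mul_le_of_le_one_left (norm_nonneg _) (norm_harmonicMonomialFun_le_one _ hw.le)

/-- Nonnegative indices of the expansion sum to a holomorphic function, nonpositive ones to the
conjugate of one. The subtracted c 0 is the common term of index 0. -/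
theorem exists_harmonicOnNhd_eqOn_harmonicProjection {f : ℂ → ℂ} (hf : Integrable f diskMeasure) :
    ∃ g : ℂ → ℂ, InnerProductSpace.HarmonicOnNhd g (Metric.ball (0 : ℂ) 1) ∧
      EqOn (harmonicProjection f) g (Metric.ball 0 1) := by
  set c : ℕ → ℂ := fun n => ∫ w, harmonicMonomialFun (-n) w * f w ∂diskMeasure with hc
  set d : ℕ → ℂ := fun n => conj (∫ w, harmonicMonomialFun n w * f w ∂diskMeasure) with hd
  have hcb : ∀ n, ‖c n‖ ≤ ∫ w, ‖f w‖ ∂diskMeasure := fun n =>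
    norm_integral_harmonicMonomialFun_mul_le hf _
  have hdb : ∀ n, ‖d n‖ ≤ ∫ w, ‖f w‖ ∂diskMeasure := fun n => by
    rw [hd, RCLike.norm_conj]
    exact norm_integral_harmonicMonomialFun_mul_le hf _
  refine ⟨fun z => ((∑' n : ℕ, ((n : ℂ) + 1) * c n * z ^ n) - c 0) +
    conj (∑' n : ℕ, ((n : ℂ) + 1) * d n * z ^ n), harmonicOnNhd_add_conj
      ((differentiableOn_tsum_succ_mul_pow hcb).sub_const _)
      (differentiableOn_tsum_succ_mul_pow hdb), fun z hz => ?_⟩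
  rw [mem_ball_zero_iff] at hz
  have h := hasSum_harmonicProjection hf hz
  set F : ℤ → ℂ := fun l => ((l.natAbs : ℂ) + 1) * harmonicMonomialFun l z *
    ∫ w, harmonicMonomialFun (-l) w * f w ∂diskMeasure with hF
  have h1 : HasSum (fun n : ℕ => F n) (∑' n : ℕ, ((n : ℂ) + 1) * c n * z ^ n) := by
    convert (summable_succ_mul_pow hcb hz).hasSum using 2 with n
    simp only [hF, hc]
    rw [harmonicMonomialFun_natCast, Int.natAbs_natCast]
    ring
  have h2 : HasSum (fun n : ℕ => F (-n)) (conj (∑' n : ℕ, ((n : ℂ) + 1) * d n * z ^ n)) := by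
    convert (Complex.hasSum_conj'.mpr (summable_succ_mul_pow hdb hz).hasSum) using 2 with n
    simp only [hF, hd]
    rw [harmonicMonomialFun_neg_natCast, Int.natAbs_neg, Int.natAbs_natCast, neg_neg]
    simp only [map_mul, map_add, map_one, map_natCast, map_pow, Complex.conj_conj]
    ring
  have h3 : F 0 = c 0 := by
    have h0 : harmonicMonomialFun 0 = fun _ => 1 := funext fun z => by
      simpa using harmonicMonomialFun_natCast 0 z
    simp [hF, hc, h0]
  have h4 := h1.of_nat_of_neg h2
  rw [h3] at h4
  rw [h.unique h4]
  ring

/-! ### Completeness of the harmonic monomials -/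

/-- On the disk of radius ρ < 1 the Taylor series converges absolutely and uniformly, so it can be
integrated termwise, and orthogonality isolates one coefficient. A itself need not be integrable on
the unit disk, hence the cutoff. -/
theorem integral_harmonicMonomialFun_mul_cutoff {A : ℂ → ℂ}
    (hA : DifferentiableOn ℂ A (Metric.ball 0 1)) {ρ : ℝ} (hρ0 : 0 < ρ) (hρ : ρ < 1) (l : ℤ) :
    ∫ w, harmonicMonomialFun (-l) w * (Metric.ball (0 : ℂ) ρ).indicator A w ∂diskMeasure =
      if 0 ≤ l then (l.toNat.factorial : ℂ)⁻¹ * iteratedDeriv l.toNat A 0 *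
        (ρ ^ (2 * l.natAbs + 2) / (l.natAbs + 1)) else 0 := by
  set a : ℕ → ℂ := fun n => (n.factorial : ℂ)⁻¹ * iteratedDeriv n A 0 with ha
  have hsum : ∀ z : ℂ, ‖z‖ < 1 → HasSum (fun n => a n * z ^ n) (A z) := by
    intro z hz
    have hA' : DifferentiableOn ℂ A (Metric.ball 0 ((1 : ℝ))) := hA
    have := Complex.hasSum_taylorSeries_on_ball hA' (mem_ball_zero_iff.mpr hz)
    refine this.congr_fun fun n => ?_
    simp only [ha, smul_eq_mul, sub_zero]
    ring
  set χ : ℝ → ℂ := (Iio ρ).indicator 1 with hχ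
  have hχz : ∀ (B : ℂ → ℂ) (w : ℂ), (Metric.ball (0 : ℂ) ρ).indicator B w = χ ‖w‖ * B w := by
    intro B w
    by_cases hw : ‖w‖ < ρ <;> simp [hχ, indicator, hw]
  have hχi : RadialIntegrable χ := by
    have h1 : RadialIntegrable fun _ => 1 := by
      simpa using radialIntegrable_const_mul_cpow 1 (s := 0) (by simp)
    refine (Integrable.indicator h1 (measurableSet_Iio (a := ρ))).congr (ae_of_all _ fun r => ?_)
    by_cases hr : r < ρ <;> simp [hχ, indicator, hr]
  have hχq : ∀ w : ℂ, χ ‖w‖ = quasihomogeneous 0 χ w := fun w =>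
    (quasihomogeneous_zero χ w).symm
  set G : ℕ → ℂ → ℂ := fun n w => harmonicMonomialFun (-l) w * (χ ‖w‖ * (a n * w ^ n)) with hG
  have hGq : ∀ n w, G n w = a n * (harmonicMonomialFun (-l) w *
      quasihomogeneous n (fun r => χ r * (r : ℂ) ^ n) w) := by
    intro n w
    simp only [hG]
    rw [hχq, ← harmonicMonomialFun_natCast, show χ = χ from rfl]
    have := harmonicMonomialFun_mul_quasihomogeneous n 0 χ w
    rw [zero_add, Int.natAbs_natCast] at this
    rw [← this]
    ring
  have hGint : ∀ n, Integrable (G n) diskMeasure := by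
    intro n
    rw [funext (hGq n)]
    exact (integrable_harmonicMonomialFun_mul
      (integrable_quasihomogeneous (hχi.mul_pow n) n) _).const_mul _
  have hGle : ∀ n, ∀ᵐ w ∂diskMeasure, ‖G n w‖ ≤ ‖a n * (ρ : ℂ) ^ n‖ := by
    intro n
    filter_upwards [ae_diskMeasure_norm_lt_one] with w hw
    simp only [hG]
    rw [norm_mul]
    refine (mul_le_of_le_one_left (norm_nonneg _)
      (norm_harmonicMonomialFun_le_one _ hw.le)).trans ?_
    by_cases hwρ : ‖w‖ < ρ
    · simp only [hχ, indicator, mem_Iio, hwρ, if_true, Pi.one_apply, one_mul, norm_mul, norm_pow,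
        Complex.norm_real, Real.norm_of_nonneg hρ0.le]
      gcongr
    · simp only [hχ, indicator, mem_Iio, hwρ, if_false, zero_mul, norm_zero]
      exact norm_nonneg _
  have hρs : Summable fun n => ‖a n * (ρ : ℂ) ^ n‖ :=
    (hsum ρ (by rwa [Complex.norm_real, Real.norm_of_nonneg hρ0.le])).summable.norm
  have hGsum : Summable fun n => ∫ w, ‖G n w‖ ∂diskMeasure := by
    refine Summable.of_nonneg_of_le (fun n => integral_nonneg fun w => norm_nonneg _) (fun n => ?_)
      (hρs.mul_right (diskMeasure.real univ))
    have := integral_mono_ae (hGint n).norm (integrable_const _) (hGle n)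
    rwa [integral_const, smul_eq_mul, mul_comm] at this
  have h := hasSum_integral_of_summable_integral_norm hGint hGsum
  have e : ∫ w, ∑' n, G n w ∂diskMeasure =
      ∫ w, harmonicMonomialFun (-l) w * (Metric.ball (0 : ℂ) ρ).indicator A w ∂diskMeasure := by
    refine integral_congr_ae ?_
    filter_upwards [ae_diskMeasure_norm_lt_one] with w hw
    rw [hχz, ← (((hsum w hw).mul_left (χ ‖w‖)).mul_left (harmonicMonomialFun (-l) w)).tsum_eq]
  rw [← e, ← h.tsum_eq]
  have hterm : ∀ n : ℕ, ∫ w, G n w ∂diskMeasure =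
      if (n : ℤ) = l then a n * (2 * mellinTransform χ (2 * n + 2)) else 0 := by
    intro n
    simp only [hGq]
    rw [integral_const_mul, integral_harmonicMonomialFun_mul_quasihomogeneous,
      mellinTransform_mul_pow]
    split_ifs with hn
    · subst hn
      rw [Int.natAbs_natCast]
      congr 3
      ring
    · rw [mul_zero]
  simp only [hterm]
  split_ifs with hl
  · obtain ⟨n, rfl⟩ := Int.eq_ofNat_of_zero_le hl
    rw [tsum_eq_single n fun j hj => if_neg (by exact_mod_cast hj), if_pos rfl]
    rw [Int.toNat_natCast, Int.natAbs_natCast]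
    congr 1
    rw [mellinTransform_eq_setIntegral]
    have h1 : ∀ r ∈ Ioo (0 : ℝ) 1, (r : ℂ) * χ r * (r : ℂ) ^ ((2 * n + 2 : ℂ) - 2) =
        (Ioo 0 ρ).indicator (fun r : ℝ => (r : ℂ) ^ (2 * n + 1)) r := by
      intro r hr
      rw [add_sub_cancel_right, show (2 * n : ℂ) = ((2 * n : ℕ) : ℂ) by push_cast; rfl,
        Complex.cpow_natCast]
      by_cases hrρ : r < ρ
      · simp [hχ, indicator, hrρ, hr.1]
        ring
      · simp [hχ, indicator, hrρ]
    rw [setIntegral_congr_fun measurableSet_Ioo h1, setIntegral_indicator measurableSet_Ioo,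
      inter_eq_right.mpr (Ioo_subset_Ioo_right hρ.le), ← integral_Ioc_eq_integral_Ioo,
      ← intervalIntegral.integral_of_le hρ0.le]
    have h2 : ∫ r in (0 : ℝ)..ρ, (r : ℂ) ^ (2 * n + 1) =
        ((∫ r in (0 : ℝ)..ρ, r ^ (2 * n + 1) : ℝ) : ℂ) := by
      rw [← intervalIntegral.integral_ofReal]
      push_cast
      rfl
    rw [h2, integral_pow]
    have h3 : (n : ℂ) + 1 ≠ 0 := by exact_mod_cast Nat.succ_ne_zero n
    push_cast
    rw [show (2 * n + 1 + 1 : ℂ) = 2 * (n + 1) by ring]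
    field_simp
    simp
  · refine (tsum_congr fun n => if_neg ?_).trans tsum_zero
    omega

/-- The real and imaginary parts of g are real parts of holomorphic F₁ and F₂, and the halves of F₁
± iF₂ recombine to g. -/
theorem exists_holomorphic_decomposition {g : ℂ → ℂ}
    (hg : InnerProductSpace.HarmonicOnNhd g (Metric.ball (0 : ℂ) 1)) :
    ∃ A B : ℂ → ℂ, DifferentiableOn ℂ A (Metric.ball 0 1) ∧
      DifferentiableOn ℂ B (Metric.ball 0 1) ∧
      ∀ z ∈ Metric.ball (0 : ℂ) 1, g z = A z + conj (B z) := by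
  obtain ⟨F₁, h₁, e₁⟩ := (hg.comp_CLM Complex.reCLM).exists_analyticOnNhd_ball_re_eq
  obtain ⟨F₂, h₂, e₂⟩ := (hg.comp_CLM Complex.imCLM).exists_analyticOnNhd_ball_re_eq
  refine ⟨fun z => (F₁ z + Complex.I * F₂ z) / 2, fun z => (F₁ z - Complex.I * F₂ z) / 2, ?_, ?_,
    fun z hz => ?_⟩
  · exact (h₁.differentiableOn.add (h₂.differentiableOn.const_mul _)).div_const _
  · exact (h₁.differentiableOn.sub (h₂.differentiableOn.const_mul _)).div_const _
  · have r1 : (F₁ z).re = (g z).re := e₁ hz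
    have r2 : (F₂ z).re = (g z).im := e₂ hz
    apply Complex.ext
    · simp [r1, r2, Complex.div_re, Complex.normSq_apply]
      ring
    · simp [r1, r2, Complex.div_im, Complex.normSq_apply]
      ring

theorem eqOn_zero_of_iteratedDeriv_eq_zero {A : ℂ → ℂ}
    (hA : DifferentiableOn ℂ A (Metric.ball 0 1)) (h : ∀ n : ℕ, 1 ≤ n → iteratedDeriv n A 0 = 0)
    {z : ℂ} (hz : z ∈ Metric.ball (0 : ℂ) 1) : A z = A 0 := by
  have hA' : DifferentiableOn ℂ A (Metric.ball 0 ((1 : ℝ))) := hA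
  have hs := Complex.hasSum_taylorSeries_on_ball hA' hz
  rw [← hs.tsum_eq, tsum_eq_single 0]
  · simp
  · intro n hn
    rw [h n (Nat.one_le_iff_ne_zero.mpr hn), smul_zero, smul_zero]

/-- A harmonic function which is orthogonal to all harmonic monomials vanishes. -/
theorem harmonic_eq_zero_of_forall_integral_eq_zero {g : ℂ → ℂ}
    (hg : InnerProductSpace.HarmonicOnNhd g (Metric.ball (0 : ℂ) 1))
    (hgi : Integrable g diskMeasure)
    (h : ∀ l : ℤ, ∫ w, harmonicMonomialFun (-l) w * g w ∂diskMeasure = 0) :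
    ∀ z ∈ Metric.ball (0 : ℂ) 1, g z = 0 := by
  obtain ⟨A, B, hA, hB, hAB⟩ := exists_holomorphic_decomposition hg
  set α : ℤ → ℂ := fun l =>
    (if 0 ≤ l then (l.toNat.factorial : ℂ)⁻¹ * iteratedDeriv l.toNat A 0 else 0) +
    (if 0 ≤ -l then conj (((-l).toNat.factorial : ℂ)⁻¹ * iteratedDeriv (-l).toNat B 0) else 0)
    with hα
  have hcut : ∀ (l : ℤ) (ρ : ℝ), 0 < ρ → ρ < 1 →
      ∫ w, harmonicMonomialFun (-l) w * (Metric.ball (0 : ℂ) ρ).indicator g w ∂diskMeasure =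
        α l * (ρ ^ (2 * l.natAbs + 2) / (l.natAbs + 1)) := by
    intro l ρ hρ0 hρ
    have hball : Metric.ball (0 : ℂ) ρ ⊆ Metric.ball 0 1 := Metric.ball_subset_ball hρ.le
    have hbd : ∀ {D : ℂ → ℂ}, DifferentiableOn ℂ D (Metric.ball 0 1) →
        Integrable ((Metric.ball (0 : ℂ) ρ).indicator D) diskMeasure := by
      intro D hD
      have hcb : Metric.closedBall (0 : ℂ) ρ ⊆ Metric.ball 0 1 :=
        Metric.closedBall_subset_ball hρ
      have hcont : ContinuousOn D (Metric.closedBall 0 ρ) := hD.continuousOn.mono hcb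
      have h1 : IntegrableOn D (Metric.closedBall 0 ρ) volume :=
        hcont.integrableOn_compact (isCompact_closedBall 0 ρ)
      rw [integrable_diskMeasure_iff]
      exact ((h1.mono_set Metric.ball_subset_closedBall).integrable_indicator
        measurableSet_ball).integrableOn
    have hBc := integral_harmonicMonomialFun_mul_cutoff hB hρ0 hρ (-l)
    have hBc' := congrArg conj hBc
    rw [← integral_conj] at hBc'
    have e : ∀ w, harmonicMonomialFun (-l) w * (Metric.ball (0 : ℂ) ρ).indicator g w =
        harmonicMonomialFun (-l) w * (Metric.ball (0 : ℂ) ρ).indicator A w +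
        conj (harmonicMonomialFun (- -l) w * (Metric.ball (0 : ℂ) ρ).indicator B w) := by
      intro w
      rw [map_mul, conj_harmonicMonomialFun, neg_neg]
      by_cases hw : w ∈ Metric.ball (0 : ℂ) ρ
      · simp only [indicator_of_mem hw, hAB w (hball hw)]
        ring
      · simp [indicator_of_notMem hw]
    rw [integral_congr_ae (ae_of_all _ e), integral_add
      (integrable_harmonicMonomialFun_mul (hbd hA) _), hBc',
      integral_harmonicMonomialFun_mul_cutoff hA hρ0 hρ]
    · simp only [hα, Int.natAbs_neg]
      rw [add_mul]
      congr 1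
      · split_ifs <;> simp
      · split_ifs <;> simp
    · exact (LinearIsometryEquiv.integrable_comp_iff Complex.conjLIE).mpr
        (integrable_harmonicMonomialFun_mul (hbd hB) (- -l))
  -- The moments over the disks of radius ρ converge to the vanishing moment over the unit disk as ρ
  -- → 1, while by the cutoff formula they are α l times a quantity with nonzero limit.
  have hα0 : ∀ l, α l = 0 := by
    intro l
    set ρ : ℕ → ℝ := fun n => 1 - 1 / ((n : ℝ) + 2) with hρ
    have hρ0 : ∀ n, 0 < ρ n := fun n => by
      have : 1 / ((n : ℝ) + 2) < 1 := by
        rw [div_lt_one (by positivity)]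
        linarith [(Nat.cast_nonneg n : (0 : ℝ) ≤ n)]
      simp only [hρ]
      linarith
    have hρ1 : ∀ n, ρ n < 1 := fun n => by
      have : 0 < 1 / ((n : ℝ) + 2) := by positivity
      simp only [hρ]
      linarith
    have hρt : Tendsto ρ atTop (𝓝 1) := by
      have h1 : Tendsto (fun n : ℕ => 1 / ((n : ℝ) + 2)) atTop (𝓝 0) := by
        refine tendsto_const_nhds.div_atTop ?_
        exact tendsto_atTop_add_const_right _ _ tendsto_natCast_atTop_atTop
      have h2 := h1.const_sub 1
      rwa [sub_zero] at h2
    have hlim1 : Tendsto (fun n => ∫ w, harmonicMonomialFun (-l) w *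
        (Metric.ball (0 : ℂ) (ρ n)).indicator g w ∂diskMeasure) atTop
        (𝓝 (∫ w, harmonicMonomialFun (-l) w * g w ∂diskMeasure)) := by
      refine tendsto_integral_of_dominated_convergence (fun w => ‖g w‖) (fun n => ?_) hgi.norm
        (fun n => ?_) ?_
      · exact (integrable_harmonicMonomialFun_mul
          (hgi.indicator measurableSet_ball) _).aestronglyMeasurable
      · filter_upwards [ae_diskMeasure_norm_lt_one] with w hw
        rw [norm_mul]
        exact (mul_le_of_le_one_left (norm_nonneg _)
          (norm_harmonicMonomialFun_le_one _ hw.le)).trans (norm_indicator_le_norm_self _ _)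
      · filter_upwards [ae_diskMeasure_norm_lt_one] with w hw
        refine tendsto_const_nhds.congr' ?_
        filter_upwards [hρt.eventually (lt_mem_nhds hw)] with n hn
        rw [indicator_of_mem (mem_ball_zero_iff.mpr hn)]
    rw [h l] at hlim1
    have hlim2 : Tendsto (fun n => α l * ((ρ n : ℂ) ^ (2 * l.natAbs + 2) / (l.natAbs + 1))) atTop
        (𝓝 (α l * (((1 : ℝ) : ℂ) ^ (2 * l.natAbs + 2) / (l.natAbs + 1)))) :=
      (((((Complex.continuous_ofReal.tendsto _).comp hρt).pow _).div_const _).const_mul _)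
    have := tendsto_nhds_unique hlim1 (hlim2.congr fun n => (hcut l _ (hρ0 n) (hρ1 n)).symm)
    have hn : ((l.natAbs : ℂ) + 1) ≠ 0 := by exact_mod_cast Nat.succ_ne_zero l.natAbs
    rw [Complex.ofReal_one, one_pow] at this
    exact (mul_eq_zero.mp this.symm).resolve_right (one_div_ne_zero hn)
  have hAn : ∀ n : ℕ, 1 ≤ n → iteratedDeriv n A 0 = 0 := by
    intro n hn
    have := hα0 n
    simp only [hα] at this
    rw [if_pos (by omega), if_neg (by omega), add_zero, Int.toNat_natCast] at this
    exact (mul_eq_zero.mp this).resolve_left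
      (inv_ne_zero (by exact_mod_cast Nat.factorial_ne_zero n))
  have hBn : ∀ n : ℕ, 1 ≤ n → iteratedDeriv n B 0 = 0 := by
    intro n hn
    have := hα0 (-n)
    simp only [hα] at this
    rw [if_neg (by omega), if_pos (by omega), zero_add, neg_neg, Int.toNat_natCast] at this
    exact (mul_eq_zero.mp ((map_eq_zero _).mp this)).resolve_left
      (inv_ne_zero (by exact_mod_cast Nat.factorial_ne_zero n))
  intro z hz
  rw [hAB z hz, eqOn_zero_of_iteratedDeriv_eq_zero hA hAn hz,
    eqOn_zero_of_iteratedDeriv_eq_zero hB hBn hz]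
  have := hα0 0
  simpa [hα] using this

end HarmonicToeplitz

namespace HarmonicToeplitz

open Filter Topology Set

/-! ### The harmonic Bergman space as a Hilbert space -/

theorem radialIntegrable_pow (n : ℕ) : RadialIntegrable fun r => (r : ℂ) ^ n := by
  have := radialIntegrable_const_mul_cpow 1 (s := n) (by
    rw [Complex.natCast_re]
    linarith [(Nat.cast_nonneg n : (0 : ℝ) ≤ n)])
  simpa using this

theorem mellinTransform_pow (n : ℕ) {z : ℂ} (hz : 0 < z.re) :
    mellinTransform (fun r => (r : ℂ) ^ n) z = 1 / (z + n) := by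
  have := mellinTransform_const_mul_cpow 1 n (z := z) (by
    rw [Complex.add_re, Complex.natCast_re]
    positivity)
  simpa using this

theorem integrable_coe_Lp (f : Lp ℂ 2 diskMeasure) : Integrable (f : ℂ → ℂ) diskMeasure :=
  (Lp.memLp f).integrable one_le_two

theorem harmonicProjection_congr {f g : ℂ → ℂ} (h : f =ᵐ[diskMeasure] g) :
    harmonicProjection f = harmonicProjection g :=
  funext fun _ => integral_congr_ae (h.mono fun w hw => by simp only [hw])

theorem coeFn_harmonicMonomial (l : ℤ) :
    ((harmonicMonomial l : Lp ℂ 2 diskMeasure) : ℂ → ℂ) =ᵐ[diskMeasure] harmonicMonomialFun l :=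
  (memLp_harmonicMonomialFun l).coeFn_toLp

/-- The point evaluations of `Q f` are given by inner products. -/
theorem exists_harmonicProjection_eq_inner : ∃ k : ℂ → Lp ℂ 2 diskMeasure,
    ∀ z : ℂ, ‖z‖ < 1 → ∀ f : Lp ℂ 2 diskMeasure, harmonicProjection f z = inner ℂ (k z) f := by
  have key : ∀ z : ℂ, ∃ k : Lp ℂ 2 diskMeasure, ‖z‖ < 1 → ∀ f : Lp ℂ 2 diskMeasure,
      harmonicProjection f z = inner ℂ k f := by
    intro z
    by_cases hz : ‖z‖ < 1
    swap
    · exact ⟨0, fun h => absurd h hz⟩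
    -- For fixed z in the disk the kernel is bounded in w, by the absolutely summable majorant of
    -- its expansion, so it represents a functional on L².
    have hm : MemLp (fun w => conj (1 / (1 - z * conj w) ^ 2 + 1 / (1 - conj z * w) ^ 2 - 1)) 2
        diskMeasure := by
      refine MemLp.of_bound (C := ∑' l : ℤ, ((l.natAbs : ℝ) + 1) * ‖z‖ ^ l.natAbs) ?_ ?_
      · refine Measurable.aestronglyMeasurable ?_
        fun_prop
      · filter_upwards [ae_diskMeasure_norm_lt_one] with w hw
        rw [RCLike.norm_conj]
        refine (hasSum_kernel hz hw.le).norm_le_of_bounded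
          (summable_succ_mul_pow_natAbs (norm_nonneg z) hz).hasSum fun l => ?_
        rw [norm_mul, norm_mul, norm_harmonicMonomialFun l z,
          show ‖(l.natAbs : ℂ) + 1‖ = (l.natAbs : ℝ) + 1 by
            rw [show (l.natAbs : ℂ) + 1 = (((l.natAbs : ℝ) + 1 : ℝ) : ℂ) by push_cast; rfl,
              Complex.norm_real, Real.norm_of_nonneg (by positivity)]]
        exact mul_le_of_le_one_right (by positivity) (norm_harmonicMonomialFun_le_one _ hw.le)
    refine ⟨hm.toLp _, fun _ f => ?_⟩
    rw [L2.inner_def]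
    refine integral_congr_ae ?_
    filter_upwards [hm.coeFn_toLp] with w hw
    rw [hw, RCLike.inner_apply, Complex.conj_conj, mul_comm]
  choose k hk using key
  exact ⟨k, hk⟩

theorem harmonicProjection_harmonicMonomialFun (l : ℤ) {z : ℂ} (hz : ‖z‖ < 1) :
    harmonicProjection (harmonicMonomialFun l) z = harmonicMonomialFun l z := by
  rw [harmonicMonomialFun, harmonicProjection_quasihomogeneous (radialIntegrable_pow _) _ hz,
    mellinTransform_pow _ (by
      rw [Complex.add_re, Complex.natCast_re, Complex.re_ofNat]
      positivity), harmonicMonomialFun]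
  have h : (l.natAbs : ℂ) + 1 ≠ 0 := by exact_mod_cast Nat.succ_ne_zero l.natAbs
  rw [show (l.natAbs : ℂ) + 2 + l.natAbs = 2 * (l.natAbs + 1) by ring,
    mul_one_div_cancel (mul_ne_zero two_ne_zero h), one_mul]

theorem inner_harmonicMonomial_coe (l : ℤ) (f : Lp ℂ 2 diskMeasure) :
    inner ℂ (harmonicMonomial l : Lp ℂ 2 diskMeasure) f =
      ∫ w, harmonicMonomialFun (-l) w * f w ∂diskMeasure := by
  rw [L2.inner_def]
  refine integral_congr_ae ?_
  filter_upwards [coeFn_harmonicMonomial l] with w hw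
  rw [hw, RCLike.inner_apply, conj_harmonicMonomialFun, mul_comm]

theorem inner_harmonicMonomial (l k : ℤ) :
    inner ℂ (harmonicMonomial l) (harmonicMonomial k) =
      if k = l then (1 / ((l.natAbs : ℂ) + 1)) else 0 := by
  rw [Submodule.coe_inner, inner_harmonicMonomial_coe]
  have : ∫ w, harmonicMonomialFun (-l) w * (harmonicMonomial k : Lp ℂ 2 diskMeasure) w
      ∂diskMeasure = ∫ w, harmonicMonomialFun (-l) w * quasihomogeneous k
        (fun r => (r : ℂ) ^ k.natAbs) w ∂diskMeasure := by
    refine integral_congr_ae ?_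
    filter_upwards [coeFn_harmonicMonomial k] with w hw
    rw [hw, harmonicMonomialFun, harmonicMonomialFun]
  rw [this, integral_harmonicMonomialFun_mul_quasihomogeneous]
  split_ifs with h
  · subst h
    rw [mellinTransform_pow _ (by
      rw [Complex.add_re, Complex.natCast_re, Complex.re_ofNat]
      positivity)]
    have h : (k.natAbs : ℂ) + 1 ≠ 0 := by exact_mod_cast Nat.succ_ne_zero k.natAbs
    rw [show (k.natAbs : ℂ) + 2 + k.natAbs = 2 * (k.natAbs + 1) by ring]
    field_simp
  · rfl

theorem eq_zero_of_forall_inner_harmonicMonomial {f : harmonicBergman}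
    (h : ∀ l, inner ℂ (harmonicMonomial l) f = 0) : f = 0 := by
  obtain ⟨g, hg, hfg⟩ := f.2
  have hgi : Integrable g diskMeasure := (integrable_coe_Lp f).congr hfg
  have h0 := harmonic_eq_zero_of_forall_integral_eq_zero hg hgi fun l => by
    rw [← h l, Submodule.coe_inner, inner_harmonicMonomial_coe]
    exact integral_congr_ae (hfg.mono fun w hw => by simp only [hw])
  refine Subtype.ext (Lp.ext ?_)
  filter_upwards [hfg, ae_diskMeasure_mem_ball, Lp.coeFn_zero ℂ 2 diskMeasure] with w h1 h2 h3
  rw [h1, h0 w h2, Submodule.coe_zero, h3, Pi.zero_apply]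

/-- The subspace of all `f` with `f = Q f`. -/
theorem exists_fixed_subspace : ∃ S : Submodule ℂ (Lp ℂ 2 diskMeasure),
    IsClosed (S : Set (Lp ℂ 2 diskMeasure)) ∧
      ∀ f, f ∈ S ↔ f =ᵐ[diskMeasure] harmonicProjection f := by
  obtain ⟨k, hk⟩ := exists_harmonicProjection_eq_inner
  have hmem : ∀ f : Lp ℂ 2 diskMeasure, f =ᵐ[diskMeasure] harmonicProjection f ↔
      ∀ᵐ z ∂diskMeasure, f z = inner ℂ (k z) f := by
    intro f
    constructor
    · intro h
      filter_upwards [h, ae_diskMeasure_norm_lt_one] with z h1 h2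
      rw [h1, hk z h2]
    · intro h
      filter_upwards [h, ae_diskMeasure_norm_lt_one] with z h1 h2
      rw [h1, hk z h2]
  refine ⟨{ carrier := {f | ∀ᵐ z ∂diskMeasure, f z = inner ℂ (k z) f}
            add_mem' := ?_
            zero_mem' := ?_
            smul_mem' := ?_ }, ?_, fun f => (hmem f).symm⟩
  · intro f g hf hg
    filter_upwards [hf, hg, Lp.coeFn_add f g] with z h1 h2 h3
    rw [h3, Pi.add_apply, h1, h2, inner_add_right]
  · show ∀ᵐ z ∂diskMeasure, (0 : Lp ℂ 2 diskMeasure) z = inner ℂ (k z) (0 : Lp ℂ 2 diskMeasure)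
    filter_upwards [Lp.coeFn_zero ℂ 2 diskMeasure] with z hz
    rw [hz, inner_zero_right, Pi.zero_apply]
  · intro c f hf
    filter_upwards [hf, Lp.coeFn_smul c f] with z h1 h2
    rw [h2, Pi.smul_apply, h1, inner_smul_right, smul_eq_mul]
  -- A subsequence of an L²-convergent sequence converges almost everywhere, while the inner
  -- products with k z converge for every z; the identity therefore passes to the limit.
  · refine isClosed_of_closure_subset fun f hf => ?_
    obtain ⟨x, hx, hxf⟩ := mem_closure_iff_seq_limit.mp hf
    obtain ⟨ns, hns, hae⟩ := (tendstoInMeasure_of_tendsto_Lp hxf).exists_seq_tendsto_ae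
    have hx' : ∀ᵐ z ∂diskMeasure, ∀ n, x n z = inner ℂ (k z) (x n) := ae_all_iff.mpr hx
    show ∀ᵐ z ∂diskMeasure, f z = inner ℂ (k z) f
    filter_upwards [hae, hx'] with z h1 h2
    refine tendsto_nhds_unique h1 ?_
    simp only [h2]
    exact ((continuous_const.inner continuous_id).tendsto f).comp (hxf.comp hns.tendsto_atTop)

/-- The space is identified with the closed subspace of fixed points of Q. Fixed points are harmonic
because Q f is. Conversely, a harmonic f minus its projection onto the fixed points is harmonic and
orthogonal to every monomial, hence zero by completeness. -/
theorem isClosed_harmonicBergman : IsClosed (harmonicBergman : Set (Lp ℂ 2 diskMeasure)) := by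
  obtain ⟨S, hS, hmem⟩ := exists_fixed_subspace
  suffices h : harmonicBergman = S by rwa [h]
  have hle : S ≤ harmonicBergman := by
    intro f hf
    obtain ⟨g, hg, hfg⟩ := exists_harmonicOnNhd_eqOn_harmonicProjection (integrable_coe_Lp f)
    refine ⟨g, hg, ((hmem f).mp hf).trans ?_⟩
    filter_upwards [ae_diskMeasure_mem_ball] with z hz using hfg hz
  refine le_antisymm (fun f hf => ?_) hle
  have : CompleteSpace S := hS.completeSpace_coe
  have hp : (S.starProjection f : Lp ℂ 2 diskMeasure) ∈ S := Submodule.starProjection_apply_mem S f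
  have h0 : (⟨f - S.starProjection f, sub_mem hf (hle hp)⟩ : harmonicBergman) = 0 := by
    refine eq_zero_of_forall_inner_harmonicMonomial fun l => ?_
    rw [Submodule.coe_inner]
    refine Submodule.inner_right_of_mem_orthogonal (K := S) ?_
      (Submodule.sub_starProjection_mem_orthogonal f)
    refine (hmem _).mpr ?_
    filter_upwards [coeFn_harmonicMonomial l, ae_diskMeasure_norm_lt_one] with z h1 h2
    rw [h1, harmonicProjection_congr (coeFn_harmonicMonomial l),
      harmonicProjection_harmonicMonomialFun l h2]
  have h1 := congrArg Subtype.val h0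
  rw [sub_eq_zero.mp h1]
  exact hp

instance : CompleteSpace harmonicBergman := isClosed_harmonicBergman.completeSpace_coe

/-- The norm of a harmonic monomial, inverted. -/
noncomputable def monomialWeight (l : ℤ) : ℝ := Real.sqrt ((l.natAbs : ℝ) + 1)

theorem monomialWeight_pos (l : ℤ) : 0 < monomialWeight l := Real.sqrt_pos.mpr (by positivity)

theorem monomialWeight_sq (l : ℤ) : monomialWeight l * monomialWeight l = (l.natAbs : ℝ) + 1 :=
  Real.mul_self_sqrt (by positivity)

theorem orthonormal_monomialWeight_smul :
    Orthonormal ℂ fun l => (monomialWeight l : ℂ) • harmonicMonomial l := by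
  classical
  rw [orthonormal_iff_ite]
  intro l k
  rw [inner_smul_left (harmonicMonomial l), inner_smul_right (harmonicMonomial l)
    (harmonicMonomial k), inner_harmonicMonomial, Complex.conj_ofReal]
  rcases eq_or_ne l k with h | h
  · subst h
    rw [if_pos rfl, if_pos rfl, ← mul_assoc, ← Complex.ofReal_mul, monomialWeight_sq]
    have h : (l.natAbs : ℂ) + 1 ≠ 0 := by exact_mod_cast Nat.succ_ne_zero l.natAbs
    push_cast
    field_simp
  · rw [if_neg h, if_neg h.symm, mul_zero, mul_zero]

/-- The orthonormal basis of normalized harmonic monomials. -/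
noncomputable def monomialBasis : HilbertBasis ℤ ℂ harmonicBergman :=
  HilbertBasis.mkOfOrthogonalEqBot orthonormal_monomialWeight_smul (by
    rw [Submodule.eq_bot_iff]
    intro f hf
    refine eq_zero_of_forall_inner_harmonicMonomial fun l => ?_
    have h := Submodule.inner_right_of_mem_orthogonal (Submodule.subset_span (mem_range_self l)) hf
    rw [inner_smul_left (harmonicMonomial l), Complex.conj_ofReal] at h
    exact (mul_eq_zero.mp h).resolve_left (Complex.ofReal_ne_zero.mpr (monomialWeight_pos l).ne'))

theorem monomialBasis_apply (l : ℤ) :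
    monomialBasis l = (monomialWeight l : ℂ) • harmonicMonomial l := by
  rw [monomialBasis, HilbertBasis.coe_mkOfOrthogonalEqBot]

theorem harmonicMonomial_eq_smul (l : ℤ) :
    harmonicMonomial l = ((monomialWeight l : ℂ)⁻¹) • monomialBasis l := by
  rw [monomialBasis_apply, smul_smul,
    inv_mul_cancel₀ (Complex.ofReal_ne_zero.mpr (monomialWeight_pos l).ne'), one_smul]

theorem harmonicMonomial_ne_zero (l : ℤ) : harmonicMonomial l ≠ 0 := by
  intro h
  have := inner_harmonicMonomial l l
  rw [h, inner_zero_left, if_pos rfl] at this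
  exact one_div_ne_zero (by exact_mod_cast Nat.succ_ne_zero l.natAbs) this.symm

theorem linearIndependent_harmonicMonomial : LinearIndependent ℂ harmonicMonomial :=
  linearIndependent_of_ne_zero_of_inner_eq_zero harmonicMonomial_ne_zero fun l k h =>
    (inner_harmonicMonomial l k).trans (if_neg h.symm)

theorem eq_of_forall_harmonicMonomial {S T : harmonicBergman →L[ℂ] harmonicBergman}
    (h : ∀ l, S (harmonicMonomial l) = T (harmonicMonomial l)) : S = T := by
  refine ContinuousLinearMap.ext_on (s := range monomialBasis) ?_ ?_
  · rw [Submodule.dense_iff_topologicalClosure_eq_top]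
    exact monomialBasis.dense_span
  · rintro _ ⟨l, rfl⟩
    simp only [monomialBasis_apply, map_smul, h]

/-- A bounded sequence of coefficients determines a bounded weighted shift of `ℓ²(ℤ)`. -/
theorem exists_weightedShift_lp (k : ℤ) {c : ℤ → ℂ} {M : ℝ} (hc : ∀ l, ‖c l‖ ≤ M) :
    ∃ T : lp (fun _ : ℤ => ℂ) 2 →L[ℂ] lp (fun _ : ℤ => ℂ) 2,
      ∀ x i, T x (k + i) = c i * x i := by
  have hM : 0 ≤ M := (norm_nonneg _).trans (hc 0)
  have h2 : (2 : ENNReal).toReal = 2 := by simp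
  have hle : ∀ (x : lp (fun _ : ℤ => ℂ) 2) (i : ℤ),
      ‖c (i - k) * x (i - k)‖ ^ (2 : ENNReal).toReal ≤ M ^ (2 : ENNReal).toReal *
        ‖x (i - k)‖ ^ (2 : ENNReal).toReal := by
    intro x i
    rw [h2, norm_mul, Real.mul_rpow (norm_nonneg _) (norm_nonneg _)]
    gcongr
    exact hc _
  have hs : ∀ x : lp (fun _ : ℤ => ℂ) 2, HasSum (fun i => ‖x (i - k)‖ ^ (2 : ENNReal).toReal)
      (‖x‖ ^ (2 : ENNReal).toReal) := fun x =>
    (Equiv.subRight k).hasSum_iff.mpr (lp.hasSum_norm (by rw [h2]; norm_num) x)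
  have hsum : ∀ x : lp (fun _ : ℤ => ℂ) 2, Summable fun i =>
      ‖c (i - k) * x (i - k)‖ ^ (2 : ENNReal).toReal := fun x =>
    Summable.of_nonneg_of_le (fun i => by positivity) (hle x) ((hs x).summable.mul_left _)
  let L : lp (fun _ : ℤ => ℂ) 2 →ₗ[ℂ] lp (fun _ : ℤ => ℂ) 2 :=
    { toFun := fun x => ⟨fun i => c (i - k) * x (i - k), memℓp_gen (hsum x)⟩
      map_add' := fun x y => by
        ext i
        exact mul_add _ _ _
      map_smul' := fun a x => by
        ext i
        exact mul_left_comm _ _ _ }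
  refine ⟨L.mkContinuous M fun x => ?_, fun x i => ?_⟩
  · refine lp.norm_le_of_tsum_le (by rw [h2]; norm_num) (by positivity) ?_
    rw [Real.mul_rpow hM (norm_nonneg _), ← (hs x).tsum_eq, ← tsum_mul_left]
    exact (hsum x).tsum_le_tsum (hle x) ((hs x).summable.mul_left _)
  · show c (k + i - k) * x (k + i - k) = _
    rw [add_sub_cancel_left]

/-- A bounded sequence of coefficients determines a bounded weighted shift. -/
theorem exists_weightedShift (k : ℤ) {c : ℤ → ℂ} {M : ℝ} (hc : ∀ l, ‖c l‖ ≤ M) :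
    ∃ T : harmonicBergman →L[ℂ] harmonicBergman,
      ∀ l, T (harmonicMonomial l) = c l • harmonicMonomial (k + l) := by
  set d : ℤ → ℂ := fun l => c l * (monomialWeight l / monomialWeight (k + l) : ℝ) with hd
  have hM : 0 ≤ M := (norm_nonneg _).trans (hc 0)
  have hdb : ∀ l, ‖d l‖ ≤ M * monomialWeight k := by
    intro l
    -- Passing to the orthonormal basis multiplies the coefficients by this ratio of weights. It is
    -- bounded because |l|+1 ≤ (|k|+1)(|k+l|+1).
    have h1 : monomialWeight l ≤ monomialWeight k * monomialWeight (k + l) := by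
      rw [monomialWeight, monomialWeight, monomialWeight, ← Real.sqrt_mul (by positivity)]
      refine Real.sqrt_le_sqrt ?_
      have : l.natAbs ≤ k.natAbs + (k + l).natAbs := by omega
      have : (l.natAbs : ℝ) ≤ k.natAbs + (k + l).natAbs := by exact_mod_cast this
      nlinarith [(Nat.cast_nonneg k.natAbs : (0 : ℝ) ≤ _),
        mul_nonneg (Nat.cast_nonneg (α := ℝ) k.natAbs) (Nat.cast_nonneg (α := ℝ) (k + l).natAbs)]
    rw [hd, norm_mul, Complex.norm_real, Real.norm_of_nonneg
      (div_nonneg (monomialWeight_pos _).le (monomialWeight_pos _).le)]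
    exact mul_le_mul (hc l) ((div_le_iff₀ (monomialWeight_pos _)).mpr h1)
      (div_nonneg (monomialWeight_pos _).le (monomialWeight_pos _).le) hM
  obtain ⟨S, hS⟩ := exists_weightedShift_lp k hdb
  refine ⟨(monomialBasis.repr.symm.toContinuousLinearEquiv : _ →L[ℂ] harmonicBergman) ∘L S ∘L
    (monomialBasis.repr.toContinuousLinearEquiv : harmonicBergman →L[ℂ] _), fun l => ?_⟩
  have hb : S (monomialBasis.repr (monomialBasis l)) =
      d l • monomialBasis.repr (monomialBasis (k + l)) := by
    classical
    ext i
    obtain ⟨j, rfl⟩ : ∃ j, i = k + j := ⟨i - k, by ring⟩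
    rw [hS, monomialBasis.repr_self, monomialBasis.repr_self, lp.coeFn_smul, Pi.smul_apply,
      smul_eq_mul, lp.single_apply, lp.single_apply]
    rcases eq_or_ne j l with h | h
    · subst h
      simp
    · have h' : k + j ≠ k + l := fun e => h (add_left_cancel e)
      simp [h, h']
  have hl := Complex.ofReal_ne_zero.mpr (monomialWeight_pos l).ne'
  have hkl := Complex.ofReal_ne_zero.mpr (monomialWeight_pos (k + l)).ne'
  rw [harmonicMonomial_eq_smul l, map_smul]
  show (monomialWeight l : ℂ)⁻¹ • monomialBasis.repr.symm
    (S (monomialBasis.repr (monomialBasis l))) = _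
  rw [hb, map_smul, LinearIsometryEquiv.symm_apply_apply, monomialBasis_apply, smul_smul, smul_smul]
  congr 1
  simp only [hd]
  push_cast
  field_simp

end HarmonicToeplitz

namespace HarmonicToeplitz

open Filter Topology Set

/-! ### Toeplitz operators with quasihomogeneous symbols -/

theorem harmonicProjection_add {f g : ℂ → ℂ} (hf : Integrable f diskMeasure)
    (hg : Integrable g diskMeasure) {z : ℂ} (hz : ‖z‖ < 1) :
    harmonicProjection (fun w => f w + g w) z =
      harmonicProjection f z + harmonicProjection g z := by
  refine (hasSum_harmonicProjection (hf.add hg) hz).unique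
    (((hasSum_harmonicProjection hf hz).add (hasSum_harmonicProjection hg hz)).congr_fun
      fun l => ?_)
  rw [← mul_add, ← integral_add (integrable_harmonicMonomialFun_mul hf _)
    (integrable_harmonicMonomialFun_mul hg _)]
  simp only [Pi.add_apply, mul_add]

theorem harmonicProjection_const_mul (c : ℂ) (f : ℂ → ℂ) (z : ℂ) :
    harmonicProjection (fun w => c * f w) z = c * harmonicProjection f z := by
  rw [harmonicProjection, harmonicProjection, ← integral_const_mul]
  exact integral_congr_ae (ae_of_all _ fun w => mul_left_comm _ _ _)

/-- A bounded operator extends `p ↦ Q (F p)` if it does so on the harmonic monomials. -/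
theorem isToeplitzExtension_of_harmonicMonomial {F : ℂ → ℂ} (hF : Integrable F diskMeasure)
    {T : harmonicBergman →L[ℂ] harmonicBergman}
    (h : ∀ l, ((T (harmonicMonomial l) : Lp ℂ 2 diskMeasure) : ℂ → ℂ) =ᵐ[diskMeasure]
      harmonicProjection (fun w => F w * harmonicMonomialFun l w)) :
    IsToeplitzExtension F T := by
  -- Integrability of F p is carried through the induction because additivity of Q requires it.
  have key : ∀ p ∈ harmonicPolynomials,
      Integrable (fun w => F w * (p : Lp ℂ 2 diskMeasure) w) diskMeasure ∧
      ((T p : Lp ℂ 2 diskMeasure) : ℂ → ℂ) =ᵐ[diskMeasure]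
        harmonicProjection (fun w => F w * ((p : Lp ℂ 2 diskMeasure) : ℂ → ℂ) w) := by
    intro p hp
    induction hp using Submodule.span_induction with
    | mem p hp =>
      obtain ⟨l, rfl⟩ := hp
      have e : (fun w => F w * (harmonicMonomial l : Lp ℂ 2 diskMeasure) w) =ᵐ[diskMeasure]
          fun w => F w * harmonicMonomialFun l w :=
        (coeFn_harmonicMonomial l).mono fun w hw => by simp only [hw]
      refine ⟨((integrable_harmonicMonomialFun_mul hF l).congr (ae_of_all _ fun w =>
        mul_comm _ _)).congr e.symm, ?_⟩
      rw [harmonicProjection_congr e]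
      exact h l
    | zero =>
      have e : (fun w => F w * ((0 : harmonicBergman) : Lp ℂ 2 diskMeasure) w) =ᵐ[diskMeasure]
          fun _ => 0 :=
        (Lp.coeFn_zero ℂ 2 diskMeasure).mono fun w hw => by
          beta_reduce
          rw [Submodule.coe_zero, hw, Pi.zero_apply, mul_zero]
      refine ⟨(integrable_zero _ _ _).congr e.symm, ?_⟩
      rw [harmonicProjection_congr e, map_zero, Submodule.coe_zero]
      filter_upwards [Lp.coeFn_zero ℂ 2 diskMeasure] with w hw
      rw [hw, harmonicProjection]
      simp
    | add p q _ _ hp hq =>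
      have e : (fun w => F w * ((p + q : harmonicBergman) : Lp ℂ 2 diskMeasure) w) =ᵐ[diskMeasure]
          fun w => F w * (p : Lp ℂ 2 diskMeasure) w + F w * (q : Lp ℂ 2 diskMeasure) w :=
        (Lp.coeFn_add (p : Lp ℂ 2 diskMeasure) q).mono fun w hw => by
          beta_reduce
          rw [Submodule.coe_add, hw, Pi.add_apply, mul_add]
      refine ⟨(hp.1.add hq.1).congr e.symm, ?_⟩
      rw [harmonicProjection_congr e, map_add, Submodule.coe_add]
      filter_upwards [Lp.coeFn_add (T p : Lp ℂ 2 diskMeasure) (T q), hp.2, hq.2,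
        ae_diskMeasure_norm_lt_one] with w h1 h2 h3 h4
      rw [h1, Pi.add_apply, h2, h3, harmonicProjection_add hp.1 hq.1 h4]
    | smul c p _ hp =>
      have e : (fun w => F w * ((c • p : harmonicBergman) : Lp ℂ 2 diskMeasure) w) =ᵐ[diskMeasure]
          fun w => c * (F w * (p : Lp ℂ 2 diskMeasure) w) :=
        (Lp.coeFn_smul c (p : Lp ℂ 2 diskMeasure)).mono fun w hw => by
          beta_reduce
          rw [Submodule.coe_smul, hw, Pi.smul_apply, smul_eq_mul, mul_left_comm]
      refine ⟨(hp.1.const_mul c).congr e.symm, ?_⟩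
      rw [harmonicProjection_congr e, map_smul, Submodule.coe_smul]
      filter_upwards [Lp.coeFn_smul c (T p : Lp ℂ 2 diskMeasure), hp.2] with w h1 h2
      rw [h1, Pi.smul_apply, h2, harmonicProjection_const_mul, smul_eq_mul]
  exact fun p hp => (key p hp).2

/-- The coefficient in the action of the Toeplitz operator of `e^{ikθ} φ` on the harmonic monomial
of index `l`. -/
noncomputable def toeplitzCoeff (φ : ℝ → ℂ) (k l : ℤ) : ℂ :=
  2 * (((|k + l| : ℤ) : ℂ) + 1) * mellinTransform φ ((|l| + |k + l| + 2 : ℤ) : ℂ)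

theorem isToeplitzExtension_quasihomogeneous_iff {φ : ℝ → ℂ} (hφ : RadialIntegrable φ) (k : ℤ)
    (T : harmonicBergman →L[ℂ] harmonicBergman) :
    IsToeplitzExtension (quasihomogeneous k φ) T ↔
      ∀ l, T (harmonicMonomial l) = toeplitzCoeff φ k l • harmonicMonomial (k + l) := by
  have hQ : ∀ l, harmonicProjection (fun w => quasihomogeneous k φ w * harmonicMonomialFun l w)
      =ᵐ[diskMeasure]
      ((toeplitzCoeff φ k l • harmonicMonomial (k + l) : harmonicBergman) :
        Lp ℂ 2 diskMeasure) := by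
    intro l
    rw [Submodule.coe_smul]
    filter_upwards [Lp.coeFn_smul (toeplitzCoeff φ k l)
      (harmonicMonomial (k + l) : Lp ℂ 2 diskMeasure), coeFn_harmonicMonomial (k + l),
      ae_diskMeasure_norm_lt_one] with z h1 h2 h3
    rw [h1, Pi.smul_apply, h2, harmonicProjection_quasihomogeneous_mul hφ k l h3, smul_eq_mul,
      toeplitzCoeff]
  constructor
  · intro h l
    refine Subtype.ext (Lp.ext ((h _ (Submodule.subset_span (mem_range_self l))).trans ?_))
    rw [harmonicProjection_congr (g := fun w => quasihomogeneous k φ w * harmonicMonomialFun l w)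
      ((coeFn_harmonicMonomial l).mono fun w hw => by simp only [hw])]
    exact hQ l
  · intro h
    refine isToeplitzExtension_of_harmonicMonomial (integrable_quasihomogeneous hφ k) fun l => ?_
    rw [h l]
    exact (hQ l).symm

theorem toeplitz_quasihomogeneous_apply {φ : ℝ → ℂ} (hφ : RadialIntegrable φ) {k : ℤ}
    (h : IsTFunction (quasihomogeneous k φ)) (l : ℤ) :
    toeplitz (quasihomogeneous k φ) (harmonicMonomial l) =
      toeplitzCoeff φ k l • harmonicMonomial (k + l) := by
  rw [toeplitz, dif_pos h]
  exact (isToeplitzExtension_quasihomogeneous_iff hφ k _).mp h.2.choose_spec l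

theorem norm_abs_add_one (n : ℤ) : ‖((|n| : ℤ) : ℂ) + 1‖ = (n.natAbs : ℝ) + 1 := by
  rw [Int.abs_eq_natAbs, Int.cast_natCast,
    show (n.natAbs : ℂ) + 1 = (((n.natAbs : ℝ) + 1 : ℝ) : ℂ) by push_cast; rfl,
    Complex.norm_real, Real.norm_of_nonneg (by positivity)]

/-- The weight is 2(|k+l|+1) times the Mellin value at n+2 with n = |l|+|k+l|, and |k+l|+1 ≤ n+1. So
decay of order 1/n bounds all the shifts at once, uniformly in k. -/
theorem isTFunction_quasihomogeneous {φ : ℝ → ℂ} (hφ : RadialIntegrable φ) {M : ℝ}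
    (hM : ∀ n : ℕ, ((n : ℝ) + 1) * ‖mellinTransform φ (n + 2)‖ ≤ M) (k : ℤ) :
    IsTFunction (quasihomogeneous k φ) := by
  refine ⟨integrable_quasihomogeneous hφ k, ?_⟩
  obtain ⟨T, hT⟩ := exists_weightedShift k (c := toeplitzCoeff φ k) (M := 2 * M) fun l => by
    have h := hM (l.natAbs + (k + l).natAbs)
    have e : ((|l| + |k + l| + 2 : ℤ) : ℂ) = ((l.natAbs + (k + l).natAbs : ℕ) : ℂ) + 2 := by
      rw [Int.abs_eq_natAbs, Int.abs_eq_natAbs, ← Nat.cast_add, Int.cast_add, Int.cast_natCast,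
        Int.cast_ofNat]
    rw [toeplitzCoeff, norm_mul, norm_mul, norm_abs_add_one, e, Complex.norm_ofNat, mul_assoc]
    refine mul_le_mul_of_nonneg_left (le_trans ?_ h) zero_le_two
    push_cast
    refine mul_le_mul_of_nonneg_right ?_ (norm_nonneg _)
    linarith [(Nat.cast_nonneg l.natAbs : (0 : ℝ) ≤ _)]
  exact ⟨T, (isToeplitzExtension_quasihomogeneous_iff hφ k T).mpr hT⟩

/-- The n+1 copies of r^n are dominated by the geometric sum 1 + r + ... + r^n, and multiplication
by 1-r telescopes. -/
theorem succ_mul_pow_mul_one_sub_le {r : ℝ} (hr0 : 0 ≤ r) (hr1 : r ≤ 1) (n : ℕ) :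
    ((n : ℝ) + 1) * (r ^ n * (1 - r)) ≤ 1 := by
  have h1 : ((n : ℝ) + 1) * r ^ n ≤ ∑ i ∈ Finset.range (n + 1), r ^ i := by
    have := Finset.card_nsmul_le_sum (Finset.range (n + 1)) (fun i => r ^ i) (r ^ n) fun i hi =>
      pow_le_pow_of_le_one hr0 hr1 (Nat.lt_succ_iff.mp (Finset.mem_range.mp hi))
    rw [Finset.card_range, nsmul_eq_mul] at this
    exact_mod_cast this
  have h2 := geom_sum_mul_neg r (n + 1)
  rw [← mul_assoc]
  refine (mul_le_mul_of_nonneg_right h1 (sub_nonneg.mpr hr1)).trans ?_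
  rw [h2]
  linarith [pow_nonneg hr0 (n + 1)]

theorem mellinTransform_natCast_add_two (φ : ℝ → ℂ) (n : ℕ) :
    mellinTransform φ (n + 2) = ∫ r in Ioo (0 : ℝ) 1, (r : ℂ) * φ r * (r : ℂ) ^ n := by
  rw [mellinTransform_eq_setIntegral]
  simp only [add_sub_cancel_right, Complex.cpow_natCast]

/-- The difference of consecutive moments carries the factor r^n(1-r) ≤ 1/(n+1). This transfers
decay from even to odd indices for any integrable radial φ. -/
theorem norm_mellinTransform_sub_le {φ : ℝ → ℂ} (hφ : RadialIntegrable φ) (n : ℕ) :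
    ((n : ℝ) + 1) * ‖mellinTransform φ (n + 2) - mellinTransform φ ((n + 1 : ℕ) + 2)‖ ≤
      ∫ r in Ioo (0 : ℝ) 1, ‖(r : ℂ) * φ r‖ := by
  have hi : ∀ j : ℕ, IntegrableOn (fun r : ℝ => (r : ℂ) * φ r * (r : ℂ) ^ j) (Ioo 0 1) := by
    intro j
    have h : IntegrableOn (fun r : ℝ => (r : ℂ) * (φ r * (r : ℂ) ^ j)) (Ioo 0 1) := hφ.mul_pow j
    simpa only [mul_assoc] using h
  have hn : (0 : ℝ) < n + 1 := by positivity
  rw [mellinTransform_natCast_add_two, mellinTransform_natCast_add_two,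
    ← integral_sub (hi _) (hi _),
    mul_comm, ← le_div_iff₀ hn, ← integral_div]
  refine norm_integral_le_of_norm_le (hφ.norm.div_const _) ?_
  filter_upwards [ae_restrict_mem measurableSet_Ioo] with r hr
  rw [show (r : ℂ) * φ r * (r : ℂ) ^ n - (r : ℂ) * φ r * (r : ℂ) ^ (n + 1) =
    (r : ℂ) * φ r * ((r ^ n * (1 - r) : ℝ) : ℂ) by push_cast; ring, norm_mul, Complex.norm_real,
    Real.norm_of_nonneg (mul_nonneg (pow_nonneg hr.1.le _) (sub_nonneg.mpr hr.2.le)),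
    div_eq_mul_inv]
  refine mul_le_mul_of_nonneg_left ?_ (norm_nonneg _)
  rw [← one_div, le_div_iff₀ hn, mul_comm]
  exact succ_mul_pow_mul_one_sub_le hr.1.le hr.2.le n

/-- The Mellin coefficients of a radial T-function decay. -/
theorem exists_mellinTransform_bound {φ : ℝ → ℂ} (hφ : IsTFunction fun z : ℂ => φ ‖z‖) :
    ∃ M : ℝ, ∀ n : ℕ, ((n : ℝ) + 1) * ‖mellinTransform φ (n + 2)‖ ≤ M := by
  have hr : RadialIntegrable φ := (integrable_radial_iff φ).mp hφ.1
  obtain ⟨T, hT⟩ := hφ.2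
  have e : (fun z : ℂ => φ ‖z‖) = quasihomogeneous 0 φ :=
    funext fun z => (quasihomogeneous_zero φ z).symm
  rw [e, isToeplitzExtension_quasihomogeneous_iff hr] at hT
  -- Boundedness of the operator of φ itself sees only the even moments: they give its eigenvalues
  -- 2(j+1) φ̂(2j+2) on the monomials.
  have heven : ∀ j : ℕ, 2 * ((j : ℝ) + 1) * ‖mellinTransform φ ((2 * j : ℕ) + 2)‖ ≤ ‖T‖ := by
    intro j
    have h := T.le_opNorm (harmonicMonomial j)
    rw [hT j, zero_add, norm_smul] at h
    have h1 := le_of_mul_le_mul_right h (norm_pos_iff.mpr (harmonicMonomial_ne_zero j))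
    rw [toeplitzCoeff, zero_add, norm_mul, norm_mul, norm_abs_add_one, Complex.norm_ofNat,
      Int.natAbs_natCast] at h1
    rwa [show ((|(j : ℤ)| + |(j : ℤ)| + 2 : ℤ) : ℂ) = ((2 * j : ℕ) : ℂ) + 2 by
      rw [Nat.abs_cast]
      push_cast
      ring] at h1
  refine ⟨‖T‖ + 2 * ∫ r in Ioo (0 : ℝ) 1, ‖(r : ℂ) * φ r‖, fun n => ?_⟩
  have hI : 0 ≤ ∫ r in Ioo (0 : ℝ) 1, ‖(r : ℂ) * φ r‖ := integral_nonneg fun r => norm_nonneg _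
  obtain ⟨j, rfl | rfl⟩ := n.even_or_odd'
  · have h := heven j
    have := norm_nonneg (mellinTransform φ ((2 * j : ℕ) + 2))
    push_cast at h this ⊢
    linarith
  · have h := heven j
    have h1 := norm_mellinTransform_sub_le hr (2 * j)
    have h2 := norm_sub_norm_le (mellinTransform φ ((2 * j + 1 : ℕ) + 2))
      (mellinTransform φ ((2 * j : ℕ) + 2))
    rw [norm_sub_rev] at h2
    set a := ‖mellinTransform φ ((2 * j + 1 : ℕ) + 2)‖
    set b := ‖mellinTransform φ ((2 * j : ℕ) + 2)‖
    set d := ‖mellinTransform φ ((2 * j : ℕ) + 2) - mellinTransform φ ((2 * j + 1 : ℕ) + 2)‖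
    have hd : 0 ≤ d := norm_nonneg _
    have hj : (0 : ℝ) ≤ j := Nat.cast_nonneg j
    push_cast at h1 ⊢
    nlinarith [mul_le_mul_of_nonneg_left h2 (by positivity : (0 : ℝ) ≤ 2 * j + 1 + 1),
      mul_nonneg hj hd]

theorem IsTFunction.quasihomogeneous {φ : ℝ → ℂ} (hφ : IsTFunction fun z : ℂ => φ ‖z‖) (k : ℤ) :
    IsTFunction (quasihomogeneous k φ) := by
  obtain ⟨M, hM⟩ := exists_mellinTransform_bound hφ
  exact isTFunction_quasihomogeneous ((integrable_radial_iff φ).mp hφ.1) hM k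

theorem radialEq_rpow (m : ℝ) :
    RadialEq (fun r => ((r ^ m : ℝ) : ℂ)) fun r => 1 * (r : ℂ) ^ (m : ℂ) := by
  filter_upwards [ae_restrict_mem measurableSet_Ioo] with r hr
  rw [one_mul, Complex.ofReal_cpow hr.1.le]

theorem radialIntegrable_rpow {m : ℝ} (hm : -1 ≤ m) :
    RadialIntegrable fun r => ((r ^ m : ℝ) : ℂ) := by
  refine (radialIntegrable_const_mul_cpow 1 (s := m) ?_).congr
    ((radialEq_rpow m).mono fun r h => h.symm)
  rw [Complex.ofReal_re]
  linarith

theorem mellinTransform_rpow {m : ℝ} {z : ℂ} (hz : 0 < (z + m).re) :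
    mellinTransform (fun r => ((r ^ m : ℝ) : ℂ)) z = 1 / (z + m) := by
  rw [mellinTransform_congr (radialEq_rpow m), mellinTransform_const_mul_cpow 1 m hz]

theorem isTFunction_quasihomogeneous_rpow {m : ℝ} (hm : -1 ≤ m) (k : ℤ) :
    IsTFunction (HarmonicToeplitz.quasihomogeneous k fun r => ((r ^ m : ℝ) : ℂ)) := by
  refine isTFunction_quasihomogeneous (radialIntegrable_rpow hm) (M := 1) (fun n => ?_) k
  have hn : (0 : ℝ) < n + 2 + m := by linarith [(Nat.cast_nonneg n : (0 : ℝ) ≤ n)]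
  have e : (n : ℂ) + 2 + m = ((n + 2 + m : ℝ) : ℂ) := by push_cast; rfl
  rw [mellinTransform_rpow (by rw [e, Complex.ofReal_re]; exact hn), e, norm_div, norm_one,
    Complex.norm_real, Real.norm_of_nonneg hn.le, mul_one_div, div_le_one hn]
  linarith

/-- The action of the commutator on the harmonic monomials. -/
theorem operatorCommutator_toeplitz_apply {φ : ℝ → ℂ} (hφ : IsTFunction fun z : ℂ => φ ‖z‖)
    {m : ℝ} (hm : -1 ≤ m) (k₁ k₂ l : ℤ) :
    operatorCommutator
        (toeplitz (HarmonicToeplitz.quasihomogeneous k₁ fun r => ((r ^ m : ℝ) : ℂ)))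
        (toeplitz (HarmonicToeplitz.quasihomogeneous k₂ φ)) (harmonicMonomial l) =
      (4 * (((|l + k₁ + k₂| : ℤ) : ℂ) + 1) *
        commCoeff (fun n => mellinTransform φ n) k₁ k₂ (m : ℂ) l) •
          harmonicMonomial (l + k₁ + k₂) := by
  have hr : RadialIntegrable φ := (integrable_radial_iff φ).mp hφ.1
  have h1 := toeplitz_quasihomogeneous_apply (radialIntegrable_rpow hm)
    (isTFunction_quasihomogeneous_rpow hm k₁)
  have h2 := toeplitz_quasihomogeneous_apply hr (hφ.quasihomogeneous k₂)
  have h3 : ∀ k j : ℤ, mellinTransform (fun r => ((r ^ m : ℝ) : ℂ)) ((|j| + |k + j| + 2 : ℤ) : ℂ) =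
      1 / (((|j| : ℤ) : ℂ) + ((|k + j| : ℤ) : ℂ) + 2 + m) := by
    intro k j
    rw [mellinTransform_rpow]
    · rw [Int.cast_add, Int.cast_add, Int.cast_ofNat]
    · have : (0 : ℝ) ≤ ((|j| + |k + j| : ℤ) : ℝ) := Int.cast_nonneg (by positivity)
      rw [Complex.add_re, Complex.intCast_re, Complex.ofReal_re, Int.cast_add _ (2 : ℤ),
        Int.cast_ofNat]
      linarith
  rw [operatorCommutator, sub_apply, ContinuousLinearMap.comp_apply,
    ContinuousLinearMap.comp_apply, h1, h2, map_smul, map_smul, h1, h2, smul_smul, smul_smul]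
  rw [show k₂ + (k₁ + l) = l + k₁ + k₂ by ring, show k₁ + (k₂ + l) = l + k₁ + k₂ by ring,
    ← sub_smul]
  congr 1
  simp only [toeplitzCoeff, commCoeff, h3]
  rw [show k₂ + (k₁ + l) = l + k₁ + k₂ by ring, show k₁ + (k₂ + l) = l + k₁ + k₂ by ring,
    show k₁ + l = l + k₁ by ring, show k₂ + l = l + k₂ by ring]
  ring

end HarmonicToeplitz

namespace HarmonicToeplitz

open Filter Topology Set

/-! ### Weighted shifts of finite rank -/

/-- Every nonzero weight puts a monomial into the range, and distinct monomials are linearly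
independent. -/
theorem finite_support_of_hasFiniteRank {A : harmonicBergman →L[ℂ] harmonicBergman} {a : ℤ → ℂ}
    {n : ℤ} (hA : ∀ l, A (harmonicMonomial l) = a l • harmonicMonomial (l + n))
    (h : HasFiniteRank A) : {l | a l ≠ 0}.Finite := by
  have : FiniteDimensional ℂ (LinearMap.range A.toLinearMap).topologicalClosure := h
  have hmem : ∀ l : {l | a l ≠ 0},
      harmonicMonomial (l + n) ∈ (LinearMap.range A.toLinearMap).topologicalClosure := by
    intro l
    refine Submodule.le_topologicalClosure _ ⟨(a l)⁻¹ • harmonicMonomial l, ?_⟩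
    show A _ = _
    rw [map_smul, hA, smul_smul, inv_mul_cancel₀ l.2, one_smul]
  have hli : LinearIndependent ℂ fun l : {l | a l ≠ 0} =>
      (⟨harmonicMonomial (l + n), hmem l⟩ :
        (LinearMap.range A.toLinearMap).topologicalClosure) := by
    refine LinearIndependent.of_comp (Submodule.subtype _) ?_
    exact linearIndependent_harmonicMonomial.comp (fun l : {l | a l ≠ 0} => (l : ℤ) + n)
      fun x y hxy => Subtype.ext (add_right_cancel hxy)
  have := hli.finite
  exact toFinite _

theorem tensor_harmonicMonomial_apply (i j l : ℤ) :
    tensor (harmonicMonomial i) (harmonicMonomial j) (harmonicMonomial l) =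
      if l = j then (1 / ((j.natAbs : ℂ) + 1)) • harmonicMonomial i else 0 := by
  rw [tensor, InnerProductSpace.rankOne_apply, inner_harmonicMonomial]
  split_ifs
  · rfl
  · exact zero_smul _ _

/-- The reflection pairs the output index k with k₁+k₂-k, and antisymmetry makes the two rank one
terms share one constant up to sign. The extra factor |k-k₁-k₂|+1 in the constant undoes the squared
norm of the monomial in the tensor. -/
theorem eq_sum_halfIndexSet {k₁ k₂ : ℤ} {d : ℤ → ℂ} (hd : ∀ l, d (-l - k₁ - k₂) = -d l)
    (hsupp : ∀ l, d l ≠ 0 → l + k₁ + k₂ ∈ indexSet k₁ k₂)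
    {A : harmonicBergman →L[ℂ] harmonicBergman}
    (hA : ∀ l, A (harmonicMonomial l) =
      (4 * (((|l + k₁ + k₂| : ℤ) : ℂ) + 1) * d l) • harmonicMonomial (l + k₁ + k₂)) :
    A = ∑ k ∈ halfIndexSet k₁ k₂,
      (4 * ((k.natAbs : ℂ) + 1) * (((k - k₁ - k₂).natAbs : ℂ) + 1) * d (k - k₁ - k₂)) •
        (tensor (harmonicMonomial k) (harmonicMonomial (k - k₁ - k₂)) -
          tensor (harmonicMonomial (-k + k₁ + k₂)) (harmonicMonomial (-k))) := by
  have habs : ∀ n : ℤ, ((|n| : ℤ) : ℂ) = n.natAbs := fun n => by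
    rw [Int.abs_eq_natAbs, Int.cast_natCast]
  have hne : ∀ n : ℤ, (n.natAbs : ℂ) + 1 ≠ 0 := fun n => by exact_mod_cast Nat.succ_ne_zero n.natAbs
  have hhalf : ∀ k, k ∈ halfIndexSet k₁ k₂ ↔ k₁ + k₂ < 2 * k ∧ k ≤ boundN k₁ k₂ + k₁ + k₂ - 1 := by
    intro k
    rw [mem_halfIndexSet, div_lt_iff₀ two_pos, mul_comm]
    norm_cast
  refine eq_of_forall_harmonicMonomial fun l => ?_
  rw [hA, sum_apply]
  have hterm : ∀ k ∈ halfIndexSet k₁ k₂,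
      ((4 * ((k.natAbs : ℂ) + 1) * (((k - k₁ - k₂).natAbs : ℂ) + 1) * d (k - k₁ - k₂)) •
        (tensor (harmonicMonomial k) (harmonicMonomial (k - k₁ - k₂)) -
          tensor (harmonicMonomial (-k + k₁ + k₂)) (harmonicMonomial (-k)))) (harmonicMonomial l) =
      (if l + k₁ + k₂ = k then (4 * (((|l + k₁ + k₂| : ℤ) : ℂ) + 1) * d l) •
        harmonicMonomial (l + k₁ + k₂) else 0) +
      (if -l = k then (4 * (((|l + k₁ + k₂| : ℤ) : ℂ) + 1) * d l) •
        harmonicMonomial (l + k₁ + k₂) else 0) := by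
    intro k _
    rw [smul_apply, sub_apply, tensor_harmonicMonomial_apply, tensor_harmonicMonomial_apply,
      smul_sub, sub_eq_add_neg, ← smul_neg]
    congr 1
    · rcases eq_or_ne (l + k₁ + k₂) k with h | h
      · subst h
        rw [if_pos rfl, if_pos (by ring), smul_smul, show l + k₁ + k₂ - k₁ - k₂ = l by ring, habs]
        congr 1
        have := hne l
        field_simp
      · rw [if_neg h, if_neg fun e => h (by rw [e]; ring), smul_zero]
    · rcases eq_or_ne (-l) k with h | h
      · subst h
        rw [if_pos rfl, if_pos (by ring), ← neg_smul, smul_smul, hd, habs, Int.natAbs_neg, neg_neg,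
          show -l - k₁ - k₂ = -(l + k₁ + k₂) by ring, Int.natAbs_neg]
        congr 1
        have := hne l
        field_simp
      · rw [if_neg h, if_neg fun e => h (by rw [e]; ring), neg_zero, smul_zero]
  rw [Finset.sum_congr rfl hterm, Finset.sum_add_distrib, Finset.sum_ite_eq, Finset.sum_ite_eq]
  by_cases h1 : l + k₁ + k₂ ∈ halfIndexSet k₁ k₂
  · have h2 : -l ∉ halfIndexSet k₁ k₂ := fun h2 => by
      rw [hhalf] at h1 h2
      omega
    rw [if_pos h1, if_neg h2, add_zero]
  · by_cases h2 : -l ∈ halfIndexSet k₁ k₂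
    · rw [if_neg h1, if_pos h2, zero_add]
    · have h0 : d l = 0 := by
        by_contra h
        have h3 := mem_indexSet.mp (hsupp l h)
        rw [hhalf] at h1 h2
        omega
      rw [if_neg h1, if_neg h2, h0, mul_zero, zero_smul, add_zero]

theorem sub_mem_indexSet {k₁ k₂ k : ℤ} (h : k ∈ indexSet k₁ k₂) :
    -k + k₁ + k₂ ∈ indexSet k₁ k₂ := by
  rw [mem_indexSet] at h ⊢
  omega

theorem halfIndexSet_subset {k₁ k₂ k : ℤ} (h : k ∈ halfIndexSet k₁ k₂)  :
    k ∈ indexSet k₁ k₂ := by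
  rw [mem_halfIndexSet, div_lt_iff₀ two_pos, mul_comm] at h
  have h1 : k₁ + k₂ < 2 * k := by exact_mod_cast h.1
  have h2 := h.2
  have hN : -k₁ - k₂ ≤ 2 * boundN k₁ k₂ := by
    simp only [boundN]
    omega
  rw [mem_indexSet]
  omega

/-- The range of a finite sum of rank one operators with the support of the commutator. -/
theorem range_eq_span {k₁ k₂ : ℤ} {a : ℤ → ℂ} {A : harmonicBergman →L[ℂ] harmonicBergman}
    (hA : ∀ l, A (harmonicMonomial l) = a l • harmonicMonomial (l + k₁ + k₂))
    (ha : ∀ l, l + k₁ + k₂ ∈ indexSet k₁ k₂ → a l ≠ 0) {C : ℤ → ℂ}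
    (hsum : A = ∑ k ∈ halfIndexSet k₁ k₂, C k •
      (tensor (harmonicMonomial k) (harmonicMonomial (k - k₁ - k₂)) -
        tensor (harmonicMonomial (-k + k₁ + k₂)) (harmonicMonomial (-k)))) :
    LinearMap.range A.toLinearMap = Submodule.span ℂ (harmonicMonomial '' indexSet k₁ k₂) := by
  refine le_antisymm ?_ (Submodule.span_le.mpr ?_)
  · rintro _ ⟨f, rfl⟩
    show A f ∈ _
    -- For a general f the action on monomials is not enough; the finite sum shows that A f is a
    -- combination of the listed monomials.
    rw [hsum, sum_apply]
    refine Submodule.sum_mem _ fun k hk => Submodule.smul_mem _ _ ?_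
    have hk' := halfIndexSet_subset hk
    show tensor _ _ f - tensor _ _ f ∈ _
    rw [tensor, tensor, InnerProductSpace.rankOne_apply, InnerProductSpace.rankOne_apply]
    exact sub_mem (Submodule.smul_mem _ _ (Submodule.subset_span (mem_image_of_mem _ hk')))
      (Submodule.smul_mem _ _ (Submodule.subset_span (mem_image_of_mem _ (sub_mem_indexSet hk'))))
  · rintro _ ⟨k, hk, rfl⟩
    obtain ⟨l, rfl⟩ : ∃ l, k = l + k₁ + k₂ := ⟨k - k₁ - k₂, by ring⟩
    refine ⟨(a l)⁻¹ • harmonicMonomial l, ?_⟩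
    show A _ = _
    rw [map_smul, hA, smul_smul, inv_mul_cancel₀ (ha l hk), one_smul]

theorem indexSet_eq_coe (k₁ k₂ : ℤ) : indexSet k₁ k₂ =
    ((Finset.Icc (-boundN k₁ k₂ + 1) (boundN k₁ k₂ + k₁ + k₂ - 1)).filter
      fun k => 2 * k ≠ k₁ + k₂ : Finset ℤ) := by
  ext k
  rw [mem_indexSet, Finset.coe_filter, mem_ofPred_eq, Finset.mem_Icc, and_assoc]

/-- The interval in the definition of the index set thus has |k₁|+|k₂|-1 elements; for k₁+k₂ even it
also contains the midpoint, which is removed. -/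
theorem two_mul_boundN_add {k₁ k₂ : ℤ} (h : k₁ * k₂ < -1 ∨ 0 < k₁ * k₂) :
    2 * boundN k₁ k₂ + k₁ + k₂ = k₁.natAbs + k₂.natAbs ∧ 1 ≤ k₁.natAbs ∧ 1 ≤ k₂.natAbs := by
  have h1 : k₁ ≠ 0 := by
    rintro rfl
    omega
  have h2 : k₂ ≠ 0 := by
    rintro rfl
    omega
  simp only [boundN]
  omega

theorem rank_span_indexSet (k₁ k₂ : ℤ) :
    Module.rank ℂ (Submodule.span ℂ (harmonicMonomial '' indexSet k₁ k₂)) =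
      (((Finset.Icc (-boundN k₁ k₂ + 1) (boundN k₁ k₂ + k₁ + k₂ - 1)).filter
        fun k => 2 * k ≠ k₁ + k₂).card : Cardinal) := by
  have hli : LinearIndepOn ℂ id (harmonicMonomial '' indexSet k₁ k₂) :=
    (linearIndependent_harmonicMonomial.linearIndepOn _).id_image
  rw [rank_span_set hli, Cardinal.mk_image_eq linearIndependent_harmonicMonomial.injective,
    indexSet_eq_coe, Finset.coe_sort_coe, Cardinal.mk_coe_finset]

theorem card_indexSet_of_odd {k₁ k₂ : ℤ} (h : k₁ * k₂ < -1 ∨ 0 < k₁ * k₂) (ho : Odd (k₁ + k₂)) :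
    ((Finset.Icc (-boundN k₁ k₂ + 1) (boundN k₁ k₂ + k₁ + k₂ - 1)).filter
      fun k => 2 * k ≠ k₁ + k₂).card = k₁.natAbs + k₂.natAbs - 1 := by
  have hN := two_mul_boundN_add h
  obtain ⟨c, hc⟩ := ho
  rw [Finset.filter_true_of_mem fun k _ => by omega, Int.card_Icc]
  omega

theorem card_indexSet_of_even {k₁ k₂ : ℤ} (h : k₁ * k₂ < -1 ∨ 0 < k₁ * k₂)
    (he : Even (k₁ + k₂)) :
    ((Finset.Icc (-boundN k₁ k₂ + 1) (boundN k₁ k₂ + k₁ + k₂ - 1)).filter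
      fun k => 2 * k ≠ k₁ + k₂).card = k₁.natAbs + k₂.natAbs - 2 := by
  have hN := two_mul_boundN_add h
  obtain ⟨c, hc⟩ := he
  have : (Finset.Icc (-boundN k₁ k₂ + 1) (boundN k₁ k₂ + k₁ + k₂ - 1)).filter
      (fun k => 2 * k ≠ k₁ + k₂) =
      (Finset.Icc (-boundN k₁ k₂ + 1) (boundN k₁ k₂ + k₁ + k₂ - 1)).erase c := by
    ext k
    rw [Finset.mem_filter, Finset.mem_erase, Finset.mem_Icc]
    omega
  rw [this, Finset.card_erase_of_mem (Finset.mem_Icc.mpr (by omega)), Int.card_Icc]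
  omega

theorem hasFiniteRank_of_finiteDimensional_range {A : harmonicBergman →L[ℂ] harmonicBergman}
    (h : FiniteDimensional ℂ (LinearMap.range A.toLinearMap)) : HasFiniteRank A := by
  have hc : IsClosed (LinearMap.range A.toLinearMap : Set harmonicBergman) :=
    Submodule.closed_of_finiteDimensional _
  rw [HasFiniteRank, hc.submodule_topologicalClosure_eq]
  exact h

end HarmonicToeplitz

/-! ### Assembly of the theorem -/

open HarmonicToeplitz

theorem mainTheorem4 (k₁ k₂ : ℤ) (m : ℝ) (hm : -1 ≤ m) (φ : ℝ → ℂ)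
    (hφ : IsTFunction (fun z : ℂ => φ ‖z‖)) (hφ0 : ¬ RadialEq φ (fun _ => 0)) :
    let f₁ : ℂ → ℂ := quasihomogeneous k₁ (fun r => ((r ^ m : ℝ) : ℂ))
    let f₂ : ℂ → ℂ := quasihomogeneous k₂ φ
    let A := operatorCommutator (toeplitz f₁) (toeplitz f₂)
    IsTFunction f₁ ∧ IsTFunction f₂ ∧
    (HasFiniteRank A ↔ VanishingCase k₁ k₂ m φ ∨ NonvanishingCase k₁ k₂ m φ) ∧
    (VanishingCase k₁ k₂ m φ → A = 0 ∧ operatorRank A = 0) ∧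
    (NonvanishingCase k₁ k₂ m φ →
      LinearMap.range A.toLinearMap =
        Submodule.span ℂ (harmonicMonomial '' indexSet k₁ k₂) ∧
      (∃ C : ℤ → ℂ, (∀ k ∈ halfIndexSet k₁ k₂, C k ≠ 0) ∧
        A = ∑ k ∈ halfIndexSet k₁ k₂, C k •
          (tensor (harmonicMonomial k) (harmonicMonomial (k - k₁ - k₂)) -
            tensor (harmonicMonomial (-k + k₁ + k₂)) (harmonicMonomial (-k)))) ∧
      (Odd (k₁ + k₂) → operatorRank A = ((k₁.natAbs + k₂.natAbs - 1 : ℕ) : Cardinal)) ∧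
      (Even (k₁ + k₂) → operatorRank A = ((k₁.natAbs + k₂.natAbs - 2 : ℕ) : Cardinal))) := by
  intro f₁ f₂ A
  have hr : RadialIntegrable φ := (integrable_radial_iff φ).mp hφ.1
  set d : ℤ → ℂ := commCoeff (fun n => mellinTransform φ n) k₁ k₂ (m : ℂ) with hd
  have hA : ∀ l, A (harmonicMonomial l) =
      (4 * (((|l + k₁ + k₂| : ℤ) : ℂ) + 1) * d l) • harmonicMonomial (l + k₁ + k₂) :=
    operatorCommutator_toeplitz_apply hφ hm k₁ k₂
  have hne : ∀ n : ℤ, ((|n| : ℤ) : ℂ) + 1 ≠ 0 := fun n => by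
    rw [Int.abs_eq_natAbs, Int.cast_natCast]
    exact_mod_cast Nat.succ_ne_zero n.natAbs
  have h4 : (4 : ℂ) ≠ 0 := by norm_num
  have hV : VanishingCase k₁ k₂ m φ → A = 0 := fun h =>
    eq_of_forall_harmonicMonomial fun l => by
      rw [hA, show d l = 0 from commCoeff_eq_zero_of_vanishingCase hm h l, mul_zero, zero_smul,
        zero_apply]
  have hsum : NonvanishingCase k₁ k₂ m φ → _ := fun h =>
    eq_sum_halfIndexSet (commCoeff_reflect _ k₁ k₂ _)
      (fun l => (commCoeff_ne_zero_iff hr hφ0 hm h l).mp) hA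
  have hrange : NonvanishingCase k₁ k₂ m φ → LinearMap.range A.toLinearMap =
      Submodule.span ℂ (harmonicMonomial '' indexSet k₁ k₂) := fun h =>
    range_eq_span hA (fun l hl => mul_ne_zero (mul_ne_zero h4 (hne _))
      ((commCoeff_ne_zero_iff hr hφ0 hm h l).mpr hl)) (hsum h)
  refine ⟨isTFunction_quasihomogeneous_rpow hm k₁, hφ.quasihomogeneous k₂, ⟨fun h => ?_, ?_⟩,
    fun h => ⟨hV h, ?_⟩, fun h => ⟨hrange h, ⟨_, fun k hk => ?_, hsum h⟩, fun ho => ?_, fun he => ?_⟩⟩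
  -- Finite rank gives finite support of the full weights; the factor 4(|l+k₁+k₂|+1) never vanishes,
  -- so the support of d is finite as well.
  · refine cases_of_commCoeff_finite_support hr hφ0 hm ?_
    refine (finite_support_of_hasFiniteRank (n := k₁ + k₂) (fun l => ?_) h).subset fun l hl =>
      mul_ne_zero (mul_ne_zero h4 (hne (l + k₁ + k₂))) hl
    rw [hA, add_assoc l]
  · rintro (h | h)
    · refine hasFiniteRank_of_finiteDimensional_range ?_
      rw [hV h, ContinuousLinearMap.toLinearMap_zero, LinearMap.range_zero]
      infer_instance
    · refine hasFiniteRank_of_finiteDimensional_range ?_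
      rw [hrange h]
      refine FiniteDimensional.span_of_finite ℂ (Set.Finite.image _ ?_)
      rw [indexSet_eq_coe]
      exact Finset.finite_toSet _
  · rw [hV h, operatorRank, ContinuousLinearMap.toLinearMap_zero, LinearMap.range_zero, rank_bot]
  · have h1 := (commCoeff_ne_zero_iff hr hφ0 hm h (k - k₁ - k₂)).mpr (by
      rw [show k - k₁ - k₂ + k₁ + k₂ = k by ring]
      exact halfIndexSet_subset hk)
    have hnat : ∀ n : ℤ, (n.natAbs : ℂ) + 1 ≠ 0 := fun n => by
      exact_mod_cast Nat.succ_ne_zero n.natAbs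
    exact mul_ne_zero (mul_ne_zero (mul_ne_zero h4 (hnat _)) (hnat _)) h1
  · rw [operatorRank, hrange h, rank_span_indexSet,
      card_indexSet_of_odd (nonvanishingCase_mul_ne h) ho]
  · rw [operatorRank, hrange h, rank_span_indexSet,
      card_indexSet_of_even (nonvanishingCase_mul_ne h) he]
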